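/- Let $G$ be a finite simple graph. A total colouring of $G$ assigns a colour to every vertex and every edge; it is proper if adjacent vertices, adjacent edges, and incident vertices and edges receive different colours. A proper total colouring $c$ is harmonious if no unordered pair of colours occurs twice among the pairs $\{c(v),c(e)\}$, where $(v,e)$ runs over the incident vertex–edge pairs of $G$. The harmonious total chromatic number $h_t(G)$ is the smallest number of colours in a harmonious total colouring of $G$. Theorem. Let $G$ be a finite simple graph of order $n$ different from $K_1$ and $K_4$. Then $$h_t(G)\le\left\lceil\tfrac32 n\right\rceil .$$ -/

import Mathlib

namespace SimpleGraph

universe u v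

variable {V : Type u} {α : Type v}

/-- A total colouring of `G` colours both the vertices (`Sum.inl v`) and the edges (`Sum.inr e`).
It is proper when adjacent vertices, adjacent edges (distinct edges with a common end vertex), and
incident vertices and edges receive different colours. -/
structure IsProperTotalColoring (G : SimpleGraph V) (c : V ⊕ G.edgeSet → α) : Prop where
  adj_vertices : ∀ u v : V, G.Adj u v → c (Sum.inl u) ≠ c (Sum.inl v)
  adj_edges : ∀ (e f : G.edgeSet) (v : V), e ≠ f → v ∈ (e : Sym2 V) → v ∈ (f : Sym2 V) →
    c (Sum.inr e) ≠ c (Sum.inr f)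
  incident : ∀ (v : V) (e : G.edgeSet), v ∈ (e : Sym2 V) → c (Sum.inl v) ≠ c (Sum.inr e)

/-- A harmonious total colouring of `G`: a proper total colouring such that distinct incident
pairs (vertex, edge) receive distinct unordered pairs of colours. -/
structure IsHarmoniousTotalColoring (G : SimpleGraph V) (c : V ⊕ G.edgeSet → α) : Prop
    extends G.IsProperTotalColoring c where
  harmonious : ∀ (v w : V) (e f : G.edgeSet), v ∈ (e : Sym2 V) → w ∈ (f : Sym2 V) →
    s(c (Sum.inl v), c (Sum.inr e)) = s(c (Sum.inl w), c (Sum.inr f)) → v = w ∧ e = f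

/-- `G` has a harmonious total colouring with colours from a set of `k` colours. -/
def HarmoniousTotalColorable (G : SimpleGraph V) (k : ℕ) : Prop :=
  ∃ c : V ⊕ G.edgeSet → Fin k, G.IsHarmoniousTotalColoring c

/-- The harmonious total chromatic number of `G`: the smallest number of colours of a harmonious
total colouring of `G` (infinite if no finite number of colours suffices, which cannot happen
when `G` is finite). -/
noncomputable def harmoniousTotalChromaticNumber (G : SimpleGraph V) : ℕ∞ :=
  ⨅ k ∈ {k : ℕ | G.HarmoniousTotalColorable k}, (k : ℕ∞)

end SimpleGraph

/-! Give the n vertices distinct colours and let an edge receive either a vertex colour or one of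
⌈3n/2⌉ - n extra colours. If the edge uv receives the colour of w, draw the arcs w → u and w → v (a
cherry with centre w). Then the colouring is harmonious exactly when the edge colouring is proper,
no edge has the colour of one of its ends, and no arc occurs together with its reverse. Counting
arcs, at most n(n-1)/4 edges can have vertex colours.

For n = 2p, take the vertices modulo 2p. There are p(p-1) = n(n-2)/4 edges inside the two parity
classes, so it is numerically possible to colour all of them by vertices; the crossing edges form a
bipartite graph with degrees p, for which König's theorem needs p extra colours. The vertex colours
are given cyclically: w colours edges {w + a, w + b}, with a list of offsets (a, b) that depends
only on the parity of w. Edges symmetric about a centre, {w + c + h, w + c - h}, have difference 2h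
and use each offset once. The offsets between two given parity classes then fill intervals, placed
so that no offset meets the negative of one going back.

This succeeds without change for p ≡ 1 mod 4. For p ≡ 3 mod 4 one difference stays uncovered; in
exchange the crossing edges of difference 1 are coloured by vertices. For even p the antipodal edges
lie inside the classes and have a short orbit: a separate block colours them, together with the
crossing edges of an odd difference z, and one difference in each class stays uncovered. In both
cases the crossing degrees drop by two, and the uncovered edges form cycles. Even cycles split into
two matchings; if odd cycles occur, a third matching takes the edges left over, and crossing edges
are added to the matchings so that the crossing degrees drop by three.

For n = 2p + 1, a vertex ∞ is added. Its edges to one class are coloured by vertices, u∞ receiving u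
+ g for an unused offset g; for the rest ∞ joins that same class as a vertex of the bipartite graph.
There are p + 1 extra colours; where the cyclic tiling leaves edges uncovered, two of the remaining
edges at ∞ are rerouted into the matchings. A few small orders are settled by explicit tables, and
for n = 4 one edge must be missing. -/

namespace HarmoniousTotal

open Finset SimpleGraph

/-! ### Matchings and edge colourings of bipartite graphs -/

/-- A nonnegative integer matrix with constant line sums is supported by permutations. -/
theorem exists_perms_of_line_sums {V : Type*} [Fintype V] [DecidableEq V] (D : ℕ) :
    ∀ W : V → V → ℕ, (∀ u, ∑ v, W u v = D) → (∀ v, ∑ u, W u v = D) →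
      ∃ σ : ℕ → Equiv.Perm V, ∀ u v, 0 < W u v → ∃ c < D, σ c u = v := by
  induction D with
  | zero =>
    intro W hr _
    refine ⟨fun _ => Equiv.refl V, fun u v h => ?_⟩
    have := (Finset.sum_eq_zero_iff.1 (hr u)) v (mem_univ v)
    omega
  | succ D ih =>
    intro W hr hc
    -- Hall's condition by double counting: the rows in `s` have total weight |s|(D + 1), all of it
    -- in the columns `N`, whose total weight is |N|(D + 1).
    have hall : ∃ f : V → V, Function.Injective f ∧
        ∀ u, f u ∈ univ.filter (fun v => 0 < W u v) := by
      refine (Finset.all_card_le_biUnion_card_iff_exists_injective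
        (fun u => univ.filter (fun v => 0 < W u v))).1 (fun s => ?_)
      set N := s.biUnion (fun u => univ.filter (fun v => 0 < W u v)) with hN
      have h1 : ∑ u ∈ s, ∑ v, W u v = s.card * (D + 1) := by
        rw [Finset.sum_congr rfl (fun u _ => hr u), Finset.sum_const, smul_eq_mul]
      have h2 : ∑ u ∈ s, ∑ v, W u v = ∑ u ∈ s, ∑ v ∈ N, W u v := by
        refine Finset.sum_congr rfl (fun u hu => ?_)
        symm
        refine Finset.sum_subset (subset_univ _) (fun v _ hv => ?_)
        by_contra h
        exact hv (mem_biUnion.2 ⟨u, hu, mem_filter.2 ⟨mem_univ _, Nat.pos_of_ne_zero h⟩⟩)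
      have h3 : ∑ u ∈ s, ∑ v ∈ N, W u v ≤ N.card * (D + 1) := by
        rw [Finset.sum_comm]
        calc ∑ v ∈ N, ∑ u ∈ s, W u v ≤ ∑ v ∈ N, ∑ u, W u v :=
              Finset.sum_le_sum (fun v _ => Finset.sum_le_sum_of_subset (subset_univ _))
          _ = N.card * (D + 1) := by
              rw [Finset.sum_congr rfl (fun v _ => hc v), Finset.sum_const, smul_eq_mul]
      have h4 : s.card * (D + 1) ≤ N.card * (D + 1) := by omega
      exact Nat.le_of_mul_le_mul_right h4 (Nat.succ_pos D)
    obtain ⟨f, hf, hfW⟩ := hall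
    have hpos : ∀ u, 0 < W u (f u) := fun u => (mem_filter.1 (hfW u)).2
    let τ : Equiv.Perm V := Equiv.ofBijective f (Finite.injective_iff_bijective.1 hf)
    have hτ : ∀ u, τ u = f u := fun u => rfl
    have hle : ∀ u v, (if τ u = v then 1 else 0) ≤ W u v := by
      intro u v
      split_ifs with h
      · subst h; exact hpos u
      · exact Nat.zero_le _
    -- Removing the permutation matrix of `τ` lowers every line sum by exactly one.
    obtain ⟨σ, hσ⟩ := ih (fun u v => W u v - if τ u = v then 1 else 0)
      (fun u => by
        have := Finset.sum_tsub_distrib (s := univ) (f := fun v => W u v)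
          (g := fun v => if τ u = v then 1 else 0) (fun v _ => hle u v)
        rw [this, hr u]; simp)
      (fun v => by
        have := Finset.sum_tsub_distrib (s := univ) (f := fun u => W u v)
          (g := fun u => if τ u = v then 1 else 0) (fun u _ => hle u v)
        rw [this, hc v]
        have : ∀ u, (τ u = v) ↔ (u = τ.symm v) := fun u => by
          rw [Equiv.eq_symm_apply]
        simp [this])
    refine ⟨fun c => if c = D then τ else σ c, fun u v h => ?_⟩
    by_cases huv : τ u = v
    · exact ⟨D, Nat.lt_succ_self D, by simpa using huv⟩
    · obtain ⟨c, hcD, hcu⟩ := hσ u v (by simpa [huv] using h)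
      exact ⟨c, by omega, by simpa [hcD.ne] using hcu⟩

/-- König's edge colouring theorem: a bipartite graph of maximum degree at most `D` has a proper
edge colouring with `D` colours. -/
theorem exists_edge_coloring_of_bipartite {V : Type*} [Fintype V] (R : V → V → Prop)
    (hsymm : ∀ u v, R u v → R v u) (side : V → Prop)
    (hside : ∀ u v, R u v → (side u ↔ ¬ side v)) (D : ℕ)
    (hD : ∀ u, Nat.card {v // R u v} ≤ D) :
    ∃ g : V → V → ℕ, (∀ u v, g u v = g v u) ∧ (∀ u v, R u v → g u v < D) ∧
      ∀ u v v', R u v → R u v' → g u v = g u v' → v = v' := by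
  classical
  have hdeg : ∀ u, ∑ v, (if R u v then 1 else 0) ≤ D := by
    intro u
    refine le_trans (le_of_eq ?_) (hD u)
    rw [Nat.card_eq_fintype_card, Fintype.card_subtype, Finset.card_filter]
  have hirr : ∀ u, ¬ R u u := fun u h => by have := hside u u h; tauto
  have hcomm : ∀ u v, R u v ↔ R v u := fun u v => ⟨hsymm u v, hsymm v u⟩
  let deg : V → ℕ := fun u => ∑ v, (if R u v then 1 else 0)
  -- The diagonal pads every line sum to exactly `D`; as `R` is irreflexive, this does not disturb
  -- its entries.
  let W : V → V → ℕ := fun u v => (if R u v then 1 else 0) + if u = v then D - deg u else 0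
  have hWr : ∀ u, ∑ v, W u v = D := by
    intro u
    simp only [W, Finset.sum_add_distrib, Finset.sum_ite_eq, mem_univ, if_true]
    have := hdeg u
    simp only [deg]
    omega
  have hWs : ∀ u v, W u v = W v u := by
    intro u v
    simp only [W, hcomm u v]
    by_cases h : u = v
    · subst h; rfl
    · simp [h, Ne.symm h]
  obtain ⟨σ, hσ⟩ := exists_perms_of_line_sums D W hWr
    (fun v => by rw [← hWr v]; exact Finset.sum_congr rfl (fun u _ => hWs u v))
  have hch : ∀ u v, ∃ c, R u v → c < D ∧ σ c u = v := by
    intro u v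
    by_cases h : R u v
    · obtain ⟨c, h1, h2⟩ := hσ u v (by simp [W, h])
      exact ⟨c, fun _ => ⟨h1, h2⟩⟩
    · exact ⟨0, fun h' => absurd h' h⟩
  choose f hf using hch
  -- Each edge is read from its end in `side`, which makes the colour symmetric. A colour is then a
  -- partial matching because each `σ c` is a function on one side and injective towards the other.
  refine ⟨fun u v => if side u ∧ ¬ side v then f u v else if side v ∧ ¬ side u then f v u else 0,
    ?_, ?_, ?_⟩
  · intro u v
    by_cases h1 : side u <;> by_cases h2 : side v <;> simp [h1, h2]
  · intro u v h
    have := hside u v h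
    by_cases h1 : side u
    · have h2 : ¬ side v := this.1 h1
      simpa [h1, h2] using (hf u v h).1
    · have h2 : side v := by tauto
      simpa [h1, h2] using (hf v u (hsymm _ _ h)).1
  · intro u v v' h h' he
    have e1 := hside u v h
    have e2 := hside u v' h'
    by_cases h1 : side u
    · have h2 : ¬ side v := e1.1 h1
      have h3 : ¬ side v' := e2.1 h1
      simp only [h1, h2, h3, not_false_eq_true, and_self, if_true] at he
      rw [← (hf u v h).2, ← (hf u v' h').2, he]
    · have h2 : side v := by tauto
      have h3 : side v' := by tauto
      simp only [h1, h2, h3, not_false_eq_true, and_self, if_true, false_and, if_false] at he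
      have a1 := (hf v u (hsymm _ _ h)).2
      have a2 := (hf v' u (hsymm _ _ h')).2
      rw [← he] at a2
      exact (σ (f v u)).injective (a1.trans a2.symm)

/-- Hall's theorem for nearly complete bipartite graphs. -/
theorem exists_bijection_of_almost_complete {α β : Type*} [Fintype α] [Fintype β]
    (hcard : Fintype.card α = Fintype.card β) (h4 : 4 ≤ Fintype.card α) (r : α → β → Prop)
    (hα : ∀ a, Nat.card {b // ¬ r a b} ≤ 2) (hβ : ∀ b, Nat.card {a // ¬ r a b} ≤ 2) :
    ∃ f : α ≃ β, ∀ a, r a (f a) := by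
  classical
  have hall : ∃ f : α → β, Function.Injective f ∧ ∀ a, f a ∈ univ.filter (fun b => r a b) := by
    refine (Finset.all_card_le_biUnion_card_iff_exists_injective
      (fun a => univ.filter (fun b => r a b))).1 (fun s => ?_)
    have hα' : ∀ a, (univ.filter (fun b => ¬ r a b)).card ≤ 2 := fun a => by
      have := hα a
      rwa [Nat.card_eq_fintype_card, Fintype.card_subtype] at this
    have hβ' : ∀ b, (univ.filter (fun a => ¬ r a b)).card ≤ 2 := fun b => by
      have := hβ b
      rwa [Nat.card_eq_fintype_card, Fintype.card_subtype] at this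
    -- A single element already has at least 4 - 2 = 2 partners; three or more elements cannot all
    -- miss the same `b`, so their neighbourhood is everything.
    by_cases hs : s.card ≤ 2
    · rcases s.eq_empty_or_nonempty with rfl | ⟨a, ha⟩
      · simp
      · have h1 := Finset.card_le_card
          (Finset.subset_biUnion_of_mem (fun a => univ.filter (fun b => r a b)) ha)
        have h2 := Finset.card_filter_add_card_filter_not (s := (univ : Finset β)) (fun b => r a b)
        have h3 := hα' a
        rw [Finset.card_univ] at h2
        omega
    · have : s.biUnion (fun a => univ.filter (fun b => r a b)) = univ := by
        refine Finset.eq_univ_of_forall (fun b => ?_)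
        by_contra hb
        have hsub : s ⊆ univ.filter (fun a => ¬ r a b) := by
          intro a ha
          refine mem_filter.2 ⟨mem_univ _, fun hr => hb ?_⟩
          exact mem_biUnion.2 ⟨a, ha, mem_filter.2 ⟨mem_univ _, hr⟩⟩
        have := Finset.card_le_card hsub
        have := hβ' b
        omega
      rw [this, Finset.card_univ, ← hcard]
      exact Finset.card_le_univ s
  obtain ⟨f, hf, hr⟩ := hall
  refine ⟨Equiv.ofBijective f ((Fintype.bijective_iff_injective_and_card f).2 ⟨hf, hcard⟩), ?_⟩
  intro a
  exact (mem_filter.1 (hr a)).2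

/-! ### Harmonious colourings from edges coloured by vertices -/

/-- Colour each vertex by itself and the edges by vertices or by natural numbers. -/
theorem harmoniousTotalColorable_of_edgeColoring {V : Type*} [Fintype V] (G : SimpleGraph V)
    (K : ℕ) (f : V → V → V ⊕ ℕ) (hsymm : ∀ u v, f u v = f v u)
    (hK : ∀ u v e, G.Adj u v → f u v = Sum.inr e → e < K)
    (h1 : ∀ u v, G.Adj u v → f u v ≠ Sum.inl u)
    (h2 : ∀ u v v', G.Adj u v → G.Adj u v' → f u v = f u v' → v = v')
    (h3 : ∀ u v w v', G.Adj u v → G.Adj w v' → f u v = Sum.inl w → f w v' ≠ Sum.inl u) :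
    G.HarmoniousTotalColorable (Fintype.card V + K) := by
  classical
  let φ : V ⊕ ℕ → ℕ := fun x => match x with
    | Sum.inl v => (Fintype.equivFin V v : ℕ)
    | Sum.inr e => Fintype.card V + e
  have hφ : Function.Injective φ := by
    intro x y hxy
    rcases x with x | x <;> rcases y with y | y <;> simp only [φ] at hxy
    · exact congrArg Sum.inl ((Fintype.equivFin V).injective (Fin.ext hxy))
    · have := (Fintype.equivFin V x).2; omega
    · have := (Fintype.equivFin V y).2; omega
    · exact congrArg Sum.inr (by omega)
  let F : Sym2 V → V ⊕ ℕ := Sym2.lift ⟨f, hsymm⟩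
  have hF : ∀ u v, F s(u, v) = f u v := fun u v => Sym2.lift_mk _ _ _
  let c : V ⊕ G.edgeSet → V ⊕ ℕ := Sum.elim Sum.inl (fun e => F e.1)
  have hc : ∀ x, φ (c x) < Fintype.card V + K := by
    rintro (v | ⟨e, he⟩)
    · have := (Fintype.equivFin V v).2
      simp only [c, φ, Sum.elim_inl]; omega
    · induction e with
      | _ u v =>
        rw [SimpleGraph.mem_edgeSet] at he
        simp only [c, Sum.elim_inr, hF]
        rcases h : f u v with w | e
        · have := (Fintype.equivFin V w).2
          simp only [φ]; omega
        · have := hK u v e he h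
          simp only [φ]; omega
  have other : ∀ (v : V) (e : G.edgeSet), v ∈ (e : Sym2 V) →
      ∃ u, (e : Sym2 V) = s(v, u) ∧ G.Adj v u := by
    intro v e hv
    obtain ⟨u, hu⟩ := Sym2.mem_iff_exists.1 hv
    exact ⟨u, hu, by have := e.2; rw [hu] at this; exact this⟩
  have hcE : ∀ (e : G.edgeSet) (v u : V), (e : Sym2 V) = s(v, u) → c (Sum.inr e) = f v u := by
    intro e v u h
    simp only [c, Sum.elim_inr, h, hF]
  let C : V ⊕ G.edgeSet → Fin (Fintype.card V + K) := fun x => ⟨φ (c x), hc x⟩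
  have hC : ∀ x y, C x = C y ↔ c x = c y := fun x y =>
    ⟨fun h => hφ (Fin.mk.inj_iff.1 h), fun h => by simp only [C, h]⟩
  have hadj : ∀ (e e' : G.edgeSet) (v : V), v ∈ (e : Sym2 V) → v ∈ (e' : Sym2 V) →
      c (Sum.inr e) = c (Sum.inr e') → e = e' := by
    intro e e' v hv hv' h
    obtain ⟨u, hu, hvu⟩ := other v e hv
    obtain ⟨u', hu', hvu'⟩ := other v e' hv'
    rw [hcE e v u hu, hcE e' v u' hu'] at h
    have := h2 v u u' hvu hvu' h
    exact Subtype.ext (by rw [hu, hu', this])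
  refine ⟨C, { adj_vertices := ?_, adj_edges := ?_, incident := ?_, harmonious := ?_ }⟩
  · intro u v huv h
    rw [hC] at h
    exact huv.ne (Sum.inl_injective h)
  · intro e e' v hne hv hv' h
    exact hne (hadj e e' v hv hv' ((hC _ _).1 h))
  · intro v e hv h
    rw [hC] at h
    obtain ⟨u, hu, hvu⟩ := other v e hv
    rw [hcE e v u hu] at h
    exact h1 v u hvu h.symm
  · intro v w e e' hv hw h
    rw [Sym2.eq_iff, hC, hC, hC, hC] at h
    -- Equal pairs agree either straight, which is properness at one vertex, or crosswise, which
    -- would be an arc together with its reverse.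
    rcases h with ⟨hvw, he⟩ | ⟨hve, hew⟩
    · have hvw' : v = w := Sum.inl_injective hvw
      subst hvw'
      exact ⟨rfl, hadj e e' v hv hw he⟩
    · obtain ⟨u, hu, hvu⟩ := other v e hv
      obtain ⟨u', hu', hwu'⟩ := other w e' hw
      rw [hcE e v u hu] at hew
      rw [hcE e' w u' hu'] at hve
      exact absurd hve.symm (h3 v u w u' hvu hwu' hew)

/-- Edges coloured by vertices (`S w u v`: the edge `uv` may receive the colour of `w`), edges
covered by `m` matchings, and a bipartite remainder of maximum degree at most `D`. -/
theorem harmoniousTotalColorable_of_cherries {V : Type*} [Fintype V] (G : SimpleGraph V)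
    (S : V → V → V → Prop) {m : ℕ} (M : Fin m → V → V → Prop) (R : V → V → Prop)
    (side : V → Prop) (D : ℕ)
    (hSsymm : ∀ w u v, S w u v → S w v u)
    (hSinj : ∀ w u v v', S w u v → S w u v' → v = v')
    (hSanti : ∀ w u v v', S w u v → ¬ S u w v')
    (hMsymm : ∀ i u v, M i u v → M i v u)
    (hMinj : ∀ i u v v', M i u v → M i u v' → v = v')
    (hRsymm : ∀ u v, R u v → R v u)
    (hRside : ∀ u v, R u v → (side u ↔ ¬ side v))
    (hRD : ∀ u, Nat.card {v // R u v} ≤ D)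
    (hcover : ∀ u v, u ≠ v → (∃ w, S w u v) ∨ (∃ i, M i u v) ∨ R u v) :
    G.HarmoniousTotalColorable (Fintype.card V + (m + D)) := by
  classical
  obtain ⟨g, hgs, hgD, hgp⟩ := exists_edge_coloring_of_bipartite R hRsymm side hRside D hRD
  -- Vertex colours have priority over the matchings, and these over the bipartite remainder. The
  -- choice depends only on the predicates, not on the ordered pair, so that it is symmetric in the
  -- two ends.
  let F : (V → Prop) → (Fin m → Prop) → ℕ → V ⊕ ℕ := fun P Q d =>
    if h : ∃ w, P w then Sum.inl h.choose
    else if h : ∃ i, Q i then Sum.inr (h.choose : ℕ) else Sum.inr (m + d)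
  have hFl : ∀ P Q d w, F P Q d = Sum.inl w → P w := by
    intro P Q d w h
    by_cases hP : ∃ w, P w
    · simp only [F, dif_pos hP, Sum.inl.injEq] at h
      rw [← h]; exact hP.choose_spec
    · by_cases hQ : ∃ i, Q i
      · simp only [F, dif_neg hP, dif_pos hQ, reduceCtorEq] at h
      · simp only [F, dif_neg hP, dif_neg hQ, reduceCtorEq] at h
  have hFr : ∀ P Q d e, F P Q d = Sum.inr e →
      (∃ i : Fin m, Q i ∧ e = i) ∨ ((¬ ∃ w, P w) ∧ (¬ ∃ i, Q i) ∧ e = m + d) := by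
    intro P Q d e h
    by_cases hP : ∃ w, P w
    · simp only [F, dif_pos hP, reduceCtorEq] at h
    · by_cases hQ : ∃ i, Q i
      · simp only [F, dif_neg hP, dif_pos hQ, Sum.inr.injEq] at h
        exact Or.inl ⟨hQ.choose, hQ.choose_spec, h.symm⟩
      · simp only [F, dif_neg hP, dif_neg hQ, Sum.inr.injEq] at h
        exact Or.inr ⟨hP, hQ, h.symm⟩
  have hr : ∀ u v e, G.Adj u v → F (fun w => S w u v) (fun i => M i u v) (g u v) = Sum.inr e →
      (∃ i : Fin m, M i u v ∧ e = i) ∨ (R u v ∧ e = m + g u v) := by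
    intro u v e huv h
    rcases hFr _ _ _ _ h with h | ⟨h1, h2, h3⟩
    · exact Or.inl h
    · rcases hcover u v huv.ne with h | h | h
      · exact absurd h h1
      · exact absurd h h2
      · exact Or.inr ⟨h, h3⟩
  refine harmoniousTotalColorable_of_edgeColoring G (m + D)
    (fun u v => F (fun w => S w u v) (fun i => M i u v) (g u v)) ?_ ?_ ?_ ?_ ?_
  · intro u v
    have e1 : (fun w => S w u v) = fun w => S w v u :=
      funext fun w => propext ⟨hSsymm w u v, hSsymm w v u⟩
    have e2 : (fun i => M i u v) = fun i => M i v u :=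
      funext fun i => propext ⟨hMsymm i u v, hMsymm i v u⟩
    simp only [e1, e2, hgs u v]
  · intro u v e huv h
    rcases hr u v e huv h with ⟨i, _, rfl⟩ | ⟨h1, rfl⟩
    · have := i.2; omega
    · have := hgD u v h1; omega
  · intro u v huv h
    have := hFl _ _ _ _ h
    exact hSanti u u v v this this
  · intro u v v' huv huv' h
    rcases he : F (fun w => S w u v) (fun i => M i u v) (g u v) with w | e
    · exact hSinj w u v v' (hFl (fun w => S w u v) _ _ _ he)
        (hFl (fun w => S w u v') _ _ _ (h.symm.trans he))
    · rcases hr u v e huv he with ⟨i, hi, h1⟩ | ⟨hi, h1⟩ <;>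
        rcases hr u v' e huv' (h.symm.trans he) with ⟨j, hj, h2⟩ | ⟨hj, h2⟩
      · have : i = j := Fin.ext (h1.symm.trans h2)
        subst this
        exact hMinj i u v v' hi hj
      · have := i.2; omega
      · have := j.2; omega
      · exact hgp u v v' hi hj (by omega)
  · intro u v w v' huv hwv' h h'
    exact hSanti w u v v' (hFl (fun x => S x u v) _ _ _ h) (hFl (fun x => S x w v') _ _ _ h')

/-- `S w u v` (the edge `uv` may receive the colour of the vertex `w`), on the vertices
`0, …, N - 1`: every vertex is used at most once by `w`, and no arc is reversed. -/
structure IsCherryFamily (N : ℤ) (S : ℤ → ℤ → ℤ → Prop) : Prop where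
  range : ∀ w u v, S w u v → 0 ≤ w ∧ w < N ∧ 0 ≤ u ∧ u < N
  symm : ∀ w u v, S w u v → S w v u
  inj : ∀ w u v v', S w u v → S w u v' → v = v'
  anti : ∀ w u v v', S w u v → ¬ S u w v'

theorem IsCherryFamily.union {N : ℤ} {S S' : ℤ → ℤ → ℤ → Prop} (h : IsCherryFamily N S)
    (h' : IsCherryFamily N S') (h1 : ∀ w u v v', S w u v → ¬ S' w u v')
    (h2 : ∀ w u v v', S w u v → ¬ S' u w v') :
    IsCherryFamily N (fun w u v => S w u v ∨ S' w u v) where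
  range := by rintro w u v (a | a); exacts [h.range _ _ _ a, h'.range _ _ _ a]
  symm := by rintro w u v (a | a); exacts [.inl (h.symm _ _ _ a), .inr (h'.symm _ _ _ a)]
  inj := by
    rintro w u v v' (a | a) (b | b)
    exacts [h.inj _ _ _ _ a b, absurd b (h1 _ _ _ _ a), absurd a (h1 _ _ _ _ b),
      h'.inj _ _ _ _ a b]
  anti := by
    rintro w u v v' (a | a) (b | b)
    exacts [h.anti _ _ _ _ a b, h2 _ _ _ _ a b, h2 _ _ _ _ b a, h'.anti _ _ _ _ a b]

theorem IsCherryFamily.mono {N N' : ℤ} {S : ℤ → ℤ → ℤ → Prop} (h : IsCherryFamily N S)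
    (hN : N ≤ N') : IsCherryFamily N' S where
  range := fun w u v a => by have := h.range w u v a; omega
  symm := h.symm
  inj := h.inj
  anti := h.anti

/-- Passage from `V` to integers, where all conditions become linear arithmetic. The remainder
consists of the uncovered edges between the two sides, so edges inside a side have to be covered.
The lists bound its degrees: they name enough neighbours on the other side whose edges are already
coloured. -/
theorem harmoniousTotalColorable_of_cherryFamily {V : Type*} [Fintype V] (G : SimpleGraph V)
    {N : ℕ} (hN : Fintype.card V = N) (S : ℤ → ℤ → ℤ → Prop) (hS : IsCherryFamily N S) {m : ℕ}
    (M : Fin m → ℤ → ℤ → Prop) (hMsymm : ∀ i u v, M i u v → M i v u)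
    (hMinj : ∀ i, ∀ u v v' : ℤ, 0 ≤ u → u < N → 0 ≤ v → v < N → 0 ≤ v' → v' < N →
      M i u v → M i u v' → v = v')
    (side : ℤ → Prop) (A B D : ℕ) (hA : Nat.card {x : Fin N // side (x : ℕ)} ≤ A)
    (hB : Nat.card {x : Fin N // ¬ side (x : ℕ)} ≤ B)
    (hcover : ∀ u v : ℤ, 0 ≤ u → u < v → v < N → (side u ↔ side v) →
      (∃ w, S w u v) ∨ ∃ i, M i u v)
    (hdegA : ∀ u : ℤ, 0 ≤ u → u < N → side u → ∃ l : List ℤ, l.Nodup ∧ B ≤ D + l.length ∧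
      ∀ y ∈ l, 0 ≤ y ∧ y < N ∧ ¬ side y ∧ ((∃ w, S w u y) ∨ ∃ i, M i u y))
    (hdegB : ∀ u : ℤ, 0 ≤ u → u < N → ¬ side u → ∃ l : List ℤ, l.Nodup ∧ A ≤ D + l.length ∧
      ∀ y ∈ l, 0 ≤ y ∧ y < N ∧ side y ∧ ((∃ w, S w u y) ∨ ∃ i, M i u y)) :
    G.HarmoniousTotalColorable (N + (m + D)) := by
  classical
  let e : V ≃ Fin N := Fintype.equivFinOfCardEq hN
  let φ : V → ℤ := fun x => ((e x : ℕ) : ℤ)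
  have hφ0 : ∀ x, 0 ≤ φ x := fun x => Int.natCast_nonneg _
  have hφN : ∀ x, φ x < N := fun x => Int.ofNat_lt.2 (e x).2
  have hφi : Function.Injective φ := fun x y h => e.injective (Fin.ext (Int.ofNat_inj.1 h))
  have hφs : ∀ z : ℤ, 0 ≤ z → z < N → ∃ x, φ x = z := by
    intro z h0 h1
    refine ⟨e.symm ⟨z.toNat, by omega⟩, ?_⟩
    simp only [φ, Equiv.apply_symm_apply]
    omega
  let C : ℤ → ℤ → Prop := fun u v => (∃ w, S w u v) ∨ ∃ i, M i u v
  have hC : ∀ u v, C u v → C v u := by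
    rintro u v (⟨w, h⟩ | ⟨i, h⟩)
    exacts [.inl ⟨w, hS.symm _ _ _ h⟩, .inr ⟨i, hMsymm _ _ _ h⟩]
  have hcount : ∀ (P : ℤ → Prop) (B : ℕ) (u : V), Nat.card {x : Fin N // P (x : ℕ)} ≤ B →
      (∃ l : List ℤ, l.Nodup ∧ B ≤ D + l.length ∧
        ∀ y ∈ l, 0 ≤ y ∧ y < N ∧ P y ∧ C (φ u) y) →
      Nat.card {v : V // P (φ v) ∧ ¬ C (φ u) (φ v)} ≤ D := by
    rintro P B u hB ⟨l, hl, hlen, hmem⟩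
    let X : Finset V := Finset.univ.filter fun v => P (φ v) ∧ ¬ C (φ u) (φ v)
    have hX : Nat.card {v : V // P (φ v) ∧ ¬ C (φ u) (φ v)} = X.card := by
      rw [Nat.card_eq_fintype_card, Fintype.card_subtype]
    let Y : Finset (Fin N) := Finset.univ.filter fun x => P (x : ℕ)
    have hY : Y.card ≤ B := by
      rwa [Nat.card_eq_fintype_card, Fintype.card_subtype] at hB
    have hdisj : Disjoint (X.image φ) l.toFinset := by
      rw [Finset.disjoint_left]
      intro z hz hz'
      obtain ⟨v, hv, rfl⟩ := Finset.mem_image.1 hz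
      exact (Finset.mem_filter.1 hv).2.2 (hmem _ (List.mem_toFinset.1 hz')).2.2.2
    have hsub : X.image φ ∪ l.toFinset ⊆ Y.image fun x : Fin N => ((x : ℕ) : ℤ) := by
      intro z hz
      rcases Finset.mem_union.1 hz with hz | hz
      · obtain ⟨v, hv, rfl⟩ := Finset.mem_image.1 hz
        exact Finset.mem_image.2
          ⟨e v, Finset.mem_filter.2 ⟨Finset.mem_univ _, (Finset.mem_filter.1 hv).2.1⟩, rfl⟩
      · obtain ⟨h0, h1, h2, -⟩ := hmem z (List.mem_toFinset.1 hz)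
        obtain ⟨v, rfl⟩ := hφs z h0 h1
        exact Finset.mem_image.2
          ⟨e v, Finset.mem_filter.2 ⟨Finset.mem_univ _, h2⟩, rfl⟩
    have h1 := Finset.card_le_card hsub
    rw [Finset.card_union_of_disjoint hdisj, Finset.card_image_of_injective _ hφi,
      List.toFinset_card_of_nodup hl] at h1
    have h2 := h1.trans Finset.card_image_le
    omega
  rw [← hN]
  refine harmoniousTotalColorable_of_cherries G (fun w u v => S (φ w) (φ u) (φ v))
    (fun i u v => M i (φ u) (φ v))
    (fun u v => (side (φ u) ↔ ¬ side (φ v)) ∧ ¬ C (φ u) (φ v)) (fun u => side (φ u)) D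
    (fun w u v h => hS.symm _ _ _ h) (fun w u v v' h h' => hφi (hS.inj _ _ _ _ h h'))
    (fun w u v v' h => hS.anti _ _ _ _ h) (fun i u v h => hMsymm _ _ _ h)
    (fun i u v v' h h' => hφi (hMinj i (φ u) (φ v) (φ v') (hφ0 u) (hφN u) (hφ0 v) (hφN v)
      (hφ0 v') (hφN v') h h')) ?_ (fun u v h => h.1) ?_ ?_
  · rintro u v ⟨h, h'⟩
    exact ⟨by tauto, fun h'' => h' (hC _ _ h'')⟩
  · intro u
    by_cases hu : side (φ u)
    · refine le_trans (le_of_eq ?_) (hcount (fun y => ¬ side y) B u hB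
        (hdegA _ (hφ0 _) (hφN _) hu))
      simp [hu]
    · refine le_trans (le_of_eq ?_) (hcount side A u hA (hdegB _ (hφ0 _) (hφN _) hu))
      simp [hu]
  · intro u v huv
    have hS' : C (φ u) (φ v) → (∃ w, S (φ w) (φ u) (φ v)) ∨ ∃ i, M i (φ u) (φ v) := by
      rintro (⟨w, h⟩ | h)
      · have := hS.range _ _ _ h
        obtain ⟨x, rfl⟩ := hφs w (by omega) (by omega)
        exact .inl ⟨x, h⟩
      · exact .inr h
    by_cases hc : C (φ u) (φ v)
    · rcases hS' hc with h | h
      exacts [.inl h, .inr (.inl h)]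
    · refine .inr (.inr ⟨?_, hc⟩)
      by_contra hside
      have hside : side (φ u) ↔ side (φ v) := by tauto
      rcases lt_or_gt_of_ne (hφi.ne huv) with h | h
      · exact hc (hcover _ _ (hφ0 _) h (hφN _) hside)
      · exact hc (hC _ _ (hcover _ _ (hφ0 _) h (hφN _) hside.symm))

/-! ### Cyclic tilings and a vertex at infinity -/

/-- Congruence modulo `n` of integers at distance at most `n`. -/
def Cong (n x y : ℤ) : Prop := x = y ∨ x = y + n ∨ x + n = y

theorem exists_cong {n x : ℤ} (h0 : -n ≤ x) (h1 : x < 2 * n) :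
    ∃ y, 0 ≤ y ∧ y < n ∧ Cong n y x := by
  unfold Cong
  by_cases h : x < 0
  · exact ⟨x + n, by omega⟩
  · by_cases h' : x < n
    · exact ⟨x, by omega⟩
    · exact ⟨x - n, by omega⟩

/-- `T w a b` : the colour `w` is given to the edge with ends `w + a` and `w + b` modulo `n`. -/
structure IsTiling (n : ℤ) (T : ℤ → ℤ → ℤ → Prop) : Prop where
  range : ∀ w a b, T w a b → -n < a ∧ a < n
  periodic : ∀ w w' a b, T w a b → w % 2 = w' % 2 → T w' a b
  symm : ∀ w a b, T w a b → T w b a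
  inj : ∀ w a b a' b', T w a b → T w a' b' → Cong n a a' → Cong n b b'
  anti : ∀ w a b a' b', T w a b → T (w + a) a' b' → ¬ Cong n (a + a') 0

/-- The edges coloured according to a tiling. -/
def translates (n : ℤ) (T : ℤ → ℤ → ℤ → Prop) (w u v : ℤ) : Prop :=
  0 ≤ w ∧ w < n ∧ 0 ≤ u ∧ u < n ∧ 0 ≤ v ∧ v < n ∧
    ∃ a b, T w a b ∧ Cong n u (w + a) ∧ Cong n v (w + b)

/-- Since n is even, reduction modulo n preserves parity, which is all that a tiling remembers of
the colour. -/
theorem IsTiling.isCherryFamily {n : ℤ} {T : ℤ → ℤ → ℤ → Prop} (h : IsTiling n T)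
    (hn : n % 2 = 0) : IsCherryFamily n (translates n T) where
  range := by rintro w u v ⟨h1, h2, h3, h4, -⟩; exact ⟨h1, h2, h3, h4⟩
  symm := by
    rintro w u v ⟨h1, h2, h3, h4, h5, h6, a, b, ht, h7, h8⟩
    exact ⟨h1, h2, h5, h6, h3, h4, b, a, h.symm _ _ _ ht, h8, h7⟩
  inj := by
    rintro w u v v' ⟨h1, h2, h3, h4, h5, h6, a, b, ht, h7, h8⟩
      ⟨-, -, -, -, h5', h6', a', b', ht', h7', h8'⟩
    have r := h.range _ _ _ ht
    have r' := h.range _ _ _ ht'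
    have s := h.range _ _ _ (h.symm _ _ _ ht)
    have s' := h.range _ _ _ (h.symm _ _ _ ht')
    have := h.inj _ _ _ _ _ ht ht' (by unfold Cong at *; omega)
    unfold Cong at *
    clear h7 h7' r r'
    omega
  anti := by
    rintro w u v v' ⟨h1, h2, h3, h4, h5, h6, a, b, ht, h7, h8⟩
      ⟨-, -, -, -, h5', h6', a', b', ht', h7', h8'⟩
    have r := h.range _ _ _ ht
    have r' := h.range _ _ _ ht'
    refine h.anti _ _ _ _ _ ht (h.periodic _ (w + a) _ _ ht' ?_) ?_
    · clear h8 h8' h7'; unfold Cong at *; omega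
    · clear h8 h8'; unfold Cong at *; omega

/-- One tile of the right difference, whose end has the right parity, covers the whole orbit: the
colour of uv is u - a modulo n. -/
theorem IsTiling.exists_translates {n : ℤ} {T : ℤ → ℤ → ℤ → Prop} (h : IsTiling n T)
    (hn : n % 2 = 0) {w u v a b : ℤ} (hu : 0 ≤ u ∧ u < n) (hv : 0 ≤ v ∧ v < n)
    (hT : T w a b) (hw : (w + a) % 2 = u % 2) (hab : Cong n (u - v) (a - b)) :
    ∃ w, translates n T w u v := by
  have r := h.range _ _ _ hT
  have s := h.range _ _ _ (h.symm _ _ _ hT)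
  obtain ⟨x, h0, h1, hx⟩ := exists_cong (n := n) (x := u - a) (by omega) (by omega)
  have key : T x a b := h.periodic _ _ _ _ hT (by unfold Cong at *; omega)
  refine ⟨x, h0, h1, hu.1, hu.2, hv.1, hv.2, a, b, key, ?_, ?_⟩ <;> unfold Cong at * <;> omega

/-- The edges joining `u % 2 = π` to a vertex `n` at infinity, coloured by `u + g`. -/
def slackEdges (n π g w u v : ℤ) : Prop :=
  0 ≤ w ∧ w < n ∧ ((v = n ∧ 0 ≤ u ∧ u < n ∧ u % 2 = π ∧ Cong n w (u + g)) ∨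
    (u = n ∧ 0 ≤ v ∧ v < n ∧ v % 2 = π ∧ Cong n w (v + g)))

/-- The arcs are u + g → u and u + g → ∞. Nothing is coloured by ∞. For odd g all other arcs lead
into the class π from the opposite class; for even g two of them could only be opposite if 2g = n.
-/
theorem isCherryFamily_slackEdges {n π g : ℤ} (hn : n % 2 = 0) (hg0 : 0 < g) (hgn : g < n)
    (hg : g % 2 = 1 ∨ 2 * g ≠ n) : IsCherryFamily (n + 1) (slackEdges n π g) where
  range := by rintro w u v ⟨h1, h2, h3⟩; omega
  symm := by rintro w u v ⟨h1, h2, h3 | h3⟩; exacts [⟨h1, h2, .inr h3⟩, ⟨h1, h2, .inl h3⟩]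
  inj := by
    rintro w u v v' ⟨h1, h2, h3⟩ ⟨-, -, h4⟩
    unfold Cong at *
    omega
  anti := by
    rintro w u v v' ⟨h1, h2, h3⟩ ⟨h1', h2', h4⟩
    unfold Cong at *
    omega

theorem IsCherryFamily.union_slackEdges {n π g : ℤ} {S : ℤ → ℤ → ℤ → Prop}
    (h : IsCherryFamily n S) (hn : n % 2 = 0) (hg0 : 0 < g) (hgn : g < n)
    (hg : g % 2 = 1 ∨ 2 * g ≠ n)
    (h1 : ∀ w u v, S w u v → u % 2 = π → ¬ Cong n w (u + g))
    (h2 : ∀ w u v, S w u v → w % 2 = π → ¬ Cong n u (w + g)) :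
    IsCherryFamily (n + 1) (fun w u v => S w u v ∨ slackEdges n π g w u v) := by
  refine (h.mono (by omega)).union (isCherryFamily_slackEdges hn hg0 hgn hg) ?_ ?_
  · rintro w u v v' a ⟨b1, b2, b3⟩
    have := h.range _ _ _ a
    have := h1 w u v a
    rcases b3 with b3 | b3
    · exact this b3.2.2.2.1 b3.2.2.2.2
    · omega
  · rintro w u v v' a ⟨b1, b2, b3⟩
    have := h.range _ _ _ a
    have := h2 w u v a
    rcases b3 with b3 | b3
    · exact this b3.2.2.2.1 b3.2.2.2.2
    · omega

/-- Translates the freeness of the arcs u + g → u, and of their reverses, into conditions on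
offsets: -g is unused into the class π, and g is unused out of it. -/
theorem translates_ne {n : ℤ} {T : ℤ → ℤ → ℤ → Prop} (h : IsTiling n T) (hn : n % 2 = 0)
    {π g : ℤ}
    (hT : ∀ w a b, T w a b → (w + a) % 2 = π → ¬ Cong n (a + g) 0)
    (hT' : ∀ w a b, T w a b → w % 2 = π → ¬ Cong n a g) (hg0 : 0 < g) (hgn : g < n) :
    (∀ w u v, translates n T w u v → u % 2 = π → ¬ Cong n w (u + g)) ∧
    (∀ w u v, translates n T w u v → w % 2 = π → ¬ Cong n u (w + g)) := by
  constructor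
  · rintro w u v ⟨h1, h2, h3, h4, h5, h6, a, b, ht, h7, h8⟩ hu hc
    have r := h.range _ _ _ ht
    clear h8
    refine hT _ _ _ ht ?_ ?_ <;> unfold Cong at * <;> omega
  · rintro w u v ⟨h1, h2, h3, h4, h5, h6, a, b, ht, h7, h8⟩ hu hc
    have r := h.range _ _ _ ht
    clear h8
    refine hT' _ _ _ ht hu ?_
    unfold Cong at *; omega

/-! ### Counting in the parity classes -/

/-- The vertices of a given parity. -/
noncomputable def parityClass (p : ℕ) (i : ℤ) : Finset ℤ :=
  (Finset.Ico (0 : ℤ) (2 * p)).filter fun x => x % 2 = i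

theorem mem_parity {p : ℕ} {i x : ℤ} :
    x ∈ parityClass p i ↔ (0 ≤ x ∧ x < 2 * p) ∧ x % 2 = i := by
  simp [parityClass]

theorem card_parity (p : ℕ) {i : ℤ} (hi : i = 0 ∨ i = 1) :
    (parityClass p i).card = p := by
  have : parityClass p i =
      (Finset.range p).image fun j : ℕ => 2 * (j : ℤ) + i := by
    ext x
    simp only [mem_parity, Finset.mem_image, Finset.mem_range]
    constructor
    · intro h
      exact ⟨(x / 2).toNat, by omega⟩
    · rintro ⟨j, hj, rfl⟩
      omega
  rw [this, Finset.card_image_of_injective _ (fun (a b : ℕ) (h : 2 * (a : ℤ) + i = 2 * (b : ℤ) + i) => by omega),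
    Finset.card_range]

theorem card_fin_le (N : ℕ) (Q : ℤ → Prop) (s : Finset ℤ)
    (h : ∀ x : ℤ, 0 ≤ x → x < N → Q x → x ∈ s) : Nat.card {x : Fin N // Q (x : ℕ)} ≤ s.card := by
  rw [← Fintype.card_coe, ← Nat.card_eq_fintype_card]
  refine Nat.card_le_card_of_injective
    (fun x => ⟨((x.1 : ℕ) : ℤ), h _ (by omega) (by have := x.1.2; omega) x.2⟩) ?_
  intro x y hxy
  have := Subtype.mk.inj hxy
  exact Subtype.ext (Fin.ext (by omega))

/-! ### The block: antipodal edges and one odd difference -/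

/-- Half of the vertices: exactly one of `x`, `x + p` and, for even `x`, exactly one of `x`,
`x - z`. -/
def Half (p z x : ℤ) : Prop :=
  (x % 2 = 1 ∧ x < p) ∨ (x % 2 = 0 ∧ (x < z ∨ z + p ≤ x))

/-- Half of the edges of the block. -/
def blockArcs (p z w u v : ℤ) : Prop :=
  0 ≤ w ∧ w < 2 * p ∧ 0 ≤ u ∧ u < 2 * p ∧ 0 ≤ v ∧ v < 2 * p ∧
  ((Cong (2 * p) u (w - z) ∧ Cong (2 * p) v (u + p) ∧ Half p z u) ∨
   (Cong (2 * p) u (w + z) ∧ Cong (2 * p) v (u + z) ∧ w % 2 = 1 ∧ p ≤ w) ∨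
   (Cong (2 * p) u (w - z) ∧ Cong (2 * p) v (u - z) ∧ w % 2 = 1 ∧ v < p) ∨
   (Cong (2 * p) u (w + p) ∧ Cong (2 * p) v (u + z) ∧ Half p z w))

/-- The edges with differences `p` and `z`, coloured by vertices. -/
def block (p z w u v : ℤ) : Prop := blockArcs p z w u v ∨ blockArcs p z w v u

/-- The differences `u - w` for which the block gives an edge at `u` the colour `w`. -/
def BlockDiff (p z w a : ℤ) : Prop :=
  Cong (2 * p) a z ∨ Cong (2 * p) a (-z) ∨ Cong (2 * p) a p ∨ Cong (2 * p) a (p + z) ∨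
    Cong (2 * p) a (p - z) ∨ (w % 2 = 1 ∧ (Cong (2 * p) a (2 * z) ∨ Cong (2 * p) a (-(2 * z))))

/-- Let H be the set given by `Half`. The edge {x, x + p} with x in H has colour x + z. The edge {x,
x + z} has colour x + p if x is not in H, and for x in H it has colour x - z if x is even and x + 2z
if x is odd. The eight cases list these four rules with both orders of the ends. -/
theorem exists_offsets_of_block {p z w u v : ℤ} (hz : 0 < z) (hz2 : z % 2 = 1) (hzp : 2 * z < p)
    (hp : p % 2 = 0) (h : block p z w u v) :
    ∃ a b, Cong (2 * p) u (w + a) ∧ Cong (2 * p) v (w + b) ∧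
      ((a = -z ∧ b = p - z ∧ Half p z u) ∨ (a = p - z ∧ b = -z ∧ ¬ Half p z u) ∨
      (a = z ∧ b = 2 * z ∧ w % 2 = 1 ∧ p ≤ w) ∨ (a = 2 * z ∧ b = z ∧ w % 2 = 1 ∧ p ≤ w) ∨
      (a = -z ∧ b = -(2 * z) ∧ w % 2 = 1 ∧ ¬ Half p z u) ∨
      (a = -(2 * z) ∧ b = -z ∧ w % 2 = 1 ∧ u < p) ∨
      (a = p ∧ b = p + z ∧ Half p z w) ∨ (a = p + z ∧ b = p ∧ Half p z w)) := by
  obtain ⟨h1, h2, h3, h4, h5, h6, h⟩ | ⟨h1, h2, h3, h4, h5, h6, h⟩ := h <;>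
  rcases h with ⟨ha, hb, h⟩ | ⟨ha, hb, h⟩ | ⟨ha, hb, h⟩ | ⟨ha, hb, h⟩
  · exact ⟨-z, p - z, by unfold Cong at *; omega, by unfold Cong at *; omega,
      .inl ⟨rfl, rfl, h⟩⟩
  · exact ⟨z, 2 * z, by unfold Cong at *; omega, by unfold Cong at *; omega,
      .inr (.inr (.inl ⟨rfl, rfl, h⟩))⟩
  · have hu2 : u % 2 = 0 := by clear hb; unfold Cong at ha; omega
    have : ¬ Half p z u := by clear ha; unfold Cong Half at *; omega
    exact ⟨-z, -(2 * z), by unfold Cong at *; omega, by unfold Cong at *; omega,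
      .inr (.inr (.inr (.inr (.inl ⟨rfl, rfl, h.1, this⟩))))⟩
  · exact ⟨p, p + z, by unfold Cong at *; omega, by unfold Cong at *; omega,
      .inr (.inr (.inr (.inr (.inr (.inr (.inl ⟨rfl, rfl, h⟩))))))⟩
  · have : ¬ Half p z u := by clear ha; unfold Cong Half at *; omega
    exact ⟨p - z, -z, by unfold Cong at *; omega, by unfold Cong at *; omega,
      .inr (.inl ⟨rfl, rfl, this⟩)⟩
  · exact ⟨2 * z, z, by unfold Cong at *; omega, by unfold Cong at *; omega,
      .inr (.inr (.inr (.inl ⟨rfl, rfl, h⟩)))⟩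
  · exact ⟨-(2 * z), -z, by unfold Cong at *; omega, by unfold Cong at *; omega,
      .inr (.inr (.inr (.inr (.inr (.inl ⟨rfl, rfl, h⟩)))))⟩
  · exact ⟨p + z, p, by unfold Cong at *; omega, by unfold Cong at *; omega,
      .inr (.inr (.inr (.inr (.inr (.inr (.inr (⟨rfl, rfl, h⟩)))))))⟩

theorem block_diff {p z w u v : ℤ} (hz : 0 < z) (hz2 : z % 2 = 1) (hzp : 2 * z < p)
    (hp : p % 2 = 0) (h : block p z w u v) : BlockDiff p z w (u - w) := by
  obtain ⟨a, b, hu, -, h⟩ := exists_offsets_of_block hz hz2 hzp hp h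
  have e : ∀ c : ℤ, Cong (2 * p) u (w + c) → Cong (2 * p) (u - w) c := by
    intro c hc; unfold Cong at *; omega
  have e' : Cong (2 * p) u (w + (p - z)) → Cong (2 * p) (u - w) (p - z) := e _
  rcases h with ⟨rfl, -⟩ | ⟨rfl, -⟩ | ⟨rfl, -⟩ | ⟨rfl, -, h, -⟩ | ⟨rfl, -⟩ | ⟨rfl, -, h, -⟩ |
    ⟨rfl, -⟩ | ⟨rfl, -⟩ <;> have := e _ hu <;> unfold BlockDiff <;> tauto

/-- The set H separates all possible collisions. Two edges with the same offset -z at the same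
vertex u would put u both into H and outside it. A reversed arc of offset p would put w and w + p
into H; for the offsets p + z and p - z the same vertex would be in H and outside it; for z, -z and
for 2z, -2z an odd vertex would be both below p and not. -/
theorem isCherryFamily_block {p z : ℤ} (hz : 0 < z) (hz2 : z % 2 = 1) (hzp : 2 * z < p)
    (hp : p % 2 = 0) : IsCherryFamily (2 * p) (block p z) where
  range := by
    rintro w u v (⟨h1, h2, h3, h4, h5, h6, -⟩ | ⟨h1, h2, h3, h4, h5, h6, -⟩)
    exacts [⟨h1, h2, h3, h4⟩, ⟨h1, h2, h5, h6⟩]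
  symm := fun w u v h => h.symm
  inj := by
    intro w u v v' h h'
    have r : 0 ≤ u ∧ u < 2 * p ∧ 0 ≤ v ∧ v < 2 * p ∧ 0 ≤ w ∧ w < 2 * p := by
      unfold block blockArcs at h; omega
    have r' : 0 ≤ v' ∧ v' < 2 * p := by
      unfold block blockArcs at h'; omega
    obtain ⟨a, b, hu, hv, h⟩ := exists_offsets_of_block hz hz2 hzp hp h
    obtain ⟨a', b', hu', hv', h'⟩ := exists_offsets_of_block hz hz2 hzp hp h'
    have hab : Cong (2 * p) a a' := by
      have : -(2 * p) < a ∧ a < 2 * p := by omega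
      have : -(2 * p) < a' ∧ a' < 2 * p := by omega
      clear h h' hv hv'
      unfold Cong at *; omega
    have hbb : b = b' := by
      -- Only pairs of cases with congruent first offsets survive.
      clear hv hv'
      rcases h with ⟨rfl, rfl, h⟩ | ⟨rfl, rfl, h⟩ | ⟨rfl, rfl, h⟩ | ⟨rfl, rfl, h⟩ |
        ⟨rfl, rfl, h⟩ | ⟨rfl, rfl, h⟩ | ⟨rfl, rfl, h⟩ | ⟨rfl, rfl, h⟩ <;>
      rcases h' with ⟨rfl, rfl, h'⟩ | ⟨rfl, rfl, h'⟩ | ⟨rfl, rfl, h'⟩ | ⟨rfl, rfl, h'⟩ |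
        ⟨rfl, rfl, h'⟩ | ⟨rfl, rfl, h'⟩ | ⟨rfl, rfl, h'⟩ | ⟨rfl, rfl, h'⟩ <;>
      first
      | rfl
      | (exfalso; clear h h' hu hu'; unfold Cong at hab; omega)
      | exact absurd h h'
      | exact absurd h' h
      | exact absurd h.2 h'
      | exact absurd h'.2 h
      | (exfalso; simp only [Cong, Half] at *; omega)
    clear h h' hu hu' hab
    subst hbb
    unfold Cong at *; omega
  anti := by
    intro w u v v' h h'
    have r : 0 ≤ u ∧ u < 2 * p ∧ 0 ≤ v ∧ v < 2 * p ∧ 0 ≤ w ∧ w < 2 * p := by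
      unfold block blockArcs at h; omega
    obtain ⟨a, b, hu, hv, h⟩ := exists_offsets_of_block hz hz2 hzp hp h
    obtain ⟨a', b', hu', hv', h'⟩ := exists_offsets_of_block hz hz2 hzp hp h'
    have hab : Cong (2 * p) (a + a') 0 := by
      have : -(2 * p) < a ∧ a < 2 * p := by omega
      have : -(2 * p) < a' ∧ a' < 2 * p := by omega
      clear h h' hv hv'
      unfold Cong at *; omega
    clear hv hv' hu'
    rcases h with ⟨rfl, rfl, h⟩ | ⟨rfl, rfl, h⟩ | ⟨rfl, rfl, h⟩ | ⟨rfl, rfl, h⟩ |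
      ⟨rfl, rfl, h⟩ | ⟨rfl, rfl, h⟩ | ⟨rfl, rfl, h⟩ | ⟨rfl, rfl, h⟩ <;>
    rcases h' with ⟨rfl, rfl, h'⟩ | ⟨rfl, rfl, h'⟩ | ⟨rfl, rfl, h'⟩ | ⟨rfl, rfl, h'⟩ |
      ⟨rfl, rfl, h'⟩ | ⟨rfl, rfl, h'⟩ | ⟨rfl, rfl, h'⟩ | ⟨rfl, rfl, h'⟩ <;>
    first
    | (clear h h' hu; unfold Cong at hab; omega)
    | (simp only [Cong, Half] at *; omega)

theorem block_add_half {p z u v : ℤ} (hz : 0 < z) (hz2 : z % 2 = 1) (hzp : 2 * z < p)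
    (hp : p % 2 = 0) (hu : 0 ≤ u) (huv : v = u + p) (hv : v < 2 * p) :
    ∃ w, block p z w u v := by
  by_cases h : Half p z u
  · obtain ⟨w, h0, h1, hw⟩ := exists_cong (n := 2 * p) (x := u + z) (by omega) (by omega)
    refine ⟨w, .inl ⟨h0, h1, by omega, by omega, by omega, by omega, .inl ⟨?_, ?_, h⟩⟩⟩ <;>
      unfold Cong at * <;> omega
  · obtain ⟨w, h0, h1, hw⟩ := exists_cong (n := 2 * p) (x := v + z) (by omega) (by omega)
    refine ⟨w, .inr ⟨h0, h1, by omega, by omega, by omega, by omega, .inl ⟨?_, ?_, ?_⟩⟩⟩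
    · unfold Cong at *; omega
    · unfold Cong at *; omega
    · unfold Half at *; omega

/-- The three rules for {u, u + z}: u even in H, u odd in H, and u outside H. -/
theorem block_add {p z u v : ℤ} (hz : 0 < z) (hz2 : z % 2 = 1) (hzp : 2 * z < p)
    (hp : p % 2 = 0) (hu : 0 ≤ u ∧ u < 2 * p) (hv : 0 ≤ v ∧ v < 2 * p)
    (huv : Cong (2 * p) v (u + z)) : ∃ w, block p z w u v := by
  by_cases h : Half p z u
  · by_cases h2 : u % 2 = 0
    · obtain ⟨w, h0, h1, hw⟩ := exists_cong (n := 2 * p) (x := u - z) (by omega) (by omega)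
      refine ⟨w, .inl ⟨h0, h1, by omega, by omega, by omega, by omega,
        .inr (.inl ⟨?_, ?_, ?_⟩)⟩⟩ <;> unfold Cong Half at * <;> omega
    · obtain ⟨w, h0, h1, hw⟩ := exists_cong (n := 2 * p) (x := u + 2 * z) (by omega) (by omega)
      refine ⟨w, .inr ⟨h0, h1, by omega, by omega, by omega, by omega,
        .inr (.inr (.inl ⟨?_, ?_, ?_⟩))⟩⟩ <;> unfold Cong Half at * <;> omega
  · obtain ⟨w, h0, h1, hw⟩ := exists_cong (n := 2 * p) (x := u + p) (by omega) (by omega)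
    refine ⟨w, .inl ⟨h0, h1, by omega, by omega, by omega, by omega,
      .inr (.inr (.inr ⟨?_, ?_, ?_⟩))⟩⟩
    · unfold Cong at *; omega
    · unfold Cong at *; omega
    · unfold Half Cong at *; omega

theorem card_cong_le_two {p : ℕ} {z x : ℤ} {s : Finset ℤ} (hs : ∀ y ∈ s, 0 ≤ y ∧ y < 2 * p)
    (hx : 0 ≤ x ∧ x < 2 * p) (hz : 0 < z) (hzp : z < p) (r : s → Prop)
    (hr : ∀ y, ¬ r y → Cong (2 * p) y (x + z) ∨ Cong (2 * p) y (x - z)) :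
    Nat.card {y // ¬ r y} ≤ 2 := by
  obtain ⟨c, c0, c1, hc⟩ := exists_cong (n := 2 * (p : ℤ)) (x := x + z) (by omega) (by omega)
  obtain ⟨d, d0, d1, hd⟩ := exists_cong (n := 2 * (p : ℤ)) (x := x - z) (by omega) (by omega)
  have hmem : ∀ y : {y // ¬ r y}, (y : ℤ) ∈ ({c, d} : Finset ℤ) := by
    intro y
    have h1 := hs _ y.1.2
    rw [Finset.mem_insert, Finset.mem_singleton]
    rcases hr _ y.2 with h | h <;> unfold Cong at * <;> omega
  have h1 : Nat.card {y // ¬ r y} ≤ Nat.card ({c, d} : Finset ℤ) := by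
    refine Nat.card_le_card_of_injective (fun y => ⟨(y : ℤ), hmem y⟩) ?_
    intro y y' h
    exact Subtype.ext (Subtype.ext (Subtype.mk.inj h))
  refine h1.trans ?_
  rw [Nat.card_eq_fintype_card, Fintype.card_coe]
  exact Finset.card_le_two

/-! ### Crossing matchings that avoid a difference -/

/-- A perfect matching between the even and the odd vertices that are not in given lists, without
edges of difference `z`. -/
theorem exists_crossing_matching {p : ℕ} {z : ℤ} (hz : 0 < z) (hzp : z < p) (l l' : List ℤ)
    (hl : l.Nodup) (hl' : l'.Nodup) (hmem : ∀ x ∈ l, 0 ≤ x ∧ x < 2 * p ∧ x % 2 = 0)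
    (hmem' : ∀ x ∈ l', 0 ≤ x ∧ x < 2 * p ∧ x % 2 = 1) (hlen : l.length = l'.length)
    (hp : 4 + l.length ≤ p) :
    ∃ Γ : ℤ → ℤ → Prop, (∀ x y, Γ x y → Γ y x) ∧ (∀ x y y', Γ x y → Γ x y' → y = y') ∧
      (∀ x y, Γ x y → 0 ≤ x ∧ x < 2 * p ∧ x % 2 ≠ y % 2 ∧ x ∉ l ∧ x ∉ l' ∧
        ¬ Cong (2 * p) y (x + z) ∧ ¬ Cong (2 * p) y (x - z)) ∧
      (∀ x : ℤ, 0 ≤ x → x < 2 * p → x ∉ l → x ∉ l' → ∃ y, Γ x y) := by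
  classical
  let E : Finset ℤ := parityClass p 0 \ l.toFinset
  let O : Finset ℤ := parityClass p 1 \ l'.toFinset
  have hE : ∀ x, x ∈ E ↔ ((0 ≤ x ∧ x < 2 * p) ∧ x % 2 = 0) ∧ x ∉ l := by
    intro x; rw [Finset.mem_sdiff, mem_parity, List.mem_toFinset]
  have hO : ∀ x, x ∈ O ↔ ((0 ≤ x ∧ x < 2 * p) ∧ x % 2 = 1) ∧ x ∉ l' := by
    intro x; rw [Finset.mem_sdiff, mem_parity, List.mem_toFinset]
  have cE : E.card = p - l.length := by
    rw [Finset.card_sdiff_of_subset, card_parity p (.inl rfl), List.toFinset_card_of_nodup hl]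
    intro x hx
    have := hmem x (List.mem_toFinset.1 hx)
    rw [mem_parity]; omega
  have cO : O.card = p - l.length := by
    rw [Finset.card_sdiff_of_subset, card_parity p (.inr rfl), List.toFinset_card_of_nodup hl',
      hlen]
    intro x hx
    have := hmem' x (List.mem_toFinset.1 hx)
    rw [mem_parity]; omega
  -- Each vertex has only the two forbidden partners at distance z, and at least four vertices
  -- remain in each class.
  obtain ⟨f, hf⟩ := exists_bijection_of_almost_complete (α := E) (β := O)
    (by rw [Fintype.card_coe, Fintype.card_coe, cE, cO]) (by rw [Fintype.card_coe, cE]; omega)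
    (fun x y => ¬ Cong (2 * p) (y : ℤ) (x + z) ∧ ¬ Cong (2 * p) (y : ℤ) (x - z))
    (fun x => card_cong_le_two (p := p) (z := z) (x := x) (fun y hy => ((hO y).1 hy).1.1)
      ((hE _).1 x.2).1.1 hz hzp _ (fun y hy => by by_contra hc; exact hy (not_or.1 hc)))
    (fun y => card_cong_le_two (p := p) (z := z) (x := y) (fun x hx => ((hE x).1 hx).1.1)
      ((hO _).1 y.2).1.1 hz hzp _ (fun x hx => by unfold Cong at *; omega))
  refine ⟨fun x y => (∃ a : E, (a : ℤ) = x ∧ (f a : ℤ) = y) ∨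
    ∃ a : E, (a : ℤ) = y ∧ (f a : ℤ) = x, ?_, ?_, ?_, ?_⟩
  · rintro x y (h | h)
    exacts [.inr h, .inl h]
  · rintro x y y' (⟨a, rfl, rfl⟩ | ⟨a, rfl, rfl⟩) (⟨a', h1, rfl⟩ | ⟨a', rfl, h1⟩)
    · rw [Subtype.ext h1]
    · have := (hE _).1 a.2
      have := (hO _).1 (f a').2
      omega
    · have := (hE _).1 a'.2
      have := (hO _).1 (f a).2
      omega
    · rw [f.injective (Subtype.ext h1)]
  · rintro x y (⟨a, rfl, rfl⟩ | ⟨a, rfl, rfl⟩)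
    · have h1 := (hE _).1 a.2
      have h2 := (hO _).1 (f a).2
      refine ⟨h1.1.1.1, h1.1.1.2, by omega, h1.2, fun h => ?_, hf a⟩
      have := hmem' _ h
      omega
    · have h1 := (hE _).1 a.2
      have h2 := (hO _).1 (f a).2
      have h3 := hf a
      refine ⟨h2.1.1.1, h2.1.1.2, by omega, fun h => ?_, h2.2, ?_⟩
      · have := hmem _ h
        omega
      · unfold Cong at *; omega
  · intro x h0 h1 hx hx'
    by_cases h : x % 2 = 0
    · exact ⟨_, .inl ⟨⟨x, (hE x).2 ⟨⟨⟨h0, h1⟩, h⟩, hx⟩⟩, rfl, rfl⟩⟩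
    · exact ⟨_, .inr ⟨f.symm ⟨x, (hO x).2 ⟨⟨⟨h0, h1⟩, by omega⟩, hx'⟩⟩, rfl, by simp⟩⟩

/-! ### Block tilings for even p -/

/-- A tiling that, together with a block, covers all edges joining vertices of the same parity,
except those with difference `e` (even vertices) and `f` (odd vertices). -/
structure IsBlockTiling (p z e f : ℤ) (T : ℤ → ℤ → ℤ → Prop) : Prop extends
    IsTiling (2 * p) T where
  even_half : p % 2 = 0
  pos : 0 < z
  odd : z % 2 = 1
  lt : 2 * z < p
  avoid : ∀ w a b, T w a b → ¬ BlockDiff p z w a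
  cover_even : ∀ d, 0 < d → d < p → d % 2 = 0 → d ≠ e →
    ∃ w a b, T w a b ∧ (w + a) % 2 = 0 ∧ (a - b = d ∨ a - b = d - 2 * p)
  cover_odd : ∀ d, 0 < d → d < p → d % 2 = 0 → d ≠ f →
    ∃ w a b, T w a b ∧ (w + a) % 2 = 1 ∧ (a - b = d ∨ a - b = d - 2 * p)
  hole_even : 0 < e ∧ e < p ∧ e % 2 = 0
  hole_odd : 0 < f ∧ f < p ∧ f % 2 = 0

/-- The vertex colouring of edges given by a block tiling. -/
def blockTranslates (p z : ℤ) (T : ℤ → ℤ → ℤ → Prop) (w u v : ℤ) : Prop :=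
  translates (2 * p) T w u v ∨ block p z w u v

/-- It is enough to keep tile offsets apart from block offsets. This also excludes opposite arcs, as
the block offsets are closed under negation modulo 2p; the restriction to odd w in the offsets ±2z
survives the reversal because these are even. -/
theorem IsBlockTiling.isCherryFamily {p z e f : ℤ} {T : ℤ → ℤ → ℤ → Prop}
    (h : IsBlockTiling p z e f T) : IsCherryFamily (2 * p) (blockTranslates p z T) := by
  have hb := isCherryFamily_block h.pos h.odd h.lt h.even_half
  have key : ∀ w u v, translates (2 * p) T w u v → ¬ BlockDiff p z w (u - w) := by
    rintro w u v ⟨h1, h2, h3, h4, h5, h6, a, b, ht, h7, -⟩ hd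
    have h8 := h.avoid _ _ _ ht
    have h9 := h.range _ _ _ ht
    refine h8 ?_
    obtain ⟨q, rfl⟩ : ∃ q, u - w = q := ⟨_, rfl⟩
    have hz := h.pos
    have hl := h.lt
    have e : ∀ c, -p ≤ c → c < 2 * p → Cong (2 * p) (u - w) c → Cong (2 * p) a c := by
      intro c c1 c2 hc; unfold Cong at *; omega
    unfold BlockDiff at hd ⊢
    refine hd.imp (e _ (by omega) (by omega)) fun hd =>
      hd.imp (e _ (by omega) (by omega)) fun hd =>
      hd.imp (e _ (by omega) (by omega)) fun hd =>
      hd.imp (e _ (by omega) (by omega)) fun hd =>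
      hd.imp (e _ (by omega) (by omega)) fun hd =>
      ⟨hd.1, hd.2.imp (e _ (by omega) (by omega)) (e _ (by omega) (by omega))⟩
  refine (h.toIsTiling.isCherryFamily (by omega)).union hb ?_ ?_
  · intro w u v v' h1 h2
    exact key _ _ _ h1 (block_diff h.pos h.odd h.lt h.even_half h2)
  · intro w u v v' h1 h2
    have h3 := block_diff h.pos h.odd h.lt h.even_half h2
    have h4 := key _ _ _ h1
    have h5 : 0 ≤ u ∧ u < 2 * p ∧ 0 ≤ w ∧ w < 2 * p := by unfold translates at h1; omega
    have h6 := h.lt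
    have h7 := h.pos
    clear h1 h2
    unfold BlockDiff Cong at *
    have := h.even_half
    omega

theorem IsBlockTiling.exists_blockTranslates {p z e f : ℤ} {T : ℤ → ℤ → ℤ → Prop}
    (h : IsBlockTiling p z e f T) {u v : ℤ} (h0 : 0 ≤ u) (huv : u < v) (hv : v < 2 * p)
    (hpar : u % 2 = v % 2) : (∃ w, blockTranslates p z T w u v) ∨
      (u % 2 = 0 ∧ (v = u + e ∨ v = u + 2 * p - e)) ∨
      (u % 2 = 1 ∧ (v = u + f ∨ v = u + 2 * p - f)) := by
  have hp := h.even_half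
  by_cases hd : v = u + p
  · obtain ⟨w, hw⟩ := block_add_half h.pos h.odd h.lt h.even_half h0 hd hv
    exact .inl ⟨w, .inr hw⟩
  -- A difference above p is replaced by its negative modulo 2p, since differences are unoriented.
  · obtain ⟨d, d0, d1, d2, hd⟩ : ∃ d, 0 < d ∧ d < p ∧ d % 2 = 0 ∧
        (v - u = d ∨ v - u = 2 * p - d) := by
      by_cases v - u < p
      · exact ⟨v - u, by omega⟩
      · exact ⟨2 * p - (v - u), by omega⟩
    have key : (∃ w a b, T w a b ∧ (w + a) % 2 = u % 2 ∧ (a - b = d ∨ a - b = d - 2 * p)) →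
        ∃ w, blockTranslates p z T w u v := by
      rintro ⟨w, a, b, ht, h1, h2⟩
      have hn : (2 * p) % 2 = 0 := by omega
      by_cases h3 : v - u = d
      · obtain ⟨w, hw⟩ := h.toIsTiling.exists_translates hn (u := u) (v := v) (by omega) (by omega)
          (h.symm _ _ _ ht) (by omega) (by unfold Cong; omega)
        exact ⟨w, .inl hw⟩
      · obtain ⟨w, hw⟩ := h.toIsTiling.exists_translates hn (u := u) (v := v) (by omega) (by omega)
          ht (by omega) (by unfold Cong; omega)
        exact ⟨w, .inl hw⟩
    rcases Int.emod_two_eq_zero_or_one u with hu | hu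
    · by_cases he : d = e
      · right; left; omega
      · left
        obtain ⟨w, a, b, h1, h2, h3⟩ := h.cover_even d d0 d1 d2 he
        exact key ⟨w, a, b, h1, by omega, h3⟩
    · by_cases he : d = f
      · right; right; omega
      · left
        obtain ⟨w, a, b, h1, h2, h3⟩ := h.cover_odd d d0 d1 d2 he
        exact key ⟨w, a, b, h1, by omega, h3⟩

theorem IsBlockTiling.exists_blockTranslates_add {p z e f : ℤ} {T : ℤ → ℤ → ℤ → Prop}
    (h : IsBlockTiling p z e f T) {u v : ℤ} (hu : 0 ≤ u ∧ u < 2 * p) (hv : 0 ≤ v ∧ v < 2 * p)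
    (huv : Cong (2 * p) v (u + z) ∨ Cong (2 * p) v (u - z)) :
    ∃ w, blockTranslates p z T w u v := by
  rcases huv with huv | huv
  · obtain ⟨w, hw⟩ := block_add h.pos h.odd h.lt h.even_half hu hv huv
    exact ⟨w, .inr hw⟩
  · obtain ⟨w, hw⟩ := block_add h.pos h.odd h.lt h.even_half hv hu (by unfold Cong at *; omega)
    exact ⟨w, .inr hw.symm⟩

/-- The two neighbours of a vertex along edges with difference `z`. -/
theorem exists_neighbours {p z u : ℤ} (hz : 0 < z) (hzp : z < p) (hu : 0 ≤ u ∧ u < 2 * p) :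
    ∃ x y, x ≠ y ∧ 0 ≤ x ∧ x < 2 * p ∧ 0 ≤ y ∧ y < 2 * p ∧ Cong (2 * p) x (u + z) ∧
      Cong (2 * p) y (u - z) := by
  obtain ⟨x, h1, h2, h3⟩ := exists_cong (n := 2 * p) (x := u + z) (by omega) (by omega)
  obtain ⟨y, h4, h5, h6⟩ := exists_cong (n := 2 * p) (x := u - z) (by omega) (by omega)
  refine ⟨x, y, ?_, h1, h2, h4, h5, h3, h6⟩
  unfold Cong at *; omega

/-! ### Cycles of uncovered edges -/

/-- The edges from `x` to `x + e` or `x + f`, according to the parity of `x`. -/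
def StepTo (p e f x y : ℤ) : Prop :=
  0 ≤ x ∧ x < 2 * p ∧ 0 ≤ y ∧ y < 2 * p ∧
    ((x % 2 = 0 ∧ Cong (2 * p) y (x + e)) ∨ (x % 2 = 1 ∧ Cong (2 * p) y (x + f)))

/-- The edges that start at vertices with the property `P`. -/
def steps (p e f : ℤ) (P : ℤ → Prop) (x y : ℤ) : Prop :=
  (P x ∧ StepTo p e f x y) ∨ (P y ∧ StepTo p e f y x)

theorem steps_symm {p e f : ℤ} {P : ℤ → Prop} (x y : ℤ) (h : steps p e f P x y) :
    steps p e f P y x := h.symm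

theorem StepTo.right_unique {p e f x y y' : ℤ} (h : StepTo p e f x y)
    (h' : StepTo p e f x y') : y = y' := by
  unfold StepTo Cong at *; omega

theorem StepTo.left_unique {p e f x x' y : ℤ} (he : e % 2 = 0) (hf : f % 2 = 0)
    (h : StepTo p e f x y) (h' : StepTo p e f x' y) : x = x' := by
  unfold StepTo Cong at *; omega

theorem steps_unique {p e f : ℤ} (he : e % 2 = 0) (hf : f % 2 = 0) {P : ℤ → Prop}
    (hP : ∀ x y, StepTo p e f x y → P x → ¬ P y) {x y y' : ℤ} (h : steps p e f P x y)
    (h' : steps p e f P x y') : y = y' := by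
  rcases h with ⟨h1, h2⟩ | ⟨h1, h2⟩ <;> rcases h' with ⟨h3, h4⟩ | ⟨h3, h4⟩
  · exact h2.right_unique h4
  · exact absurd h1 (hP _ _ h4 h3)
  · exact absurd h3 (hP _ _ h2 h1)
  · exact h2.left_unique he hf h4

theorem steps_range {p e f : ℤ} {P : ℤ → Prop} {x y : ℤ} (h : steps p e f P x y) :
    0 ≤ x ∧ x < 2 * p ∧ 0 ≤ y ∧ y < 2 * p := by
  unfold steps StepTo at h; omega

theorem IsBlockTiling.exists_blockTranslates_or_steps {p z e f : ℤ} {T : ℤ → ℤ → ℤ → Prop}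
    (h : IsBlockTiling p z e f T) (P : ℤ → Prop) {u v : ℤ} (h0 : 0 ≤ u) (huv : u < v)
    (hv : v < 2 * p) (hpar : u % 2 = v % 2) : (∃ w, blockTranslates p z T w u v) ∨
      steps p e f P u v ∨ steps p e f (fun x => ¬ P x) u v := by
  have key : StepTo p e f u v ∨ StepTo p e f v u → steps p e f P u v ∨
      steps p e f (fun x => ¬ P x) u v := by
    unfold steps; tauto
  rcases h.exists_blockTranslates h0 huv hv hpar with h1 | h1 | h1
  · exact .inl h1
  · exact .inr (key (by unfold StepTo Cong; omega))
  · exact .inr (key (by unfold StepTo Cong; omega))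

/-- Block tilings whose uncovered edges form even cycles. -/
theorem harmoniousTotalColorable_of_blockTiling {V : Type*} [Fintype V] (G : SimpleGraph V)
    {p : ℕ} (hV : Fintype.card V = 2 * p) {z e f : ℤ} {T : ℤ → ℤ → ℤ → Prop}
    (h : IsBlockTiling p z e f T) (P : ℤ → Prop)
    (hP : ∀ x y, StepTo p e f x y → (P x ↔ ¬ P y)) : G.HarmoniousTotalColorable (3 * p) := by
  have hp1 := h.lt
  have hp2 := h.pos
  have he := h.hole_even.2.2
  have hf := h.hole_odd.2.2
  have hz := h.odd
  -- The two crossing edges of difference z are coloured by the block. This leaves crossing degree p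
  -- - 2 and pays for the two matchings into which the cycles split.
  have hnb : ∀ u : ℤ, 0 ≤ u → u < 2 * p → ∃ l : List ℤ, l.Nodup ∧ p ≤ (p - 2) + l.length ∧
      ∀ y ∈ l, 0 ≤ y ∧ y < 2 * p ∧ y % 2 ≠ u % 2 ∧ ∃ w, blockTranslates p z T w u y := by
    intro u hu0 hu1
    obtain ⟨x, y, h1, h2, h3, h4, h5, h6, h7⟩ := exists_neighbours (p := p) (z := z) (u := u)
      (by omega) (by omega) ⟨hu0, hu1⟩
    refine ⟨[x, y], by simpa using h1, by simp only [List.length_cons, List.length_nil]; omega,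
      ?_⟩
    intro y' hy'
    simp only [List.mem_cons, List.not_mem_nil, or_false] at hy'
    rcases hy' with rfl | rfl
    · exact ⟨h2, h3, by unfold Cong at h6; omega,
        h.exists_blockTranslates_add ⟨hu0, hu1⟩ ⟨h2, h3⟩ (.inl h6)⟩
    · exact ⟨h4, h5, by unfold Cong at h7; omega,
        h.exists_blockTranslates_add ⟨hu0, hu1⟩ ⟨h4, h5⟩ (.inr h7)⟩
  have hS : IsCherryFamily ((2 * p : ℕ) : ℤ) (blockTranslates p z T) := by
    have := h.isCherryFamily
    push_cast; exact this
  have hres := harmoniousTotalColorable_of_cherryFamily G hV (blockTranslates p z T) hS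
    ![steps p e f P, steps p e f (fun x => ¬ P x)]
    (by intro i; fin_cases i <;> exact steps_symm)
    (by
      intro i u v v' _ _ _ _ _ _
      fin_cases i
      · exact fun h1 h2 => steps_unique he hf (fun x y hxy => (hP x y hxy).1) h1 h2
      · intro (h1 : steps p e f (fun x => ¬ P x) u v) (h2 : steps p e f (fun x => ¬ P x) u v')
        exact steps_unique he hf (fun x y hxy h => by have := hP x y hxy; tauto) h1 h2)
    (fun x => x % 2 = 0) p p (p - 2)
    ((card_fin_le _ _ _ fun x h0 h1 h2 => mem_parity.2 ⟨⟨h0, by push_cast at h1; exact h1⟩, h2⟩).trans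
      (card_parity p (.inl rfl)).le)
    ((card_fin_le _ _ _ fun x h0 h1 (h2 : ¬ x % 2 = 0) =>
      mem_parity.2 ⟨⟨h0, by push_cast at h1; exact h1⟩, by omega⟩).trans
      (card_parity p (.inr rfl)).le)
    (by
      intro u v h0 huv hv hpar
      rcases h.exists_blockTranslates_or_steps P h0 huv (by push_cast at hv; exact hv)
        (by have : u % 2 = 0 ↔ v % 2 = 0 := hpar; omega) with h1 | h1 | h1
      exacts [.inl h1, .inr ⟨0, h1⟩, .inr ⟨1, h1⟩])
    (by
      intro u h0 h1 hu
      obtain ⟨l, h2, h3, h4⟩ := hnb u h0 (by push_cast at h1; exact h1)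
      refine ⟨l, h2, h3, fun y hy => ?_⟩
      obtain ⟨h5, h6, h7, h8⟩ := h4 y hy
      exact ⟨h5, by push_cast; exact h6, by omega, .inl h8⟩)
    (by
      intro u h0 h1 hu
      obtain ⟨l, h2, h3, h4⟩ := hnb u h0 (by push_cast at h1; exact h1)
      refine ⟨l, h2, h3, fun y hy => ?_⟩
      obtain ⟨h5, h6, h7, h8⟩ := h4 y hy
      exact ⟨h5, by push_cast; exact h6, by omega, .inl h8⟩)
  have h3 : 2 * p + (2 + (p - 2)) = 3 * p := by omega
  rwa [h3] at hres

/-! ### Rerouting matchings -/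

/-- The single edge `ab`. -/
def Single (a b x y : ℤ) : Prop := (x = a ∧ y = b) ∨ (x = b ∧ y = a)

theorem Single.symm {a b x y : ℤ} (h : Single a b x y) : Single a b y x := by
  unfold Single at *; omega

/-- The matching obtained from `A` by removing the edges at `a`, `a'`, `v`, `v'` and adding the
edges `ca` and `a'v`. -/
def reroute (A : ℤ → ℤ → Prop) (c a a' v v' x y : ℤ) : Prop :=
  (A x y ∧ (x ≠ a ∧ x ≠ a' ∧ x ≠ v ∧ x ≠ v') ∧ (y ≠ a ∧ y ≠ a' ∧ y ≠ v ∧ y ≠ v')) ∨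
    Single c a x y ∨ Single a' v x y

theorem reroute_symm {A : ℤ → ℤ → Prop} (hA : ∀ x y, A x y → A y x) (c a a' v v' : ℤ) (x y : ℤ)
    (h : reroute A c a a' v v' x y) : reroute A c a a' v v' y x := by
  rcases h with ⟨h1, h2, h3⟩ | h | h
  exacts [.inl ⟨hA _ _ h1, h3, h2⟩, .inr (.inl h.symm), .inr (.inr h.symm)]

theorem reroute_unique {A : ℤ → ℤ → Prop} {c a a' v v' : ℤ}
    (hA : ∀ x y y', A x y → A x y' → y = y') (hc : ∀ y, ¬ A c y)
    (h1 : c ≠ a) (h2 : c ≠ a') (h3 : c ≠ v) (h4 : a ≠ a') (h5 : a ≠ v) (h6 : a' ≠ v) {x y y' : ℤ}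
    (h : reroute A c a a' v v' x y) (h' : reroute A c a a' v v' x y') : y = y' := by
  have hc' : ∀ y, A x y → x ≠ c := by rintro y hy rfl; exact hc _ hy
  rcases h with ⟨h7, h8, h9⟩ | h | h <;> rcases h' with ⟨h7', h8', h9'⟩ | h' | h'
  · exact hA _ _ _ h7 h7'
  · have := hc' _ h7
    unfold Single at h'; omega
  · unfold Single at h'; omega
  · have := hc' _ h7'
    unfold Single at h; omega
  · unfold Single at h h'; omega
  · unfold Single at h h'; omega
  · unfold Single at h; omega
  · unfold Single at h h'; omega
  · unfold Single at h h'; omega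

/-- The only edges lost are aa' and vv'. The case v = v' serves a vertex v missed by `A`: the
hypotheses on v are then vacuous and only aa' is lost. -/
theorem reroute_of_mem {A : ℤ → ℤ → Prop} {c a a' v v' : ℤ} (hA : ∀ x y, A x y → A y x)
    (ha : ∀ y, A a y → y = a') (ha' : ∀ y, A a' y → y = a) (hv : ∀ y, A v y → y = v')
    (hv' : ∀ y, A v' y → y = v) {x y : ℤ} (h : A x y) :
    reroute A c a a' v v' x y ∨ Single a a' x y ∨ Single v v' x y := by
  have h1 : x = a → y = a' := by rintro rfl; exact ha _ h
  have h2 : x = a' → y = a := by rintro rfl; exact ha' _ h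
  have h3 : x = v → y = v' := by rintro rfl; exact hv _ h
  have h4 : x = v' → y = v := by rintro rfl; exact hv' _ h
  have h' := hA _ _ h
  have h5 : y = a → x = a' := by rintro rfl; exact ha _ h'
  have h6 : y = a' → x = a := by rintro rfl; exact ha' _ h'
  have h7 : y = v → x = v' := by rintro rfl; exact hv _ h'
  have h8 : y = v' → x = v := by rintro rfl; exact hv' _ h'
  by_cases k : (x ≠ a ∧ x ≠ a' ∧ x ≠ v ∧ x ≠ v') ∧ (y ≠ a ∧ y ≠ a' ∧ y ≠ v ∧ y ≠ v')
  · exact .inl (.inl ⟨h, k⟩)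
  · right
    unfold Single
    grind

/-- A matching `Γ` with four more edges. -/
def fourMore (Γ : ℤ → ℤ → Prop) (a a' b b' c c' d d' x y : ℤ) : Prop :=
  Γ x y ∨ Single a a' x y ∨ Single b b' x y ∨ Single c c' x y ∨ Single d d' x y

theorem fourMore_symm {Γ : ℤ → ℤ → Prop} (hA : ∀ x y, Γ x y → Γ y x) (a a' b b' c c' d d' : ℤ)
    (x y : ℤ) (h : fourMore Γ a a' b b' c c' d d' x y) : fourMore Γ a a' b b' c c' d d' y x := by
  rcases h with h | h | h | h | h
  exacts [.inl (hA _ _ h), .inr (.inl h.symm), .inr (.inr (.inl h.symm)),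
    .inr (.inr (.inr (.inl h.symm))), .inr (.inr (.inr (.inr h.symm)))]

theorem fourMore_unique {Γ : ℤ → ℤ → Prop} {a a' b b' c c' d d' : ℤ}
    (hA : ∀ x y y', Γ x y → Γ x y' → y = y')
    (hΓ : ∀ x y, Γ x y → x ∉ [a, a', b, b'] ∧ x ∉ [c, c', d, d'])
    (hl : [a, a', b, b'].Nodup) (hl' : [c, c', d, d'].Nodup)
    (hd : ∀ x ∈ [a, a', b, b'], x ∉ [c, c', d, d']) {x y y' : ℤ}
    (h : fourMore Γ a a' b b' c c' d d' x y) (h' : fourMore Γ a a' b b' c c' d d' x y') :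
    y = y' := by
  have k := fun y => hΓ x y
  simp only [List.nodup_cons, List.mem_cons, List.not_mem_nil, or_false, not_or, List.nodup_nil,
    and_true, forall_eq_or_imp, forall_eq, not_false_eq_true] at *
  have k1 : ∀ y, Γ x y → ¬ (Single a a' x y' ∨ Single b b' x y' ∨ Single c c' x y' ∨
      Single d d' x y') := by
    intro y hy; have := k y hy; unfold Single; omega
  have k2 : ∀ y, Γ x y → ¬ (Single a a' x y ∨ Single b b' x y ∨ Single c c' x y ∨
      Single d d' x y) := by
    intro y hy; have := k y hy; unfold Single; omega
  have k3 : ∀ y', Γ x y' → ¬ (Single a a' x y ∨ Single b b' x y ∨ Single c c' x y ∨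
      Single d d' x y) := by
    intro y hy; have := k y hy; unfold Single; omega
  rcases h with h | h
  · rcases h' with h' | h'
    · exact hA _ _ _ h h'
    · exact absurd h' (k1 _ h)
  · rcases h' with h' | h'
    · exact absurd h (k3 _ h')
    · clear k k1 k2 k3 hΓ hA
      unfold Single at h h'
      grind

/-! ### Slack offsets and colourings with three matchings -/

/-- A tiling does not use the differences `g` from and `-g` to the vertices of parity `π`. -/
structure IsSlack (p z π g : ℤ) (T : ℤ → ℤ → ℤ → Prop) : Prop where
  parity : π = 0 ∨ π = 1
  pos : 0 < g
  lt : g < 2 * p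
  even : g % 2 = 0
  ne_half : g ≠ p
  ne_hole : π = 1 → g ≠ 2 * z ∧ g + 2 * z ≠ 2 * p
  out : ∀ w a b, T w a b → w % 2 = π → ¬ Cong (2 * p) a g
  into : ∀ w a b, T w a b → (w + a) % 2 = π → ¬ Cong (2 * p) (a + g) 0

/-- As g is even, it can only collide with the even block offsets: p, and ±2z at odd vertices. These
are excluded by `ne_half` and `ne_hole`. -/
theorem IsBlockTiling.isCherryFamily_slack {p z e f π g : ℤ} {T : ℤ → ℤ → ℤ → Prop}
    (h : IsBlockTiling p z e f T) (hs : IsSlack p z π g T) :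
    IsCherryFamily (2 * p + 1)
      (fun w u v => blockTranslates p z T w u v ∨ slackEdges (2 * p) π g w u v) := by
  have hp := h.even_half
  have hz := h.odd
  have hzp := h.lt
  have hz0 := h.pos
  have hπ := hs.parity
  have g0 := hs.pos
  have g1 := hs.lt
  have g2 := hs.even
  have g3 := hs.ne_half
  have g4 := hs.ne_hole
  have ht := translates_ne h.toIsTiling (by omega) hs.into hs.out g0 g1
  have hblock : ∀ w u v, block p z w u v → (u % 2 = π → ¬ Cong (2 * p) w (u + g)) ∧
      (w % 2 = π → ¬ Cong (2 * p) u (w + g)) := by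
    intro w u v hb
    have hd := block_diff h.pos h.odd h.lt h.even_half hb
    have hr := (isCherryFamily_block h.pos h.odd h.lt h.even_half).range _ _ _ hb
    have hr' := (isCherryFamily_block h.pos h.odd h.lt h.even_half).range _ _ _ hb.symm
    clear hb ht
    unfold BlockDiff at hd
    constructor
    · intro h1 h2
      rcases hd with hd | hd | hd | hd | hd | ⟨hw, hd | hd⟩ <;> unfold Cong at * <;> omega
    · intro h1 h2
      rcases hd with hd | hd | hd | hd | hd | ⟨hw, hd | hd⟩ <;> unfold Cong at * <;> omega
  refine h.isCherryFamily.union_slackEdges (by omega) g0 g1 (.inr (by omega)) ?_ ?_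
  · rintro w u v (h1 | h1)
    exacts [ht.1 _ _ _ h1, (hblock _ _ _ h1).1]
  · rintro w u v (h1 | h1)
    exacts [ht.2 _ _ _ h1, (hblock _ _ _ h1).2]

theorem exists_slackEdges {p π g y : ℤ} (h0 : 0 ≤ y) (h1 : y < 2 * p) (hy : y % 2 = π)
    (hg0 : 0 < g) (hg : g < 2 * p) : ∃ w, slackEdges (2 * p) π g w y (2 * p) := by
  obtain ⟨w, w0, w1, hw⟩ := exists_cong (n := 2 * p) (x := y + g) (by omega) (by omega)
  exact ⟨w, w0, w1, .inl ⟨rfl, h0, h1, hy, hw⟩⟩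

theorem exists_crossing_matching' {p : ℕ} {z τ π : ℤ} (hz : 0 < z) (hzp : z < p) (l l' : List ℤ)
    (hτ : (τ = 0 ∧ π = 1) ∨ (τ = 1 ∧ π = 0))
    (hl : l.Nodup) (hl' : l'.Nodup) (hmem : ∀ x ∈ l, 0 ≤ x ∧ x < 2 * p ∧ x % 2 = τ)
    (hmem' : ∀ x ∈ l', 0 ≤ x ∧ x < 2 * p ∧ x % 2 = π) (hlen : l.length = l'.length)
    (hp : 4 + l.length ≤ p) :
    ∃ Γ : ℤ → ℤ → Prop, (∀ x y, Γ x y → Γ y x) ∧ (∀ x y y', Γ x y → Γ x y' → y = y') ∧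
      (∀ x y, Γ x y → 0 ≤ x ∧ x < 2 * p ∧ x % 2 ≠ y % 2 ∧ x ∉ l ∧ x ∉ l' ∧
        ¬ Cong (2 * p) y (x + z) ∧ ¬ Cong (2 * p) y (x - z)) ∧
      (∀ x : ℤ, 0 ≤ x → x < 2 * p → x ∉ l → x ∉ l' → ∃ y, Γ x y) := by
  rcases hτ with ⟨rfl, rfl⟩ | ⟨rfl, rfl⟩
  · exact exists_crossing_matching hz hzp l l' hl hl' hmem hmem' hlen hp
  · obtain ⟨Γ, h1, h2, h3, h4⟩ := exists_crossing_matching hz hzp l' l hl' hl hmem' hmem hlen.symm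
      (by omega)
    refine ⟨Γ, h1, h2, fun x y h => ?_, fun x a b c d => h4 x a b d c⟩
    obtain ⟨a, b, c, d, e⟩ := h3 x y h
    exact ⟨a, b, c, e.1, d, e.2⟩

theorem nodup_three {a b c : ℤ} (h1 : a ≠ b) (h2 : c ≠ a) (h3 : c ≠ b) : [a, b, c].Nodup := by
  simp only [List.nodup_cons, List.mem_cons, List.not_mem_nil, or_false, not_or, List.nodup_nil,
    and_true, not_false_eq_true]
  exact ⟨⟨h1, h2.symm⟩, h3.symm⟩

/-- The edges with difference `z` at a vertex that are coloured by vertices. -/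
theorem exists_coloured_neighbours {p z : ℤ} {S : ℤ → ℤ → ℤ → Prop} (hz : 0 < z) (hzp : z < p)
    (hz2 : z % 2 = 1)
    (hSz : ∀ x y, 0 ≤ x → x < 2 * p → 0 ≤ y → y < 2 * p →
      Cong (2 * p) y (x + z) ∨ Cong (2 * p) y (x - z) → ∃ w, S w x y)
    {x : ℤ} (hx0 : 0 ≤ x) (hx1 : x < 2 * p) :
    ∃ y y' : ℤ, y ≠ y' ∧ (0 ≤ y ∧ y < 2 * p) ∧ (0 ≤ y' ∧ y' < 2 * p) ∧ y % 2 = 1 - x % 2 ∧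
      y' % 2 = 1 - x % 2 ∧ (∃ w, S w x y) ∧ (∃ w, S w x y') ∧ Cong (2 * p) y (x + z) ∧
      Cong (2 * p) y' (x - z) := by
  obtain ⟨y, y', h1, h2, h3, h4, h5, h6, h7⟩ := exists_neighbours (p := p) (z := z) (u := x)
    hz hzp ⟨hx0, hx1⟩
  refine ⟨y, y', h1, ⟨h2, h3⟩, ⟨h4, h5⟩, ?_, ?_, hSz _ _ hx0 hx1 h2 h3 (.inl h6),
    hSz _ _ hx0 hx1 h4 h5 (.inr h7), h6, h7⟩
  · unfold Cong at h6; omega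
  · unfold Cong at h7; omega

/-- Edges with difference `z` coloured by vertices and three matchings covering all other edges
inside the parity classes, such that every vertex is in an edge of a matching between the parity
classes. -/
theorem harmoniousTotalColorable_of_threeMatchings {V : Type*} [Fintype V] (G : SimpleGraph V)
    {p : ℕ} (hV : Fintype.card V = 2 * p) {S : ℤ → ℤ → ℤ → Prop}
    (hS : IsCherryFamily (2 * p) S) {z : ℤ} (hz : 0 < z) (hzp : z < p) (hz2 : z % 2 = 1)
    (hp3 : 3 ≤ p)
    (hSz : ∀ x y, 0 ≤ x → x < 2 * (p : ℤ) → 0 ≤ y → y < 2 * (p : ℤ) →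
      Cong (2 * p) y (x + z) ∨ Cong (2 * p) y (x - z) → ∃ w, S w x y)
    (M : Fin 3 → ℤ → ℤ → Prop) (hMs : ∀ i x y, M i x y → M i y x)
    (hMu : ∀ i x y y', M i x y → M i x y' → y = y')
    (hcover : ∀ x y : ℤ, 0 ≤ x → x < y → y < 2 * p → x % 2 = y % 2 →
      (∃ w, S w x y) ∨ ∃ i, M i x y)
    (hcross : ∀ x : ℤ, 0 ≤ x → x < 2 * p → ∃ c : ℤ, (0 ≤ c ∧ c < 2 * p) ∧ c % 2 = 1 - x % 2 ∧
      ¬ Cong (2 * p) c (x + z) ∧ ¬ Cong (2 * p) c (x - z) ∧ ∃ i, M i x c) :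
    G.HarmoniousTotalColorable (3 * p) := by
  -- Of the p crossing edges at x, two have difference z and a third is in a matching. So p - 3
  -- colours suffice for the remainder, which pays for three matchings.
  have hdeg : ∀ x : ℤ, 0 ≤ x → x < 2 * p → ∃ l : List ℤ, l.Nodup ∧ p ≤ (p - 3) + l.length ∧
      ∀ y ∈ l, 0 ≤ y ∧ y < 2 * p ∧ y % 2 = 1 - x % 2 ∧ ((∃ w, S w x y) ∨ ∃ i, M i x y) := by
    intro x h0 h1
    obtain ⟨y, y', k1, k2, k3, k4, k5, k6, k7, k8, k9⟩ :=
      exists_coloured_neighbours hz hzp hz2 hSz h0 h1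
    obtain ⟨c, c0, c1, c2, c3, c4⟩ := hcross x h0 h1
    refine ⟨[y, y', c], nodup_three k1 (by rintro rfl; exact c2 k8) (by rintro rfl; exact c3 k9),
      ?_, ?_⟩
    · simp only [List.length_cons, List.length_nil]; omega
    · intro t ht
      simp only [List.mem_cons, List.not_mem_nil, or_false] at ht
      rcases ht with rfl | rfl | rfl
      exacts [⟨k2.1, k2.2, k4, .inl k6⟩, ⟨k3.1, k3.2, k5, .inl k7⟩, ⟨c0.1, c0.2, c1, .inr c4⟩]
  have hres := harmoniousTotalColorable_of_cherryFamily G hV S (by push_cast; exact hS) M hMs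
    (fun i x y y' _ _ _ _ _ _ => hMu i x y y') (fun x => x % 2 = 0) p p (p - 3)
    ((card_fin_le _ _ _ fun x h0 h1 h2 =>
      mem_parity.2 ⟨⟨h0, by push_cast at h1; exact h1⟩, h2⟩).trans (card_parity p (.inl rfl)).le)
    ((card_fin_le _ _ _ fun x h0 h1 (h2 : ¬ x % 2 = 0) =>
      mem_parity.2 ⟨⟨h0, by push_cast at h1; exact h1⟩, by omega⟩).trans
      (card_parity p (.inr rfl)).le) ?_ ?_ ?_
  · have h3 : 2 * p + (3 + (p - 3)) = 3 * p := by omega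
    rwa [h3] at hres
  · intro x y h0 hxy hy hpar
    have hpar : x % 2 = 0 ↔ y % 2 = 0 := hpar
    exact hcover x y h0 hxy (by push_cast at hy; exact hy) (by omega)
  · intro x h0 h1 hx
    obtain ⟨l, h2, h3, h4⟩ := hdeg x h0 (by push_cast at h1; exact h1)
    refine ⟨l, h2, h3, fun y hy => ?_⟩
    obtain ⟨h5, h6, h7, h8⟩ := h4 y hy
    exact ⟨h5, by push_cast; exact h6, by omega, h8⟩
  · intro x h0 h1 hx
    obtain ⟨l, h2, h3, h4⟩ := hdeg x h0 (by push_cast at h1; exact h1)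
    refine ⟨l, h2, h3, fun y hy => ?_⟩
    obtain ⟨h5, h6, h7, h8⟩ := h4 y hy
    exact ⟨h5, by push_cast; exact h6, by omega, h8⟩

/-- The same with a vertex at infinity, whose edges to the vertices of parity `π` are coloured by
vertices. -/
theorem harmoniousTotalColorable_of_threeMatchings_succ {V : Type*} [Fintype V] (G : SimpleGraph V)
    {p : ℕ} (hV : Fintype.card V = 2 * p + 1) {S : ℤ → ℤ → ℤ → Prop}
    (hS : IsCherryFamily (2 * p + 1) S) {z τ π : ℤ} (hz : 0 < z) (hzp : z < p) (hz2 : z % 2 = 1)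
    (hp3 : 2 ≤ p) (hτ : (τ = 0 ∧ π = 1) ∨ (τ = 1 ∧ π = 0))
    (hSz : ∀ x y, 0 ≤ x → x < 2 * (p : ℤ) → 0 ≤ y → y < 2 * (p : ℤ) →
      Cong (2 * p) y (x + z) ∨ Cong (2 * p) y (x - z) → ∃ w, S w x y)
    (hSinf : ∀ x, 0 ≤ x → x < 2 * (p : ℤ) → x % 2 = π → ∃ w, S w x (2 * p))
    (M : Fin 3 → ℤ → ℤ → Prop) (hMs : ∀ i x y, M i x y → M i y x)
    (hMu : ∀ i x y y', M i x y → M i x y' → y = y')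
    (hcover : ∀ x y : ℤ, 0 ≤ x → x < y → y < 2 * p → x % 2 = y % 2 →
      (∃ w, S w x y) ∨ ∃ i, M i x y)
    {a b : ℤ} (hab : a ≠ b) (ha : 0 ≤ a ∧ a < 2 * p ∧ a % 2 = τ)
    (hb : 0 ≤ b ∧ b < 2 * p ∧ b % 2 = τ)
    (hMa : ∃ i, M i (2 * p) a) (hMb : ∃ i, M i (2 * p) b)
    (hcross : ∀ x : ℤ, 0 ≤ x → x < 2 * p → x % 2 = τ → x ≠ a → x ≠ b →
      ∃ c : ℤ, (0 ≤ c ∧ c < 2 * p) ∧ c % 2 = π ∧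
      ¬ Cong (2 * p) c (x + z) ∧ ¬ Cong (2 * p) c (x - z) ∧ ∃ i, M i x c) :
    G.HarmoniousTotalColorable (3 * p + 2) := by
  have hcardA : Nat.card {x : Fin (2 * p + 1) // ((x : ℕ) : ℤ) % 2 = π ∨ ((x : ℕ) : ℤ) = 2 * p} ≤
      p + 1 := by
    refine (card_fin_le (2 * p + 1) (fun x => x % 2 = π ∨ x = 2 * p)
      (insert (2 * (p : ℤ)) (parityClass p π)) ?_).trans ((Finset.card_insert_le _ _).trans ?_)
    · intro x h0 h1 h2
      push_cast at h1
      rw [Finset.mem_insert, mem_parity]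
      omega
    · rw [card_parity p (by omega)]
  have hcardB : Nat.card {x : Fin (2 * p + 1) // ¬ (((x : ℕ) : ℤ) % 2 = π ∨
      ((x : ℕ) : ℤ) = 2 * p)} ≤ p := by
    refine (card_fin_le (2 * p + 1) (fun x => ¬ (x % 2 = π ∨ x = 2 * p))
      (parityClass p τ) ?_).trans (card_parity p (by omega)).le
    intro x h0 h1 h2
    push_cast at h1
    rw [mem_parity]
    omega
  -- The vertex at infinity joins the class π. With p - 2 colours for the remainder, ∞ must lose two
  -- of its p edges (to a and b), a vertex of π two of its p edges, and a vertex of τ three of its p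
  -- + 1.
  have hres := harmoniousTotalColorable_of_cherryFamily G hV S (by push_cast; exact hS) M hMs
    (fun i x y y' _ _ _ _ _ _ => hMu i x y y')
    (fun x => x % 2 = π ∨ x = 2 * p) (p + 1) p (p - 2) hcardA hcardB ?_ ?_ ?_
  · have h3 : 2 * p + 1 + (3 + (p - 2)) = 3 * p + 2 := by omega
    rwa [h3] at hres
  · intro x y h0 hxy hy hpar
    have hpar : (x % 2 = π ∨ x = 2 * p) ↔ (y % 2 = π ∨ y = 2 * p) := hpar
    push_cast at hy
    by_cases hy' : y = 2 * p
    · subst hy'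
      exact .inl (hSinf x h0 hxy (by omega))
    · exact hcover x y h0 hxy (by omega) (by omega)
  · intro x h0 h1 hx
    have hx : x % 2 = π ∨ x = 2 * p := hx
    push_cast at h1
    by_cases hx' : x = 2 * p
    · refine ⟨[a, b], by simpa using hab, ?_, ?_⟩
      · simp only [List.length_cons, List.length_nil]; omega
      · intro y hy
        simp only [List.mem_cons, List.not_mem_nil, or_false] at hy
        subst hx'
        rcases hy with rfl | rfl
        · exact ⟨ha.1, by push_cast; omega, by omega, .inr hMa⟩
        · exact ⟨hb.1, by push_cast; omega, by omega, .inr hMb⟩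
    · obtain ⟨y, y', k1, k2, k3, k4, k5, k6, k7, -⟩ :=
        exists_coloured_neighbours hz hzp hz2 hSz h0 (by omega)
      refine ⟨[y, y'], by simpa using k1, ?_, ?_⟩
      · simp only [List.length_cons, List.length_nil]; omega
      · intro t ht
        simp only [List.mem_cons, List.not_mem_nil, or_false] at ht
        rcases ht with rfl | rfl
        · exact ⟨by omega, by push_cast; omega, by omega, .inl k6⟩
        · exact ⟨by omega, by push_cast; omega, by omega, .inl k7⟩
  · intro x h0 h1 hx
    have hx : ¬ (x % 2 = π ∨ x = 2 * p) := hx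
    push_cast at h1
    replace hx : x % 2 = τ ∧ x < 2 * p := by omega
    obtain ⟨y, y', k1, k2, k3, k4, k5, k6, k7, k8, k9⟩ :=
      exists_coloured_neighbours hz hzp hz2 hSz h0 hx.2
    obtain ⟨c, c0, c1, c2, c3, c4, hc⟩ : ∃ c : ℤ, 0 ≤ c ∧ c ≤ 2 * p ∧
        (c % 2 = π ∨ c = 2 * p) ∧ c ≠ y ∧ c ≠ y' ∧ ∃ i, M i x c := by
      by_cases xa : x = a
      · obtain ⟨i, hi⟩ := hMa
        subst xa
        exact ⟨2 * p, by omega, le_rfl, .inr rfl, by omega, by omega, i, hMs _ _ _ hi⟩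
      by_cases xb : x = b
      · obtain ⟨i, hi⟩ := hMb
        subst xb
        exact ⟨2 * p, by omega, le_rfl, .inr rfl, by omega, by omega, i, hMs _ _ _ hi⟩
      obtain ⟨c, c0, c1, c2, c3, c4⟩ := hcross x h0 hx.2 hx.1 xa xb
      exact ⟨c, c0.1, c0.2.le, .inl c1, by rintro rfl; exact c2 k8, by rintro rfl; exact c3 k9, c4⟩
    refine ⟨[y, y', c], nodup_three k1 c3 c4, ?_, ?_⟩
    · simp only [List.length_cons, List.length_nil]; omega
    · intro t ht
      simp only [List.mem_cons, List.not_mem_nil, or_false] at ht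
      rcases ht with rfl | rfl | rfl
      · exact ⟨by omega, by push_cast; omega, by omega, .inl k6⟩
      · exact ⟨by omega, by push_cast; omega, by omega, .inl k7⟩
      · exact ⟨c0, by push_cast; omega, c2, .inr hc⟩

theorem nodup_four {a b c d : ℤ} (h1 : a ≠ b) (h2 : a ≠ c) (h3 : a ≠ d) (h4 : b ≠ c) (h5 : b ≠ d)
    (h6 : c ≠ d) : [a, b, c, d].Nodup := by
  simp only [List.nodup_cons, List.mem_cons, List.not_mem_nil, or_false, not_or, List.nodup_nil,
    and_true, not_false_eq_true]
  exact ⟨⟨h1, h2, h3⟩, ⟨h4, h5⟩, h6⟩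

set_option maxHeartbeats 1000000 in
/-- Block tilings whose uncovered edges form even cycles, and a vertex at infinity. -/
theorem harmoniousTotalColorable_of_blockTiling_succ {V : Type*} [Fintype V] (G : SimpleGraph V)
    {p : ℕ} (hV : Fintype.card V = 2 * p + 1) {z e f π τ g : ℤ} {T : ℤ → ℤ → ℤ → Prop}
    (h : IsBlockTiling p z e f T) (hs : IsSlack p z π g T) (P : ℤ → Prop)
    (hP : ∀ x y, StepTo p e f x y → (P x ↔ ¬ P y)) (hp8 : 8 ≤ p)
    (hτ : (τ = 0 ∧ π = 1) ∨ (τ = 1 ∧ π = 0)) {a a' b b' v v' u u' : ℤ}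
    (ha : StepTo p e f a a') (hb : StepTo p e f b b') (hv : StepTo p e f v v')
    (hu : StepTo p e f u u') (haτ : a % 2 = τ) (hbτ : b % 2 = τ) (hvπ : v % 2 = π)
    (huπ : u % 2 = π) (hPa : P a) (hPb : ¬ P b) (hPv : P v) (hPu : ¬ P u)
    (hab : a ≠ b') (hab' : a' ≠ b) (huv : v ≠ u') (huv' : v' ≠ u)
    (hav : ¬ Cong (2 * p) v (a' + z) ∧ ¬ Cong (2 * p) v (a' - z))
    (hbu : ¬ Cong (2 * p) u (b' + z) ∧ ¬ Cong (2 * p) u (b' - z)) :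
    G.HarmoniousTotalColorable (3 * p + 2) := by
  have hp1 := h.lt
  have hp2 := h.pos
  have he := h.hole_even.2.2
  have hf := h.hole_odd.2.2
  have hz := h.odd
  have hPa' : ¬ P a' := (hP _ _ ha).1 hPa
  have hPb' : P b' := by by_contra hc; exact hPb ((hP _ _ hb).2 hc)
  have hPv' : ¬ P v' := (hP _ _ hv).1 hPv
  have hPu' : P u' := by by_contra hc; exact hPu ((hP _ _ hu).2 hc)
  have range : ∀ x y, StepTo p e f x y → 0 ≤ x ∧ x < 2 * p ∧ 0 ≤ y ∧ y < 2 * p ∧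
      x % 2 = y % 2 := by
    intro x y hxy; unfold StepTo Cong at hxy; omega
  have ra := range _ _ ha
  have rb := range _ _ hb
  have rv := range _ _ hv
  have ru := range _ _ hu
  have nepar : ∀ x y : ℤ, x % 2 = τ → y % 2 = π → x ≠ y := by
    clear ra rb rv ru haτ hbτ hvπ huπ hab hab' huv huv'; omega
  have neinf : ∀ x : ℤ, x < 2 * p → 2 * p ≠ x := by
    clear ra rb rv ru haτ hbτ hvπ huπ hab hab' huv huv'; omega
  have neP : ∀ x y, P x → ¬ P y → x ≠ y := by rintro x y hx hy rfl; exact hy hx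
  have hl : [a, a', b, b'].Nodup := nodup_four (neP _ _ hPa hPa') (neP _ _ hPa hPb) hab hab'
    (neP _ _ hPb' hPa').symm (neP _ _ hPb' hPb).symm
  have hl' : [v, v', u, u'].Nodup := nodup_four (neP _ _ hPv hPv') (neP _ _ hPv hPu) huv huv'
    (neP _ _ hPu' hPv').symm (neP _ _ hPu' hPu).symm
  clear hab hab' huv huv'
  have hlmem : ∀ x ∈ [a, a', b, b'], 0 ≤ x ∧ x < 2 * (p : ℤ) ∧ x % 2 = τ := by
    intro x hx
    simp only [List.mem_cons, List.not_mem_nil, or_false] at hx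
    omega
  have hlmem' : ∀ x ∈ [v, v', u, u'], 0 ≤ x ∧ x < 2 * (p : ℤ) ∧ x % 2 = π := by
    intro x hx
    simp only [List.mem_cons, List.not_mem_nil, or_false] at hx
    omega
  -- Γ leaves out exactly the eight ends of four cycle edges, one from each of the two matchings in
  -- each class.
  obtain ⟨Γ, hΓs, hΓu, hΓ, hΓe⟩ := exists_crossing_matching' hp2 (by omega) _ _ hτ hl hl'
    hlmem hlmem' rfl hp8
  let A := steps p e f P
  let B := steps p e f (fun x => ¬ P x)
  have hAu : ∀ x y y', A x y → A x y' → y = y' := fun x y y' h1 h2 =>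
    steps_unique he hf (fun x y hxy => (hP x y hxy).1) h1 h2
  have hBu : ∀ x y y', B x y → B x y' → y = y' := fun x y y' h1 h2 =>
    steps_unique he hf (fun x y hxy h => by have := hP x y hxy; tauto) h1 h2
  have hAs : ∀ x y, A x y → A y x := steps_symm
  have hBs : ∀ x y, B x y → B y x := steps_symm
  have hA0 : ∀ y, ¬ A (2 * p) y := fun y hy => by have := steps_range hy; omega
  have hB0 : ∀ y, ¬ B (2 * p) y := fun y hy => by have := steps_range hy; omega
  have hAa : A a a' := .inl ⟨hPa, ha⟩
  have hAv : A v v' := .inl ⟨hPv, hv⟩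
  have hBb : B b b' := .inl ⟨hPb, hb⟩
  have hBu' : B u u' := .inl ⟨hPu, hu⟩
  -- The four cycle edges move to the third matching. Their ends become free in the first two, which
  -- receive ∞a, a'v and ∞b, b'u. Thus every vertex of τ has a matching edge to the other side: a
  -- and b to ∞, a' and b' to v and u, all others by Γ.
  let M : Fin 3 → ℤ → ℤ → Prop :=
    ![reroute A (2 * p) a a' v v', reroute B (2 * p) b b' u u', fourMore Γ a a' b b' v v' u u']
  have hMs : ∀ i x y, M i x y → M i y x := by
    intro i
    fin_cases i
    exacts [reroute_symm hAs _ _ _ _ _, reroute_symm hBs _ _ _ _ _,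
      fourMore_symm hΓs _ _ _ _ _ _ _ _]
  have hcross : ∀ x ∈ [a, a', b, b'], x ∉ [v, v', u, u'] := by
    intro x hx hx'
    have := hlmem x hx
    have := hlmem' x hx'
    omega
  have hMu : ∀ i x y y', M i x y → M i x y' → y = y' := by
    intro i x y y'
    fin_cases i
    · exact reroute_unique hAu hA0 (neinf _ ra.2.1) (neinf _ ra.2.2.2.1) (neinf _ rv.2.1)
        (neP _ _ hPa hPa') (nepar _ _ haτ hvπ) (nepar _ _ (ra.2.2.2.2.symm.trans haτ) hvπ)
    · exact reroute_unique hBu hB0 (neinf _ rb.2.1) (neinf _ rb.2.2.2.1) (neinf _ ru.2.1)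
        (neP _ _ hPb' hPb).symm (nepar _ _ hbτ huπ) (nepar _ _ (rb.2.2.2.2.symm.trans hbτ) huπ)
    · exact fourMore_unique hΓu (fun x y hxy => by
        have := hΓ x y hxy; exact ⟨this.2.2.2.1, this.2.2.2.2.1⟩) hl hl' hcross
  refine harmoniousTotalColorable_of_threeMatchings_succ G hV (h.isCherryFamily_slack hs) hp2
    (by omega) hz (by omega) hτ ?_ ?_ M hMs hMu ?_ (neP _ _ hPa hPb) ⟨ra.1, ra.2.1, haτ⟩
    ⟨rb.1, rb.2.1, hbτ⟩ ⟨0, .inr (.inl (.inl ⟨rfl, rfl⟩))⟩ ⟨1, .inr (.inl (.inl ⟨rfl, rfl⟩))⟩ ?_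
  · intro x y h1 h2 h3 h4 h5
    obtain ⟨w, hw⟩ := h.exists_blockTranslates_add ⟨h1, h2⟩ ⟨h3, h4⟩ h5
    exact ⟨w, .inl hw⟩
  · intro x h1 h2 h3
    obtain ⟨w, hw⟩ := exists_slackEdges h1 h2 h3 hs.pos hs.lt
    exact ⟨w, .inr hw⟩
  · intro x y h0 hxy hy hpar
    rcases h.exists_blockTranslates_or_steps P h0 hxy hy hpar with ⟨w, hw⟩ | hA | hB
    · exact .inl ⟨w, .inl hw⟩
    · right
      rcases reroute_of_mem (c := 2 * p) hAs (fun y hy => hAu _ _ _ hy hAa)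
        (fun y hy => hAu _ _ _ hy (hAs _ _ hAa)) (fun y hy => hAu _ _ _ hy hAv)
        (fun y hy => hAu _ _ _ hy (hAs _ _ hAv)) hA with h1 | h1 | h1
      exacts [⟨0, h1⟩, ⟨2, .inr (.inl h1)⟩, ⟨2, .inr (.inr (.inr (.inl h1)))⟩]
    · right
      rcases reroute_of_mem (c := 2 * p) hBs (fun y hy => hBu _ _ _ hy hBb)
        (fun y hy => hBu _ _ _ hy (hBs _ _ hBb)) (fun y hy => hBu _ _ _ hy hBu')
        (fun y hy => hBu _ _ _ hy (hBs _ _ hBu')) hB with h1 | h1 | h1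
      exacts [⟨1, h1⟩, ⟨2, .inr (.inr (.inl h1))⟩, ⟨2, .inr (.inr (.inr (.inr h1)))⟩]
  · intro x h0 h1 hx xa xb
    by_cases xa' : x = a'
    · subst xa'
      exact ⟨v, ⟨rv.1, rv.2.1⟩, hvπ, hav.1, hav.2, 0, .inr (.inr (.inl ⟨rfl, rfl⟩))⟩
    by_cases xb' : x = b'
    · subst xb'
      exact ⟨u, ⟨ru.1, ru.2.1⟩, huπ, hbu.1, hbu.2, 1, .inr (.inr (.inl ⟨rfl, rfl⟩))⟩
    obtain ⟨c, hc⟩ := hΓe x h0 h1 (by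
      simp only [List.mem_cons, List.not_mem_nil, or_false, not_or]
      exact ⟨xa, xa', xb, xb'⟩) (fun hx' => by
      have := hlmem' x hx'; omega)
    have h2 := hΓ x c hc
    have h3 := hΓ c x (hΓs _ _ hc)
    exact ⟨c, ⟨h3.1, h3.2.1⟩, by omega, h2.2.2.2.2.2.1, h2.2.2.2.2.2.2, 2, .inl hc⟩

/-! ### Centred and pinned families of tiles -/

/-- The edges with ends `w + c + d` and `w + c - d`, of parity `π`, for `d ≡ ε` modulo `2` and
`|d| ≤ r`. -/
def Centred (π c ε r w a b : ℤ) : Prop :=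
  (w + a) % 2 = π ∧ a + b = 2 * c ∧ (a - c) % 2 = ε ∧ c - r ≤ a ∧ a ≤ c + r ∧ a ≠ c

/-- The edges with ends `w + x` and `w + y`, of parity `π`. -/
def Pinned (π x y w a b : ℤ) : Prop :=
  (w + a) % 2 = π ∧ ((a = x ∧ b = y) ∨ (a = y ∧ b = x))

/-- The edge does not have the difference `d`. -/
def Off (d a b : ℤ) : Prop := a - b ≠ d ∧ b - a ≠ d

theorem Centred.symm {π c ε r w a b : ℤ} (h : Centred π c ε r w a b) : Centred π c ε r w b a := by
  unfold Centred at *; omega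

theorem Centred.congr {π c ε r w w' a b : ℤ} (hw : w % 2 = w' % 2) (h : Centred π c ε r w a b) :
    Centred π c ε r w' a b := by
  unfold Centred at *; omega

theorem Pinned.symm {π x y w a b : ℤ} (hxy : x % 2 = y % 2) (h : Pinned π x y w a b) :
    Pinned π x y w b a := by
  unfold Pinned at *; omega

theorem Pinned.congr {π x y w w' a b : ℤ} (hw : w % 2 = w' % 2) (h : Pinned π x y w a b) :
    Pinned π x y w' a b := by
  unfold Pinned at *; omega

theorem Off.symm {d a b : ℤ} (h : Off d a b) : Off d b a := And.symm h

/-! ### Even p: p ≡ 4 mod 8 -/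

/-- The tiling for `p = 8 j + 4`. -/
def tilingModEightFour (j w a b : ℤ) : Prop :=
  Centred 0 (4 * j + 2) 0 (4 * j) w a b ∨
  (Centred 0 (8 * j + 4) 1 (4 * j + 1) w a b ∧ Off (4 * j + 2) a b) ∨
  Centred 1 (4 * j + 2) 0 (4 * j) w a b ∨
  (Centred 1 0 1 (4 * j + 1) w a b ∧ Off (4 * j + 2) a b)

set_option maxHeartbeats 2000000 in
-- Inside each class the offsets are 2, 4, …, 8j + 2 without the centre 4j + 2, so never opposite.
-- From even to odd they are the odd numbers between -(4j + 1) and 4j + 1, from odd to even the same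
-- shifted by p, and these sets meet no negatives of each other. The half-difference h = z is
-- dropped because ±z and p ± z belong to the block; hence 2z is the hole in both classes. The
-- centre 4j + 2 = 2z is what the block needs at odd vertices.
theorem isBlockTiling_tilingModEightFour {p z j : ℤ} (hj : 0 ≤ j) (hp : p = 8 * j + 4)
    (hz : z = 2 * j + 1) : IsBlockTiling p z (2 * z) (2 * z) (tilingModEightFour j) where
  even_half := by omega
  pos := by omega
  odd := by omega
  lt := by omega
  hole_even := by omega
  hole_odd := by omega
  range := by
    intro w a b h
    unfold tilingModEightFour at h
    rcases h with h | h | h | h <;> unfold Centred at h <;> omega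
  periodic := by
    intro w w' a b h hw
    exact h.imp (·.congr hw) <| Or.imp (·.imp_left (·.congr hw)) <| Or.imp (·.congr hw)
      (·.imp_left (·.congr hw))
  symm := by
    intro w a b h
    exact h.imp (·.symm) <| Or.imp (·.imp (·.symm) (·.symm)) <| Or.imp (·.symm)
      (·.imp (·.symm) (·.symm))
  inj := by
    intro w a b a' b' h h' hc
    unfold tilingModEightFour at *
    rcases h with h | h | h | h <;> rcases h' with h' | h' | h' | h' <;>
      simp only [Centred, Off, Cong] at * <;> omega
  anti := by
    intro w a b a' b' h h' hc
    unfold tilingModEightFour at *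
    rcases h with h | h | h | h <;> rcases h' with h' | h' | h' | h' <;>
      simp only [Centred, Off, Cong] at * <;> omega
  avoid := by
    intro w a b h hd
    unfold tilingModEightFour BlockDiff at *
    rcases h with h | h | h | h <;> simp only [Centred, Off, Cong] at * <;> omega
  cover_even := by
    intro d d0 d1 d2 d3
    obtain ⟨h, rfl⟩ : ∃ h, d = 2 * h := ⟨d / 2, by omega⟩
    by_cases hh : h % 2 = 0
    · exact ⟨4 * j + 2 + h, 4 * j + 2 + h, 4 * j + 2 - h, .inl (by simp only [Centred]; omega),
        by omega, by omega⟩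
    · exact ⟨8 * j + 4 + h, 8 * j + 4 + h, 8 * j + 4 - h,
        .inr (.inl (by simp only [Centred, Off]; omega)), by omega, by omega⟩
  cover_odd := by
    intro d d0 d1 d2 d3
    obtain ⟨h, rfl⟩ : ∃ h, d = 2 * h := ⟨d / 2, by omega⟩
    by_cases hh : h % 2 = 0
    · exact ⟨4 * j + 3 + h, 4 * j + 2 + h, 4 * j + 2 - h,
        .inr (.inr (.inl (by simp only [Centred]; omega))), by omega, by omega⟩
    · exact ⟨h + 1, h, - h, .inr (.inr (.inr (by simp only [Centred, Off]; omega))), by omega, by omega⟩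

/-- The slack offset is the omitted centre in the even class, where the block does not use 2z. -/
theorem isSlack_tilingModEightFour {p z j : ℤ} (hj : 0 ≤ j) (hp : p = 8 * j + 4) :
    IsSlack p z 0 (4 * j + 2) (tilingModEightFour j) where
  parity := by omega
  pos := by omega
  lt := by omega
  even := by omega
  ne_half := by omega
  ne_hole := by omega
  out := by
    intro w a b h hw hc
    unfold tilingModEightFour at h
    rcases h with h | h | h | h <;> simp only [Centred, Off, Cong] at * <;> omega
  into := by
    intro w a b h hw hc
    unfold tilingModEightFour at h
    rcases h with h | h | h | h <;> simp only [Centred, Off, Cong] at * <;> omega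

theorem harmoniousTotalColorable_even_mod_eight_four {V : Type*} [Fintype V] (G : SimpleGraph V) {p j : ℕ}
    (hp : p = 8 * j + 4) (hV : Fintype.card V = 2 * p) : G.HarmoniousTotalColorable (3 * p) := by
  refine harmoniousTotalColorable_of_blockTiling G hV
    (isBlockTiling_tilingModEightFour (j := j) (z := 2 * j + 1) (by omega) (by omega) rfl)
    (fun x => x % 4 = 0 ∨ x % 4 = 1) ?_
  -- Both holes are 2 modulo 4, and 4 divides 2p, so a step switches the residue within its parity
  -- class.
  intro x y hxy
  unfold StepTo Cong at hxy
  omega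

theorem harmoniousTotalColorable_odd_mod_eight_four {V : Type*} [Fintype V] (G : SimpleGraph V) {p j : ℕ}
    (hj : 0 < j) (hp : p = 8 * j + 4) (hV : Fintype.card V = 2 * p + 1) :
    G.HarmoniousTotalColorable (3 * p + 2) := by
  refine harmoniousTotalColorable_of_blockTiling_succ G hV (τ := 1)
    (isBlockTiling_tilingModEightFour (j := j) (z := 2 * j + 1) (by omega) (by omega) rfl)
    (isSlack_tilingModEightFour (j := j) (by omega) (by omega))
    (fun x => x % 4 = 0 ∨ x % 4 = 1) ?_ (by omega) (by omega)
    -- Steps of length 4j + 2, in each class one with `P` at its start and one without; the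
    -- connecting edges a'v and b'u do not have difference z.
    (a := 1) (a' := 4 * j + 3) (b := 8 * j + 7) (b' := 12 * j + 9) (v := 0) (v' := 4 * j + 2)
    (u := 8 * j + 6) (u' := 12 * j + 8) ?_ ?_ ?_ ?_ ?_ ?_ ?_ ?_ ?_ ?_ ?_ ?_ ?_ ?_ ?_ ?_ ?_ ?_
  · intro x y hxy
    unfold StepTo Cong at hxy
    omega
  all_goals (try unfold StepTo); (try unfold Cong); omega

/-! ### Even p: p ≡ 0 mod 8 -/

/-- The tiling for `p = 8 i`. -/
def tilingModEightZero (i δ w a b : ℤ) : Prop :=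
  Centred 0 (4 * i) 0 (4 * i - 2) w a b ∨
  (Centred 0 0 1 (4 * i - 1) w a b ∧ Off (4 * i + 2) a b ∧ Off (8 * i - 4 - 2 * δ) a b) ∨
  Pinned 0 (2 + δ - 4 * i) (δ - 8 * i) w a b ∨
  Centred 1 (4 * i + 2) 0 (4 * i - 4) w a b ∨
  Pinned 1 4 (4 - 2 * δ) w a b ∨
  (Centred 1 (8 * i) 1 (4 * i - 1) w a b ∧ Off (4 * i + 2) a b ∧ Off (2 * δ) a b) ∨
  Pinned 1 (2 + δ - 4 * i) (δ - 8 * i) w a b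

set_option maxHeartbeats 4000000 in
-- Besides h = z, which is lost to the block, h = 4i - 2 - δ is dropped in the even class and h = δ
-- in the odd class. The offsets so released, or the reverses of released offsets, form the pair (2
-- + δ - 4i, δ - 8i) of difference 4i + 2 = 2z, used from odd to even and from even to odd: this
-- restores 2z in both classes. The odd class regains 2δ from the small offsets 4 and 4 - 2δ, at the
-- cost of the radius and hence of the hole 8i - 4. The condition 2i ≠ 3 + δ keeps the hole of the
-- even class different from 2z.
theorem isBlockTiling_tilingModEightZero {p z i δ : ℤ} (hi : 1 ≤ i)
    (hδ : 1 ≤ δ ∧ δ ≤ 3 ∧ δ % 2 = 1 ∧ δ ≤ 4 * i - 3 ∧ 2 * i ≠ 3 + δ)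
    (hp : p = 8 * i)
    (hz : z = 2 * i + 1) : IsBlockTiling p z (8 * i - 4 - 2 * δ) (8 * i - 4) (tilingModEightZero i δ) where
  even_half := by omega
  pos := by omega
  odd := by omega
  lt := by omega
  hole_even := by omega
  hole_odd := by omega
  range := by
    intro w a b h
    unfold tilingModEightZero at h
    rcases h with h | h | h | h | h | h | h <;> simp only [Centred, Pinned] at h <;> omega
  periodic := by
    intro w w' a b h hw
    exact h.imp (·.congr hw) <| Or.imp
      (·.imp_left (·.congr hw)) <| Or.imp
      (·.congr hw) <| Or.imp
      (·.congr hw) <| Or.imp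
      (·.congr hw) <| Or.imp
      (·.imp_left (·.congr hw)) (·.congr hw)
  symm := by
    intro w a b h
    exact h.imp (·.symm) <| Or.imp
      (·.imp (·.symm) (·.imp (·.symm) (·.symm))) <| Or.imp
      (·.symm (by omega)) <| Or.imp
      (·.symm) <| Or.imp
      (·.symm (by omega)) <| Or.imp
      (·.imp (·.symm) (·.imp (·.symm) (·.symm))) (·.symm (by omega))
  inj := by
    intro w a b a' b' h h' hc
    simp only [tilingModEightZero, Centred, Pinned, Off] at h h'
    rcases hc with hc | hc | hc <;>
      rcases h with h | h | h | h | h | h | h <;>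
      rcases h' with h' | h' | h' | h' | h' | h' | h' <;>
      first
      | (exfalso; omega)
      | (unfold Cong; omega)
  anti := by
    intro w a b a' b' h h' hc
    simp only [tilingModEightZero, Centred, Pinned, Off] at h h'
    rcases hc with hc | hc | hc <;>
      rcases h with h | h | h | h | h | h | h <;>
      rcases h' with h' | h' | h' | h' | h' | h' | h' <;>
      omega
  avoid := by
    intro w a b h hd
    unfold tilingModEightZero BlockDiff at *
    rcases h with h | h | h | h | h | h | h <;>
      simp only [Centred, Pinned, Off, Cong] at * <;> omega
  cover_even := by
    intro d d0 d1 d2 d3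
    obtain ⟨h, rfl⟩ : ∃ h, d = 2 * h := ⟨d / 2, by omega⟩
    by_cases h0 : h % 2 = 0
    · exact ⟨4 * i + h, 4 * i + h, 4 * i - h,
        .inl (by simp only [Centred]; omega), by omega, by omega⟩
    by_cases h2 : h = 2 * i + 1
    · exact ⟨2 + δ - 4 * i, 2 + δ - 4 * i, δ - 8 * i,
        .inr (.inr (.inl (by unfold Pinned; omega))), by omega, by omega⟩
    exact ⟨h, h, - h,
      .inr (.inl (by simp only [Centred, Off]; omega)), by omega, by omega⟩
  cover_odd := by
    intro d d0 d1 d2 d3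
    obtain ⟨h, rfl⟩ : ∃ h, d = 2 * h := ⟨d / 2, by omega⟩
    by_cases h3 : h % 2 = 0
    · exact ⟨4 * i + 2 + h + 1, 4 * i + 2 + h, 4 * i + 2 - h,
        .inr (.inr (.inr (.inl (by simp only [Centred]; omega)))), by omega, by omega⟩
    by_cases h6 : h = 2 * i + 1
    · exact ⟨2 + δ - 4 * i + 1, 2 + δ - 4 * i, δ - 8 * i,
        .inr (.inr (.inr (.inr (.inr (.inr (by unfold Pinned; omega)))))), by omega, by omega⟩
    by_cases h4 : h = δ
    · exact ⟨4 + 1, 4, 4 - 2 * δ,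
        .inr (.inr (.inr (.inr (.inl (by unfold Pinned; omega))))), by omega, by omega⟩
    exact ⟨8 * i + h + 1, 8 * i + h, 8 * i - h,
      .inr (.inr (.inr (.inr (.inr (.inl (by simp only [Centred, Off]; omega)))))), by omega, by omega⟩

set_option maxHeartbeats 1000000 in
theorem isSlack_tilingModEightZero {p z i δ : ℤ} (hi : 1 ≤ i)
    (hδ : 1 ≤ δ ∧ δ ≤ 3 ∧ δ % 2 = 1 ∧ δ ≤ 4 * i - 3 ∧ 2 * i ≠ 3 + δ)
    (hp : p = 8 * i) : IsSlack p z 0 (4 * i) (tilingModEightZero i δ) where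
  parity := by omega
  pos := by omega
  lt := by omega
  even := by omega
  ne_half := by omega
  ne_hole := by omega
  out := by
    intro w a b h hw hc
    unfold tilingModEightZero at h
    rcases h with h | h | h | h | h | h | h <;>
      simp only [Centred, Pinned, Off, Cong] at * <;> omega
  into := by
    intro w a b h hw hc
    unfold tilingModEightZero at h
    rcases h with h | h | h | h | h | h | h <;>
      simp only [Centred, Pinned, Off, Cong] at * <;> omega

/-- The value δ = 1 is excluded only for i = 2. -/
theorem exists_shift {i : ℤ} (hi : 1 ≤ i) :
    ∃ δ : ℤ, 1 ≤ δ ∧ δ ≤ 3 ∧ δ % 2 = 1 ∧ δ ≤ 4 * i - 3 ∧ 2 * i ≠ 3 + δ := by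
  by_cases h : i = 2
  · exact ⟨3, by omega⟩
  · exact ⟨1, by omega⟩

theorem harmoniousTotalColorable_even_mod_eight_zero {V : Type*} [Fintype V] (G : SimpleGraph V) {p i : ℕ}
    (hi : 1 ≤ i) (hp : p = 8 * i) (hV : Fintype.card V = 2 * p) :
    G.HarmoniousTotalColorable (3 * p) := by
  obtain ⟨δ, hδ⟩ := exists_shift (i := i) (by omega)
  refine harmoniousTotalColorable_of_blockTiling G hV
    (isBlockTiling_tilingModEightZero (i := i) (z := 2 * i + 1) (by omega) hδ (by omega) rfl)
    (fun x => x % 4 = 0 ∨ x % 8 = 1 ∨ x % 8 = 3) ?_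
  -- The even hole is 2 modulo 4 and the odd hole is 4 modulo 8, while 8 divides 2p.
  intro x y hxy
  unfold StepTo Cong at hxy
  omega

theorem harmoniousTotalColorable_odd_mod_eight_zero {V : Type*} [Fintype V] (G : SimpleGraph V) {p i : ℕ}
    (hi : 1 ≤ i) (hp : p = 8 * i) (hV : Fintype.card V = 2 * p + 1) :
    G.HarmoniousTotalColorable (3 * p + 2) := by
  obtain ⟨δ, hδ⟩ := exists_shift (i := i) (by omega)
  refine harmoniousTotalColorable_of_blockTiling_succ G hV (τ := 1)
    (isBlockTiling_tilingModEightZero (i := i) (z := 2 * i + 1) (by omega) hδ (by omega) rfl)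
    (isSlack_tilingModEightZero (i := i) (by omega) hδ (by omega))
    (fun x => x % 4 = 0 ∨ x % 8 = 1 ∨ x % 8 = 3) ?_ (by omega) (by omega)
    (a := 1) (a' := 8 * i - 3) (b := 8 * i + 7) (b' := 3) (v := 0) (v' := 8 * i - 4 - 2 * δ)
    (u := 8 * i + 2) (u' := 16 * i - 2 - 2 * δ) ?_ ?_ ?_ ?_ ?_ ?_ ?_ ?_ ?_ ?_ ?_ ?_ ?_ ?_ ?_ ?_
    ?_ ?_
  · intro x y hxy
    unfold StepTo Cong at hxy
    omega
  all_goals (try unfold StepTo); (try unfold Cong); omega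

/-! ### Even p: p ≡ 6 mod 8 -/

/-- The tiling for `p = 8 i + 6`. -/
def tilingModEightSix (i w a b : ℤ) : Prop :=
  Centred 0 (4 * i + 4) 0 (4 * i) w a b ∨
  Pinned 0 (4 * i + 4) 2 w a b ∨
  (Centred 0 0 1 (4 * i - 1) w a b ∧ Off (4 * i + 2) a b) ∨
  Pinned 0 (4 * i + 1) (-4 * i - 3) w a b ∨
  Centred 1 (4 * i + 2) 0 (4 * i) w a b ∨
  (Centred 1 (8 * i + 6) 1 (4 * i + 1) w a b ∧ Off (4 * i + 2) a b) ∨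
  Pinned 1 (4 * i + 1) (-4 * i - 3) w a b

set_option maxHeartbeats 4000000 in
-- In the even class 2z = 4i + 2 is regained from the free centre 4i + 4 and the offset 2; in the
-- odd class it is the hole. The difference 8i + 4 is too long for the centred tiles and is covered
-- in both classes by the offsets 4i + 1 and -4i - 3. For this the odd-to-even offsets ±(4i + 1)
-- must be released, which makes 8i + 2 the hole of the even class.
theorem isBlockTiling_tilingModEightSix {p z i : ℤ} (hi : 1 ≤ i)
    (hp : p = 8 * i + 6)
    (hz : z = 2 * i + 1) : IsBlockTiling p z (8 * i + 2) (4 * i + 2) (tilingModEightSix i) where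
  even_half := by omega
  pos := by omega
  odd := by omega
  lt := by omega
  hole_even := by omega
  hole_odd := by omega
  range := by
    intro w a b h
    unfold tilingModEightSix at h
    rcases h with h | h | h | h | h | h | h <;> simp only [Centred, Pinned] at h <;> omega
  periodic := by
    intro w w' a b h hw
    exact h.imp (·.congr hw) <| Or.imp
      (·.congr hw) <| Or.imp
      (·.imp_left (·.congr hw)) <| Or.imp
      (·.congr hw) <| Or.imp
      (·.congr hw) <| Or.imp
      (·.imp_left (·.congr hw)) (·.congr hw)
  symm := by
    intro w a b h
    exact h.imp (·.symm) <| Or.imp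
      (·.symm (by omega)) <| Or.imp
      (·.imp (·.symm) (·.symm)) <| Or.imp
      (·.symm (by omega)) <| Or.imp
      (·.symm) <| Or.imp
      (·.imp (·.symm) (·.symm)) (·.symm (by omega))
  inj := by
    intro w a b a' b' h h' hc
    simp only [tilingModEightSix, Centred, Pinned, Off] at h h'
    rcases hc with hc | hc | hc <;>
      rcases h with h | h | h | h | h | h | h <;>
      rcases h' with h' | h' | h' | h' | h' | h' | h' <;>
      first
      | (exfalso; omega)
      | (unfold Cong; omega)
  anti := by
    intro w a b a' b' h h' hc
    simp only [tilingModEightSix, Centred, Pinned, Off] at h h'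
    rcases hc with hc | hc | hc <;>
      rcases h with h | h | h | h | h | h | h <;>
      rcases h' with h' | h' | h' | h' | h' | h' | h' <;>
      omega
  avoid := by
    intro w a b h hd
    unfold tilingModEightSix BlockDiff at *
    rcases h with h | h | h | h | h | h | h <;>
      simp only [Centred, Pinned, Off, Cong] at * <;> omega
  cover_even := by
    intro d d0 d1 d2 d3
    obtain ⟨h, rfl⟩ : ∃ h, d = 2 * h := ⟨d / 2, by omega⟩
    by_cases h3 : h = 4 * i + 2
    · exact ⟨4 * i + 1, 4 * i + 1, -4 * i - 3,
        .inr (.inr (.inr (.inl (by unfold Pinned; omega)))), by omega, by omega⟩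
    by_cases h0 : h % 2 = 0
    · exact ⟨4 * i + 4 + h, 4 * i + 4 + h, 4 * i + 4 - h,
        .inl (by simp only [Centred]; omega), by omega, by omega⟩
    by_cases h1 : h = 2 * i + 1
    · exact ⟨4 * i + 4, 4 * i + 4, 2,
        .inr (.inl (by unfold Pinned; omega)), by omega, by omega⟩
    exact ⟨h, h, - h,
      .inr (.inr (.inl (by simp only [Centred, Off]; omega))), by omega, by omega⟩
  cover_odd := by
    intro d d0 d1 d2 d3
    obtain ⟨h, rfl⟩ : ∃ h, d = 2 * h := ⟨d / 2, by omega⟩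
    by_cases h6 : h = 4 * i + 2
    · exact ⟨4 * i + 1 + 1, 4 * i + 1, -4 * i - 3,
        .inr (.inr (.inr (.inr (.inr (.inr (by unfold Pinned; omega)))))), by omega, by omega⟩
    by_cases h4 : h % 2 = 0
    · exact ⟨4 * i + 2 + h + 1, 4 * i + 2 + h, 4 * i + 2 - h,
        .inr (.inr (.inr (.inr (.inl (by simp only [Centred]; omega))))), by omega, by omega⟩
    exact ⟨8 * i + 6 + h + 1, 8 * i + 6 + h, 8 * i + 6 - h,
      .inr (.inr (.inr (.inr (.inr (.inl (by simp only [Centred, Off]; omega)))))), by omega, by omega⟩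

set_option maxHeartbeats 1000000 in
-- The tile offsets from odd to odd end at 8i + 2, so the two neighbours p - 2 and p + 2 of p are
-- free.
theorem isSlack_tilingModEightSix {p z i : ℤ} (hi : 1 ≤ i)
    (hp : p = 8 * i + 6)
    (hz : z = 2 * i + 1) : IsSlack p z 1 (8 * i + 4) (tilingModEightSix i) where
  parity := by omega
  pos := by omega
  lt := by omega
  even := by omega
  ne_half := by omega
  ne_hole := by omega
  out := by
    intro w a b h hw hc
    unfold tilingModEightSix at h
    rcases h with h | h | h | h | h | h | h <;>
      simp only [Centred, Pinned, Off, Cong] at * <;> omega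
  into := by
    intro w a b h hw hc
    unfold tilingModEightSix at h
    rcases h with h | h | h | h | h | h | h <;>
      simp only [Centred, Pinned, Off, Cong] at * <;> omega

theorem harmoniousTotalColorable_even_mod_eight_six {V : Type*} [Fintype V] (G : SimpleGraph V) {p i : ℕ}
    (hi : 1 ≤ i) (hp : p = 8 * i + 6) (hV : Fintype.card V = 2 * p) :
    G.HarmoniousTotalColorable (3 * p) := by
  refine harmoniousTotalColorable_of_blockTiling G hV
    (isBlockTiling_tilingModEightSix (i := i) (z := 2 * i + 1) (by omega) (by omega) rfl)
    (fun x => x % 4 = 0 ∨ x % 4 = 1) ?_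
  intro x y hxy
  unfold StepTo Cong at hxy
  omega

theorem harmoniousTotalColorable_odd_mod_eight_six {V : Type*} [Fintype V] (G : SimpleGraph V) {p i : ℕ}
    (hi : 1 ≤ i) (hp : p = 8 * i + 6) (hV : Fintype.card V = 2 * p + 1) :
    G.HarmoniousTotalColorable (3 * p + 2) := by
  refine harmoniousTotalColorable_of_blockTiling_succ G hV (τ := 0)
    (isBlockTiling_tilingModEightSix (i := i) (z := 2 * i + 1) (by omega) (by omega) rfl)
    (isSlack_tilingModEightSix (i := i) (by omega) (by omega) rfl)
    (fun x => x % 4 = 0 ∨ x % 4 = 1) ?_ (by omega) (by omega)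
    (a := 0) (a' := 8 * i + 2) (b := 8 * i + 6) (b' := 16 * i + 8) (v := 1) (v' := 4 * i + 3)
    (u := 8 * i + 7) (u' := 12 * i + 9) ?_ ?_ ?_ ?_ ?_ ?_ ?_ ?_ ?_ ?_ ?_ ?_ ?_ ?_ ?_ ?_ ?_ ?_
  · intro x y hxy
    unfold StepTo Cong at hxy
    omega
  all_goals (try unfold StepTo); (try unfold Cong); omega

/-! ### Even p: p ≡ 2 mod 8 -/

/-- The tiling for `p = 8 i + 2`. -/
def tilingModEightTwo (i w a b : ℤ) : Prop :=
  (Centred 0 (4 * i) 0 (4 * i - 2) w a b ∧ Off (4 * i) a b) ∨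
  Pinned 0 (8 * i) (4 * i) w a b ∨
  Pinned 0 (2 * i) (-6 * i) w a b ∨
  (Centred 0 0 1 (4 * i - 3) w a b ∧ Off 2 a b) ∨
  Pinned 0 (1 - 4 * i) (-4 * i - 1) w a b ∨
  Centred 1 (4 * i + 2) 0 (4 * i - 2) w a b ∨
  (Centred 1 (8 * i + 2) 1 (4 * i - 1) w a b ∧ Off 2 a b) ∨
  Pinned 1 (1 - 4 * i) (-4 * i - 1) w a b

set_option maxHeartbeats 4000000 in
-- In the even class the difference 4i moves to the centre 4i and the offset 8i. This releases 2i
-- and 6i, and 2i with -6i covers the difference 8i. The difference 2 = 2z is covered in both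
-- classes by the offsets 1 - 4i and -4i - 1, for which the odd-to-even offsets ±(4i - 1) are given
-- up; so 8i - 2 is the even hole. The odd class stops one tile earlier, with hole 8i.
theorem isBlockTiling_tilingModEightTwo {p z i : ℤ} (hi : 1 ≤ i)
    (hp : p = 8 * i + 2)
    (hz : z = 1) : IsBlockTiling p z (8 * i - 2) (8 * i) (tilingModEightTwo i) where
  even_half := by omega
  pos := by omega
  odd := by omega
  lt := by omega
  hole_even := by omega
  hole_odd := by omega
  range := by
    intro w a b h
    unfold tilingModEightTwo at h
    rcases h with h | h | h | h | h | h | h | h <;> simp only [Centred, Pinned] at h <;> omega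
  periodic := by
    intro w w' a b h hw
    exact h.imp (·.imp_left (·.congr hw)) <| Or.imp
      (·.congr hw) <| Or.imp
      (·.congr hw) <| Or.imp
      (·.imp_left (·.congr hw)) <| Or.imp
      (·.congr hw) <| Or.imp
      (·.congr hw) <| Or.imp
      (·.imp_left (·.congr hw)) (·.congr hw)
  symm := by
    intro w a b h
    exact h.imp (·.imp (·.symm) (·.symm)) <| Or.imp
      (·.symm (by omega)) <| Or.imp
      (·.symm (by omega)) <| Or.imp
      (·.imp (·.symm) (·.symm)) <| Or.imp
      (·.symm (by omega)) <| Or.imp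
      (·.symm) <| Or.imp
      (·.imp (·.symm) (·.symm)) (·.symm (by omega))
  inj := by
    intro w a b a' b' h h' hc
    simp only [tilingModEightTwo, Centred, Pinned, Off] at h h'
    rcases hc with hc | hc | hc <;>
      rcases h with h | h | h | h | h | h | h | h <;>
      rcases h' with h' | h' | h' | h' | h' | h' | h' | h' <;>
      first
      | (exfalso; omega)
      | (unfold Cong; omega)
  anti := by
    intro w a b a' b' h h' hc
    simp only [tilingModEightTwo, Centred, Pinned, Off] at h h'
    rcases hc with hc | hc | hc <;>
      rcases h with h | h | h | h | h | h | h | h <;>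
      rcases h' with h' | h' | h' | h' | h' | h' | h' | h' <;>
      omega
  avoid := by
    intro w a b h hd
    unfold tilingModEightTwo BlockDiff at *
    rcases h with h | h | h | h | h | h | h | h <;>
      simp only [Centred, Pinned, Off, Cong] at * <;> omega
  cover_even := by
    intro d d0 d1 d2 d3
    obtain ⟨h, rfl⟩ : ∃ h, d = 2 * h := ⟨d / 2, by omega⟩
    by_cases h2 : h = 4 * i
    · exact ⟨2 * i, 2 * i, -6 * i,
        .inr (.inr (.inl (by unfold Pinned; omega))), by omega, by omega⟩
    by_cases h1 : h = 2 * i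
    · exact ⟨8 * i, 8 * i, 4 * i,
        .inr (.inl (by unfold Pinned; omega)), by omega, by omega⟩
    by_cases h0 : h % 2 = 0
    · exact ⟨4 * i + h, 4 * i + h, 4 * i - h,
        .inl (by simp only [Centred, Off]; omega), by omega, by omega⟩
    by_cases h4 : h = 1
    · exact ⟨1 - 4 * i, 1 - 4 * i, -4 * i - 1,
        .inr (.inr (.inr (.inr (.inl (by unfold Pinned; omega))))), by omega, by omega⟩
    exact ⟨h, h, - h,
      .inr (.inr (.inr (.inl (by simp only [Centred, Off]; omega)))), by omega, by omega⟩
  cover_odd := by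
    intro d d0 d1 d2 d3
    obtain ⟨h, rfl⟩ : ∃ h, d = 2 * h := ⟨d / 2, by omega⟩
    by_cases h5 : h % 2 = 0
    · exact ⟨4 * i + 2 + h + 1, 4 * i + 2 + h, 4 * i + 2 - h,
        .inr (.inr (.inr (.inr (.inr (.inl (by simp only [Centred]; omega)))))), by omega, by omega⟩
    by_cases h7 : h = 1
    · exact ⟨1 - 4 * i + 1, 1 - 4 * i, -4 * i - 1,
        .inr (.inr (.inr (.inr (.inr (.inr (.inr (by unfold Pinned; omega))))))), by omega, by omega⟩
    exact ⟨8 * i + 2 + h + 1, 8 * i + 2 + h, 8 * i + 2 - h,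
      .inr (.inr (.inr (.inr (.inr (.inr (.inl (by simp only [Centred, Off]; omega))))))), by omega, by omega⟩

set_option maxHeartbeats 1000000 in
theorem isSlack_tilingModEightTwo {p z i : ℤ} (hi : 1 ≤ i)
    (hp : p = 8 * i + 2)
    (hz : z = 1) : IsSlack p z 1 (4 * i + 2) (tilingModEightTwo i) where
  parity := by omega
  pos := by omega
  lt := by omega
  even := by omega
  ne_half := by omega
  ne_hole := by omega
  out := by
    intro w a b h hw hc
    unfold tilingModEightTwo at h
    rcases h with h | h | h | h | h | h | h | h <;>
      simp only [Centred, Pinned, Off, Cong] at * <;> omega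
  into := by
    intro w a b h hw hc
    unfold tilingModEightTwo at h
    rcases h with h | h | h | h | h | h | h | h <;>
      simp only [Centred, Pinned, Off, Cong] at * <;> omega

/-- Every second edge of the cycles of uncovered edges, for `p = 8 i + 2`. -/
def firstHalf (i x : ℤ) : Prop :=
  x % 4 = 0 ∨ (x % 4 = 3 ∧ x < 8 * i + 2) ∨ (x % 4 = 1 ∧ 8 * i + 2 < x)

/-- The other edges of these cycles, except two. -/
def secondHalf (i x : ℤ) : Prop :=
  x % 4 = 2 ∨ (x % 4 = 1 ∧ x < 8 * i + 2 ∧ x ≠ 1) ∨ (x % 4 = 3 ∧ 8 * i + 3 < x)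

theorem firstHalf_not {p i x y : ℤ} (hp : p = 8 * i + 2)
    (h : StepTo p (8 * i - 2) (8 * i) x y) (hx : firstHalf i x) : ¬ firstHalf i y := by
  unfold StepTo Cong firstHalf at *
  omega

theorem secondHalf_not {p i x y : ℤ} (hp : p = 8 * i + 2)
    (h : StepTo p (8 * i - 2) (8 * i) x y) (hx : secondHalf i x) : ¬ secondHalf i y := by
  unfold StepTo Cong secondHalf at *
  omega

/-- The even class is one cycle of even length p. Since gcd(8i, 16i + 4) = 4, the odd class splits
into two cycles of odd length 4i + 1, and each of them leaves one edge over. -/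
theorem firstHalf_or {p i x y : ℤ} (hp : p = 8 * i + 2)
    (h : StepTo p (8 * i - 2) (8 * i) x y) : firstHalf i x ∨ secondHalf i x ∨
      (x = 1 ∧ y = 8 * i + 1) ∨ (x = 8 * i + 3 ∧ y = 16 * i + 3) := by
  unfold StepTo Cong firstHalf secondHalf at *
  omega

theorem cover_tilingModEightTwo {p z i : ℤ} (hi : 1 ≤ i) (hp : p = 8 * i + 2) (hz : z = 1) {x y : ℤ}
    (h0 : 0 ≤ x) (hxy : x < y) (hy : y < 2 * p) (hpar : x % 2 = y % 2) :
    (∃ w, blockTranslates p z (tilingModEightTwo i) w x y) ∨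
      steps p (8 * i - 2) (8 * i) (firstHalf i) x y ∨
      steps p (8 * i - 2) (8 * i) (secondHalf i) x y ∨
      Single 1 (8 * i + 1) x y ∨ Single (8 * i + 3) (16 * i + 3) x y := by
  rcases (isBlockTiling_tilingModEightTwo hi hp hz).exists_blockTranslates_or_steps (firstHalf i) h0 hxy hy
    hpar with h | h | ⟨h, h'⟩ | ⟨h, h'⟩
  · exact .inl h
  · exact .inr (.inl h)
  · rcases firstHalf_or hp h' with h1 | h1 | h1 | h1
    · exact absurd h1 h
    · exact .inr (.inr (.inl (.inl ⟨h1, h'⟩)))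
    · exact .inr (.inr (.inr (.inl (.inl h1))))
    · exact .inr (.inr (.inr (.inr (.inl h1))))
  · rcases firstHalf_or hp h' with h1 | h1 | h1 | h1
    · exact absurd h1 h
    · exact .inr (.inr (.inl (.inr ⟨h1, h'⟩)))
    · exact .inr (.inr (.inr (.inl (.inr h1.symm))))
    · exact .inr (.inr (.inr (.inr (.inr h1.symm))))

/-- The omitted vertices are the ends of the four edges that join Γ in the third matching: two from
the even cycle and the two left over. -/
theorem exists_matching_tilingModEightTwo {p i : ℕ} (hi : 1 ≤ i) (hp : p = 8 * i + 2) :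
    ∃ Γ : ℤ → ℤ → Prop, (∀ x y, Γ x y → Γ y x) ∧ (∀ x y y', Γ x y → Γ x y' → y = y') ∧
      (∀ x y, Γ x y → 0 ≤ x ∧ x < 2 * p ∧ x % 2 ≠ y % 2 ∧
        x ∉ [(0 : ℤ), 8 * i - 2, 8 * i + 2, 16 * i] ∧
        x ∉ [(1 : ℤ), 8 * i + 1, 8 * i + 3, 16 * i + 3] ∧
        ¬ Cong (2 * p) y (x + 1) ∧ ¬ Cong (2 * p) y (x - 1)) ∧
      (∀ x : ℤ, 0 ≤ x → x < 2 * p → x ∉ [(0 : ℤ), 8 * i - 2, 8 * i + 2, 16 * i] →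
        x ∉ [(1 : ℤ), 8 * i + 1, 8 * i + 3, 16 * i + 3] → ∃ y, Γ x y) := by
  refine exists_crossing_matching (by omega) (by omega) _ _
    (nodup_four (by omega) (by omega) (by omega) (by omega) (by omega) (by omega))
    (nodup_four (by omega) (by omega) (by omega) (by omega) (by omega) (by omega)) ?_ ?_ rfl
    (by simp only [List.length_cons, List.length_nil]; omega)
  · intro x hx
    simp only [List.mem_cons, List.not_mem_nil, or_false] at hx
    omega
  · intro x hx
    simp only [List.mem_cons, List.not_mem_nil, or_false] at hx
    omega

set_option maxHeartbeats 1000000 in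
theorem harmoniousTotalColorable_even_mod_eight_two {V : Type*} [Fintype V] (G : SimpleGraph V) {p i : ℕ}
    (hi : 1 ≤ i) (hp : p = 8 * i + 2) (hV : Fintype.card V = 2 * p) :
    G.HarmoniousTotalColorable (3 * p) := by
  obtain ⟨Γ, hΓs, hΓu, hΓ, hΓe⟩ := exists_matching_tilingModEightTwo hi hp
  have hi' : (1 : ℤ) ≤ i := by omega
  have hp' : (p : ℤ) = 8 * i + 2 := by omega
  have h := isBlockTiling_tilingModEightTwo hi' hp' rfl
  let A := steps p (8 * i - 2) (8 * i) (firstHalf i)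
  let B := steps p (8 * i - 2) (8 * i) (secondHalf i)
  have hAu : ∀ x y y', A x y → A x y' → y = y' := fun x y y' h1 h2 =>
    steps_unique (by omega) (by omega) (fun x y hxy => firstHalf_not hp' hxy) h1 h2
  have hBu : ∀ x y y', B x y → B x y' → y = y' := fun x y y' h1 h2 =>
    steps_unique (by omega) (by omega) (fun x y hxy => secondHalf_not hp' hxy) h1 h2
  have hAs : ∀ x y, A x y → A y x := steps_symm
  have hBs : ∀ x y, B x y → B y x := steps_symm
  have hA1 : ∀ y, ¬ A (8 * i + 1) y := by
    intro y hy
    simp only [A, steps, firstHalf, StepTo, Cong] at hy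
    omega
  have hA2 : ∀ y, ¬ A (16 * i + 3) y := by
    intro y hy
    simp only [A, steps, firstHalf, StepTo, Cong] at hy
    omega
  have hB1 : ∀ y, ¬ B 1 y := by
    intro y hy
    simp only [B, steps, secondHalf, StepTo, Cong] at hy
    omega
  have hB2 : ∀ y, ¬ B (8 * i + 3) y := by
    intro y hy
    simp only [B, steps, secondHalf, StepTo, Cong] at hy
    omega
  have hAa : A 0 (8 * i - 2) := .inl (by unfold firstHalf StepTo Cong; omega)
  have hBb : B (8 * i + 2) (16 * i) := .inl (by unfold secondHalf StepTo Cong; omega)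
  -- `A` misses 8i + 1 and 16i + 3, and `B` misses 1 and 8i + 3. Moving one even edge out of each to
  -- the third matching frees two ends, which are joined by crossing edges to the missed odd
  -- vertices. So every vertex has a crossing edge in some matching.
  let M : Fin 3 → ℤ → ℤ → Prop :=
    ![reroute A (8 * i + 1) 0 (8 * i - 2) (16 * i + 3) (16 * i + 3),
      reroute B 1 (8 * i + 2) (16 * i) (8 * i + 3) (8 * i + 3),
      fourMore Γ 0 (8 * i - 2) (8 * i + 2) (16 * i) 1 (8 * i + 1) (8 * i + 3) (16 * i + 3)]
  have hMs : ∀ i x y, M i x y → M i y x := by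
    intro i
    fin_cases i
    exacts [reroute_symm hAs _ _ _ _ _, reroute_symm hBs _ _ _ _ _,
      fourMore_symm hΓs _ _ _ _ _ _ _ _]
  have hMu : ∀ i x y y', M i x y → M i x y' → y = y' := by
    intro i x y y'
    fin_cases i
    · exact reroute_unique hAu hA1 (by omega) (by omega) (by omega) (by omega)
        (by omega) (by omega)
    · exact reroute_unique hBu hB1 (by omega) (by omega) (by omega) (by omega)
        (by omega) (by omega)
    · exact fourMore_unique hΓu (fun x y hxy => by
        have := hΓ x y hxy; exact ⟨this.2.2.2.1, this.2.2.2.2.1⟩)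
        (nodup_four (by omega) (by omega) (by omega) (by omega) (by omega) (by omega))
        (nodup_four (by omega) (by omega) (by omega) (by omega) (by omega) (by omega))
        (by
          intro x hx hx'
          simp only [List.mem_cons, List.not_mem_nil, or_false] at hx hx'
          omega)
  refine harmoniousTotalColorable_of_threeMatchings G hV h.isCherryFamily (z := 1) (by omega)
    (by omega) rfl (by omega) ?_ M hMs hMu ?_ ?_
  · intro x y h1 h2 h3 h4 h5
    exact h.exists_blockTranslates_add ⟨h1, h2⟩ ⟨h3, h4⟩ h5
  · intro x y h0 hxy hy hpar
    rcases cover_tilingModEightTwo hi' hp' rfl h0 hxy hy hpar with hS | hA | hB | hC | hC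
    · exact .inl hS
    · right
      rcases reroute_of_mem (c := 8 * i + 1) (v := 16 * i + 3) (v' := 16 * i + 3) hAs
        (fun y hy => hAu _ _ _ hy hAa)
        (fun y hy => hAu _ _ _ hy (hAs _ _ hAa)) (fun y hy => absurd hy (hA2 y))
        (fun y hy => absurd hy (hA2 y)) hA with h1 | h1 | h1
      · exact ⟨0, h1⟩
      · exact ⟨2, .inr (.inl h1)⟩
      · unfold Single at h1; omega
    · right
      rcases reroute_of_mem (c := 1) (v := 8 * i + 3) (v' := 8 * i + 3) hBs
        (fun y hy => hBu _ _ _ hy hBb)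
        (fun y hy => hBu _ _ _ hy (hBs _ _ hBb)) (fun y hy => absurd hy (hB2 y))
        (fun y hy => absurd hy (hB2 y)) hB with h1 | h1 | h1
      · exact ⟨1, h1⟩
      · exact ⟨2, .inr (.inr (.inl h1))⟩
      · unfold Single at h1; omega
    · exact .inr ⟨2, .inr (.inr (.inr (.inl hC)))⟩
    · exact .inr ⟨2, .inr (.inr (.inr (.inr hC)))⟩
  · intro x h0 h1
    have key : ∀ (i : Fin 3) (c : ℤ), 0 ≤ c → c < 2 * p → c % 2 = 1 - x % 2 →
        c - x ≠ 1 → x - c ≠ 1 → c - x + 1 ≠ 2 * p → x - c + 1 ≠ 2 * p → M i x c →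
        ∃ c : ℤ, (0 ≤ c ∧ c < 2 * p) ∧ c % 2 = 1 - x % 2 ∧ ¬ Cong (2 * p) c (x + 1) ∧
          ¬ Cong (2 * p) c (x - 1) ∧ ∃ i, M i x c := by
      intro i c c0 c1 c2 c3 c4 c5 c6 c7
      exact ⟨c, ⟨c0, c1⟩, c2, by unfold Cong; omega, by unfold Cong; omega, i, c7⟩
    by_cases hx : x ∈ [(0 : ℤ), 8 * i - 2, 8 * i + 2, 16 * i]
    · simp only [List.mem_cons, List.not_mem_nil, or_false] at hx
      rcases hx with rfl | rfl | rfl | rfl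
      · exact key 0 (8 * i + 1) (by omega) (by omega) (by omega) (by omega) (by omega) (by omega)
          (by omega) (.inr (.inl (.inr ⟨rfl, rfl⟩)))
      · exact key 0 (16 * i + 3) (by omega) (by omega) (by omega) (by omega) (by omega) (by omega)
          (by omega) (.inr (.inr (.inl ⟨rfl, rfl⟩)))
      · exact key 1 1 (by omega) (by omega) (by omega) (by omega) (by omega) (by omega)
          (by omega) (.inr (.inl (.inr ⟨rfl, rfl⟩)))
      · exact key 1 (8 * i + 3) (by omega) (by omega) (by omega) (by omega) (by omega) (by omega)
          (by omega) (.inr (.inr (.inl ⟨rfl, rfl⟩)))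
    by_cases hx' : x ∈ [(1 : ℤ), 8 * i + 1, 8 * i + 3, 16 * i + 3]
    · simp only [List.mem_cons, List.not_mem_nil, or_false] at hx'
      clear hx
      rcases hx' with rfl | rfl | rfl | rfl
      · exact key 1 (8 * i + 2) (by omega) (by omega) (by omega) (by omega) (by omega) (by omega)
          (by omega) (.inr (.inl (.inl ⟨rfl, rfl⟩)))
      · exact key 0 0 (by omega) (by omega) (by omega) (by omega) (by omega) (by omega)
          (by omega) (.inr (.inl (.inl ⟨rfl, rfl⟩)))
      · exact key 1 (16 * i) (by omega) (by omega) (by omega) (by omega) (by omega) (by omega)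
          (by omega) (.inr (.inr (.inr ⟨rfl, rfl⟩)))
      · exact key 0 (8 * i - 2) (by omega) (by omega) (by omega) (by omega) (by omega) (by omega)
          (by omega) (.inr (.inr (.inr ⟨rfl, rfl⟩)))
    obtain ⟨c, hc⟩ := hΓe x h0 h1 hx hx'
    have h2 := hΓ x c hc
    have h3 := hΓ c x (hΓs _ _ hc)
    exact ⟨c, ⟨h3.1, h3.2.1⟩, by omega, h2.2.2.2.2.2.1, h2.2.2.2.2.2.2, 2, .inl hc⟩

set_option maxHeartbeats 1000000 in
theorem harmoniousTotalColorable_odd_mod_eight_two {V : Type*} [Fintype V] (G : SimpleGraph V) {p i : ℕ}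
    (hi : 1 ≤ i) (hp : p = 8 * i + 2) (hV : Fintype.card V = 2 * p + 1) :
    G.HarmoniousTotalColorable (3 * p + 2) := by
  obtain ⟨Γ, hΓs, hΓu, hΓ, hΓe⟩ := exists_matching_tilingModEightTwo hi hp
  have hi' : (1 : ℤ) ≤ i := by omega
  have hp' : (p : ℤ) = 8 * i + 2 := by omega
  have h := isBlockTiling_tilingModEightTwo hi' hp' rfl
  have hs := isSlack_tilingModEightTwo hi' hp' rfl
  let A := steps p (8 * i - 2) (8 * i) (firstHalf i)
  let B := steps p (8 * i - 2) (8 * i) (secondHalf i)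
  have hAu : ∀ x y y', A x y → A x y' → y = y' := fun x y y' h1 h2 =>
    steps_unique (by omega) (by omega) (fun x y hxy => firstHalf_not hp' hxy) h1 h2
  have hBu : ∀ x y y', B x y → B x y' → y = y' := fun x y y' h1 h2 =>
    steps_unique (by omega) (by omega) (fun x y hxy => secondHalf_not hp' hxy) h1 h2
  have hAs : ∀ x y, A x y → A y x := steps_symm
  have hBs : ∀ x y, B x y → B y x := steps_symm
  have hA0 : ∀ y, ¬ A (2 * p) y := fun y hy => by have := steps_range hy; omega
  have hB0 : ∀ y, ¬ B (2 * p) y := fun y hy => by have := steps_range hy; omega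
  have hA1 : ∀ y, ¬ A (8 * i + 1) y := by
    intro y hy
    simp only [A, steps, firstHalf, StepTo, Cong] at hy
    omega
  have hB1 : ∀ y, ¬ B 1 y := by
    intro y hy
    simp only [B, steps, secondHalf, StepTo, Cong] at hy
    omega
  have hAa : A 0 (8 * i - 2) := .inl (by unfold firstHalf StepTo Cong; omega)
  have hBb : B (8 * i + 2) (16 * i) := .inl (by unfold secondHalf StepTo Cong; omega)
  -- Here one freed even end in each of `A` and `B` is joined to ∞ and the other to one missed odd
  -- vertex.
  let M : Fin 3 → ℤ → ℤ → Prop :=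
    ![reroute A (2 * p) 0 (8 * i - 2) (8 * i + 1) (8 * i + 1),
      reroute B (2 * p) (8 * i + 2) (16 * i) 1 1,
      fourMore Γ 0 (8 * i - 2) (8 * i + 2) (16 * i) 1 (8 * i + 1) (8 * i + 3) (16 * i + 3)]
  have hMs : ∀ i x y, M i x y → M i y x := by
    intro i
    fin_cases i
    exacts [reroute_symm hAs _ _ _ _ _, reroute_symm hBs _ _ _ _ _,
      fourMore_symm hΓs _ _ _ _ _ _ _ _]
  have hMu : ∀ i x y y', M i x y → M i x y' → y = y' := by
    intro i x y y'
    fin_cases i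
    · exact reroute_unique hAu hA0 (by omega) (by omega) (by omega) (by omega)
        (by omega) (by omega)
    · exact reroute_unique hBu hB0 (by omega) (by omega) (by omega) (by omega)
        (by omega) (by omega)
    · exact fourMore_unique hΓu (fun x y hxy => by
        have := hΓ x y hxy; exact ⟨this.2.2.2.1, this.2.2.2.2.1⟩)
        (nodup_four (by omega) (by omega) (by omega) (by omega) (by omega) (by omega))
        (nodup_four (by omega) (by omega) (by omega) (by omega) (by omega) (by omega))
        (by
          intro x hx hx'
          simp only [List.mem_cons, List.not_mem_nil, or_false] at hx hx'
          omega)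
  refine harmoniousTotalColorable_of_threeMatchings_succ G hV (h.isCherryFamily_slack hs)
    (z := 1) (τ := 0) (π := 1) (by omega) (by omega) rfl (by omega) (by omega) ?_ ?_ M hMs hMu ?_
    (a := 0) (b := 8 * i + 2) (by omega) (by omega) (by omega)
    ⟨0, .inr (.inl (.inl ⟨rfl, rfl⟩))⟩ ⟨1, .inr (.inl (.inl ⟨rfl, rfl⟩))⟩ ?_
  · intro x y h1 h2 h3 h4 h5
    obtain ⟨w, hw⟩ := h.exists_blockTranslates_add ⟨h1, h2⟩ ⟨h3, h4⟩ h5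
    exact ⟨w, .inl hw⟩
  · intro x h1 h2 h3
    obtain ⟨w, hw⟩ := exists_slackEdges h1 h2 h3 hs.pos hs.lt
    exact ⟨w, .inr hw⟩
  · intro x y h0 hxy hy hpar
    rcases cover_tilingModEightTwo hi' hp' rfl h0 hxy hy hpar with ⟨w, hS⟩ | hA | hB | hC | hC
    · exact .inl ⟨w, .inl hS⟩
    · right
      rcases reroute_of_mem (c := 2 * p) (v := 8 * i + 1) (v' := 8 * i + 1) hAs
        (fun y hy => hAu _ _ _ hy hAa)
        (fun y hy => hAu _ _ _ hy (hAs _ _ hAa)) (fun y hy => absurd hy (hA1 y))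
        (fun y hy => absurd hy (hA1 y)) hA with h1 | h1 | h1
      · exact ⟨0, h1⟩
      · exact ⟨2, .inr (.inl h1)⟩
      · unfold Single at h1; omega
    · right
      rcases reroute_of_mem (c := 2 * p) (v := 1) (v' := 1) hBs
        (fun y hy => hBu _ _ _ hy hBb)
        (fun y hy => hBu _ _ _ hy (hBs _ _ hBb)) (fun y hy => absurd hy (hB1 y))
        (fun y hy => absurd hy (hB1 y)) hB with h1 | h1 | h1
      · exact ⟨1, h1⟩
      · exact ⟨2, .inr (.inr (.inl h1))⟩
      · unfold Single at h1; omega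
    · exact .inr ⟨2, .inr (.inr (.inr (.inl hC)))⟩
    · exact .inr ⟨2, .inr (.inr (.inr (.inr hC)))⟩
  · intro x h0 h1 hx xa xb
    by_cases xa' : x = 8 * i - 2
    · subst xa'
      exact ⟨8 * i + 1, by omega, by omega, by unfold Cong; omega, by unfold Cong; omega, 0,
        .inr (.inr (.inl ⟨rfl, rfl⟩))⟩
    by_cases xb' : x = 16 * i
    · subst xb'
      exact ⟨1, by omega, by omega, by unfold Cong; omega, by unfold Cong; omega, 1,
        .inr (.inr (.inl ⟨rfl, rfl⟩))⟩
    obtain ⟨c, hc⟩ := hΓe x h0 h1 (by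
      simp only [List.mem_cons, List.not_mem_nil, or_false, not_or]
      exact ⟨xa, xa', xb, xb'⟩) (fun hx' => by
      simp only [List.mem_cons, List.not_mem_nil, or_false] at hx'
      omega)
    have h2 := hΓ x c hc
    have h3 := hΓ c x (hΓs _ _ hc)
    exact ⟨c, ⟨h3.1, h3.2.1⟩, by omega, h2.2.2.2.2.2.1, h2.2.2.2.2.2.2, 2, .inl hc⟩

/-! ### Odd p -/

theorem IsTiling.cover {p e : ℤ} {T : ℤ → ℤ → ℤ → Prop} (h : IsTiling (2 * p) T) (hp : p % 2 = 1)
    (hT : ∀ π d, π = 0 ∨ π = 1 → 0 < d → d < p → d % 2 = 0 → d ≠ e →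
      ∃ w a b, T w a b ∧ (w + a) % 2 = π ∧ (a - b = d ∨ a - b = d - 2 * p)) {u v : ℤ}
    (h0 : 0 ≤ u) (huv : u < v) (hv : v < 2 * p) (hpar : u % 2 = v % 2) :
    (∃ w, translates (2 * p) T w u v) ∨ v = u + e ∨ v = u + 2 * p - e := by
  -- As p is odd, vertices of the same parity are never antipodal, so d is even and strictly below
  -- p.
  obtain ⟨d, d0, d1, d2, hd⟩ : ∃ d, 0 < d ∧ d < p ∧ d % 2 = 0 ∧
      (v - u = d ∨ v - u = 2 * p - d) := by
    by_cases v - u < p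
    · exact ⟨v - u, by omega⟩
    · exact ⟨2 * p - (v - u), by omega⟩
  by_cases he : d = e
  · right; omega
  left
  obtain ⟨w, a, b, ht, h1, h2⟩ := hT (u % 2) d (by omega) d0 d1 d2 he
  have hn : (2 * p) % 2 = 0 := by omega
  by_cases h3 : v - u = d
  · exact h.exists_translates hn (u := u) (v := v) (by omega) (by omega)
      (h.symm _ _ _ ht) (by omega) (by unfold Cong; omega)
  · exact h.exists_translates hn (u := u) (v := v) (by omega) (by omega)
      ht (by omega) (by unfold Cong; omega)

/-! ### Odd p: p ≡ 1 mod 4 -/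

/-- The tiling for `p = 4 r + 1`. -/
def tilingModFourOne (r w a b : ℤ) : Prop :=
  Centred 0 (2 * r + 1) 1 (2 * r - 1) w a b ∨
  Centred 0 (4 * r + 1) 0 (2 * r) w a b ∨
  Centred 1 (2 * r + 1) 1 (2 * r - 1) w a b ∨
  Centred 1 1 0 (2 * r - 2) w a b ∨
  Pinned 1 (4 * r + 1) 1 w a b

/-- Inside each class the offsets are 2, 4, …, 4r. From odd to even they are the odd numbers from 2r
+ 1 to 6r + 1 except p, a set closed under negation; from even to odd they are the odd numbers from
3 - 2r to 2r - 1, together with p. The pinned pair of p and the centre 1 supplies the difference 4r,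
so nothing stays uncovered. -/
theorem isTiling_tilingModFourOne {p r : ℤ} (hr : 1 ≤ r) (hp : p = 4 * r + 1) :
    IsTiling (2 * p) (tilingModFourOne r) where
  range := by
    intro w a b h
    unfold tilingModFourOne at h
    rcases h with h | h | h | h | h <;> simp only [Centred, Pinned] at h <;> omega
  periodic := by
    intro w w' a b h hw
    exact h.imp (·.congr hw) <| Or.imp (·.congr hw) <| Or.imp (·.congr hw) <|
      Or.imp (·.congr hw) (·.congr hw)
  symm := by
    intro w a b h
    exact h.imp (·.symm) <| Or.imp (·.symm) <| Or.imp (·.symm) <|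
      Or.imp (·.symm) (·.symm (by omega))
  inj := by
    intro w a b a' b' h h' hc
    simp only [tilingModFourOne, Centred, Pinned] at h h'
    rcases hc with hc | hc | hc <;> rcases h with h | h | h | h | h <;>
      rcases h' with h' | h' | h' | h' | h' <;>
      first
      | (exfalso; omega)
      | (unfold Cong; omega)
  anti := by
    intro w a b a' b' h h' hc
    simp only [tilingModFourOne, Centred, Pinned] at h h'
    rcases hc with hc | hc | hc <;> rcases h with h | h | h | h | h <;>
      rcases h' with h' | h' | h' | h' | h' <;> omega

theorem cover_tilingModFourOne {p r : ℤ} (hr : 1 ≤ r) (hp : p = 4 * r + 1) {u v : ℤ}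
    (h0 : 0 ≤ u) (huv : u < v) (hv : v < 2 * p) (hpar : u % 2 = v % 2) :
    ∃ w, translates (2 * p) (tilingModFourOne r) w u v := by
  have h := (isTiling_tilingModFourOne hr hp).cover (e := 0) (by omega) ?_ h0 huv hv hpar
  · rcases h with h | h
    · exact h
    · omega
  rintro π d hπ d0 d1 d2 -
  obtain ⟨h, rfl⟩ : ∃ h, d = 2 * h := ⟨d / 2, by omega⟩
  rcases hπ with rfl | rfl
  · by_cases hh : h % 2 = 0
    · exact ⟨4 * r + 1 + h, 4 * r + 1 + h, 4 * r + 1 - h, .inr (.inl (by unfold Centred; omega)),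
        by omega, by omega⟩
    · exact ⟨2 * r + 1 + h, 2 * r + 1 + h, 2 * r + 1 - h, .inl (by unfold Centred; omega),
        by omega, by omega⟩
  · by_cases hr : h = 2 * r
    · exact ⟨0, 4 * r + 1, 1, .inr (.inr (.inr (.inr (by unfold Pinned; omega)))), by omega,
        by omega⟩
    by_cases hh : h % 2 = 0
    · exact ⟨h, 1 + h, 1 - h, .inr (.inr (.inr (.inl (by unfold Centred; omega)))),
        by omega, by omega⟩
    · exact ⟨2 * r + h, 2 * r + 1 + h, 2 * r + 1 - h,
        .inr (.inr (.inl (by unfold Centred; omega))), by omega, by omega⟩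

theorem harmoniousTotalColorable_even_mod_four_one {V : Type*} [Fintype V] (G : SimpleGraph V) {p r : ℕ}
    (hr : 1 ≤ r) (hp : p = 4 * r + 1) (hV : Fintype.card V = 2 * p) :
    G.HarmoniousTotalColorable (3 * p) := by
  have h := isTiling_tilingModFourOne (p := p) (r := r) (by omega) (by omega)
  have hres := harmoniousTotalColorable_of_cherryFamily G hV
    (translates (2 * p) (tilingModFourOne r))
    (by push_cast; exact h.isCherryFamily (by omega)) (m := 0) (fun _ _ _ => False)
    (fun i => i.elim0) (fun i => i.elim0) (fun x => x % 2 = 0) p p p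
    ((card_fin_le _ _ _ fun x h0 h1 h2 =>
      mem_parity.2 ⟨⟨h0, by push_cast at h1; exact h1⟩, h2⟩).trans (card_parity p (.inl rfl)).le)
    ((card_fin_le _ _ _ fun x h0 h1 (h2 : ¬ x % 2 = 0) =>
      mem_parity.2 ⟨⟨h0, by push_cast at h1; exact h1⟩, by omega⟩).trans
      (card_parity p (.inr rfl)).le) ?_ (fun _ _ _ _ => ⟨[], by simp⟩)
    (fun _ _ _ _ => ⟨[], by simp⟩)
  · have h3 : 2 * p + (0 + p) = 3 * p := by omega
    rwa [h3] at hres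
  · intro x y h0 hxy hy hpar
    have hpar : x % 2 = 0 ↔ y % 2 = 0 := hpar
    exact .inl (cover_tilingModFourOne (by omega) (by omega) h0 hxy (by push_cast at hy; exact hy)
      (by omega))

theorem harmoniousTotalColorable_odd_mod_four_one {V : Type*} [Fintype V] (G : SimpleGraph V) {p r : ℕ}
    (hr : 1 ≤ r) (hp : p = 4 * r + 1) (hV : Fintype.card V = 2 * p + 1) :
    G.HarmoniousTotalColorable (3 * p + 2) := by
  have h := isTiling_tilingModFourOne (p := p) (r := r) (by omega) (by omega)
  -- The even-to-odd offset 1 - 2r lies just below the range used, and its reverse 2r - 1 just below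
  -- the odd-to-even range.
  have hs := translates_ne (π := 1) (g := 2 * r - 1) h (by omega)
    (by
      intro w a b ht hw hc
      simp only [tilingModFourOne, Centred, Pinned, Cong] at ht hc
      rcases ht with ht | ht | ht | ht | ht <;> omega)
    (by
      intro w a b ht hw hc
      simp only [tilingModFourOne, Centred, Pinned, Cong] at ht hc
      rcases ht with ht | ht | ht | ht | ht <;> omega) (by omega) (by omega)
  have hS := (h.isCherryFamily (by omega)).union_slackEdges (by omega) (by omega) (by omega)
    (.inl (by omega)) hs.1 hs.2
  have hres := harmoniousTotalColorable_of_cherryFamily G hV _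
    (by push_cast; exact hS) (m := 0) (fun _ _ _ => False)
    (fun i => i.elim0) (fun i => i.elim0) (fun x => x % 2 = 1 ∨ x = 2 * p) (p + 1) p (p + 1)
    ?_ ?_ ?_ (fun _ _ _ _ => ⟨[], by simp⟩) (fun _ _ _ _ => ⟨[], by simp⟩)
  · have h3 : 2 * p + 1 + (0 + (p + 1)) = 3 * p + 2 := by omega
    rwa [h3] at hres
  · refine (card_fin_le (2 * p + 1) (fun x => x % 2 = 1 ∨ x = 2 * p)
      (insert (2 * (p : ℤ)) (parityClass p 1)) ?_).trans ((Finset.card_insert_le _ _).trans ?_)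
    · intro x h0 h1 h2
      push_cast at h1
      rw [Finset.mem_insert, mem_parity]
      omega
    · rw [card_parity p (.inr rfl)]
  · refine (card_fin_le (2 * p + 1) (fun x => ¬ (x % 2 = 1 ∨ x = 2 * p))
      (parityClass p 0) ?_).trans (card_parity p (.inl rfl)).le
    intro x h0 h1 h2
    push_cast at h1
    rw [mem_parity]
    omega
  · intro x y h0 hxy hy hpar
    have hpar : (x % 2 = 1 ∨ x = 2 * p) ↔ (y % 2 = 1 ∨ y = 2 * p) := hpar
    push_cast at hy
    left
    by_cases hy' : y = 2 * p
    · subst hy'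
      obtain ⟨w, hw⟩ := exists_slackEdges (p := p) (π := 1) (g := 2 * r - 1) h0 hxy (by omega)
        (by omega) (by omega)
      exact ⟨w, .inr hw⟩
    · obtain ⟨w, hw⟩ := cover_tilingModFourOne (p := p) (r := r) (by omega) (by omega) h0 hxy
        (by omega) (by omega)
      exact ⟨w, .inl hw⟩

/-! ### Odd p: p ≡ 3 mod 4 -/

/-- The edge with ends `w + x` and `w + y`, for `w` of parity `ω`. -/
def Marked (ω x y w a b : ℤ) : Prop :=
  w % 2 = ω ∧ ((a = x ∧ b = y) ∨ (a = y ∧ b = x))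

theorem Marked.symm {ω x y w a b : ℤ} (h : Marked ω x y w a b) : Marked ω x y w b a := by
  unfold Marked at *; omega

theorem Marked.congr {ω x y w w' a b : ℤ} (hw : w % 2 = w' % 2) (h : Marked ω x y w a b) :
    Marked ω x y w' a b := by
  unfold Marked at *; omega

/-- The tiling for `p = 4 r + 3`. -/
def tilingModFourThree (r w a b : ℤ) : Prop :=
  Centred 0 (2 * r + 3) 1 (2 * r - 1) w a b ∨
  Centred 0 (4 * r + 3) 0 (2 * r) w a b ∨
  Centred 1 (2 * r + 1) 1 (2 * r - 1) w a b ∨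
  Centred 1 1 0 (2 * r) w a b ∨
  Marked 0 2 1 w a b ∨
  Marked 1 (-4 * r - 3) (-4 * r - 2) w a b

set_option maxHeartbeats 1000000 in
-- As for 4r + 1, but the offsets left over, such as the centres 1 and p of the opposite-parity
-- families, are spent on crossing edges of difference 1: {x, x + 1} has colour x - 1 for odd x and
-- x + p for even x. The difference p - 1 stays uncovered.
theorem isTiling_tilingModFourThree {p r : ℤ} (hr : 0 ≤ r) (hp : p = 4 * r + 3) :
    IsTiling (2 * p) (tilingModFourThree r) where
  range := by
    intro w a b h
    unfold tilingModFourThree at h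
    rcases h with h | h | h | h | h | h <;> simp only [Centred, Marked] at h <;> omega
  periodic := by
    intro w w' a b h hw
    exact h.imp (·.congr hw) <| Or.imp (·.congr hw) <| Or.imp (·.congr hw) <|
      Or.imp (·.congr hw) <| Or.imp (·.congr hw) (·.congr hw)
  symm := by
    intro w a b h
    exact h.imp (·.symm) <| Or.imp (·.symm) <| Or.imp (·.symm) <|
      Or.imp (·.symm) <| Or.imp (·.symm) (·.symm)
  inj := by
    intro w a b a' b' h h' hc
    simp only [tilingModFourThree, Centred, Marked] at h h'
    rcases hc with hc | hc | hc <;> rcases h with h | h | h | h | h | h <;>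
      rcases h' with h' | h' | h' | h' | h' | h' <;>
      first
      | (exfalso; omega)
      | (unfold Cong; omega)
  anti := by
    intro w a b a' b' h h' hc
    simp only [tilingModFourThree, Centred, Marked] at h h'
    rcases hc with hc | hc | hc <;> rcases h with h | h | h | h | h | h <;>
      rcases h' with h' | h' | h' | h' | h' | h' <;> omega

theorem exists_translates_tilingModFourThree {p r : ℤ} (hr : 0 ≤ r) (hp : p = 4 * r + 3) {x y : ℤ}
    (hx0 : 0 ≤ x) (hx1 : x < 2 * p) (hy0 : 0 ≤ y) (hy1 : y < 2 * p)
    (hxy : Cong (2 * p) y (x + 1) ∨ Cong (2 * p) y (x - 1)) :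
    ∃ w, translates (2 * p) (tilingModFourThree r) w x y := by
  have h := isTiling_tilingModFourThree hr hp
  have key : ∀ x y, 0 ≤ x → x < 2 * p → 0 ≤ y → y < 2 * p → Cong (2 * p) y (x + 1) →
      ∃ w, translates (2 * p) (tilingModFourThree r) w x y := by
    intro x y hx0 hx1 hy0 hy1 hxy
    by_cases hx : x % 2 = 0
    · exact h.exists_translates (by omega) (u := x) (v := y) (w := 1) (a := -4 * r - 3)
        (b := -4 * r - 2) ⟨hx0, hx1⟩ ⟨hy0, hy1⟩
        (.inr (.inr (.inr (.inr (.inr (by unfold Marked; omega)))))) (by omega)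
        (by unfold Cong at *; omega)
    · exact h.exists_translates (by omega) (u := x) (v := y) (w := 0) (a := 1) (b := 2)
        ⟨hx0, hx1⟩ ⟨hy0, hy1⟩
        (.inr (.inr (.inr (.inr (.inl (by unfold Marked; omega)))))) (by omega)
        (by unfold Cong at *; omega)
  rcases hxy with hxy | hxy
  · exact key x y hx0 hx1 hy0 hy1 hxy
  · obtain ⟨w, hw⟩ := key y x hy0 hy1 hx0 hx1 (by unfold Cong at *; omega)
    exact ⟨w, (h.isCherryFamily (by omega)).symm _ _ _ hw⟩

/-- Every second edge of the two cycles of uncovered edges, for odd `p`. -/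
def firstHalfOdd (p x : ℤ) : Prop := (x < p ∧ x % 2 = 1) ∨ (p ≤ x ∧ x % 2 = 0)

/-- The other edges of these cycles, except two. -/
def secondHalfOdd (p x : ℤ) : Prop := (x < p ∧ x % 2 = 0 ∧ x ≠ 0) ∨ (p < x ∧ x % 2 = 1)

/-- As gcd(p - 1, 2p) = 2, the uncovered edges form one cycle of odd length p in each class; each
cycle leaves one edge over. -/
theorem firstHalfOdd_or {p x y : ℤ} (hp : p % 2 = 1) (h : StepTo p (p - 1) (p - 1) x y) :
    firstHalfOdd p x ∨ secondHalfOdd p x ∨ (x = 0 ∧ y = p - 1) ∨ (x = p ∧ y = 2 * p - 1) := by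
  unfold StepTo Cong firstHalfOdd secondHalfOdd at *
  omega

theorem cover_tilingModFourThree {p r : ℤ} (hr : 0 ≤ r) (hp : p = 4 * r + 3) {u v : ℤ}
    (h0 : 0 ≤ u) (huv : u < v) (hv : v < 2 * p) (hpar : u % 2 = v % 2) :
    (∃ w, translates (2 * p) (tilingModFourThree r) w u v) ∨
      steps p (p - 1) (p - 1) (firstHalfOdd p) u v ∨
      steps p (p - 1) (p - 1) (secondHalfOdd p) u v ∨
      Single 0 (p - 1) u v ∨ Single p (2 * p - 1) u v := by
  have h := (isTiling_tilingModFourThree hr hp).cover (e := p - 1) (by omega) ?_ h0 huv hv hpar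
  · rcases h with h | h
    · exact .inl h
    right
    have key : StepTo p (p - 1) (p - 1) u v ∨ StepTo p (p - 1) (p - 1) v u := by
      unfold StepTo Cong; omega
    rcases key with h' | h' <;> rcases firstHalfOdd_or (by omega) h' with h1 | h1 | h1 | h1
    exacts [.inl (.inl ⟨h1, h'⟩), .inr (.inl (.inl ⟨h1, h'⟩)), .inr (.inr (.inl (.inl h1))),
      .inr (.inr (.inr (.inl h1))), .inl (.inr ⟨h1, h'⟩), .inr (.inl (.inr ⟨h1, h'⟩)),
      .inr (.inr (.inl (.inr h1.symm))), .inr (.inr (.inr (.inr h1.symm)))]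
  rintro π d hπ d0 d1 d2 d3
  obtain ⟨h, rfl⟩ : ∃ h, d = 2 * h := ⟨d / 2, by omega⟩
  rcases hπ with rfl | rfl
  · by_cases hh : h % 2 = 0
    · exact ⟨4 * r + 3 + h, 4 * r + 3 + h, 4 * r + 3 - h, .inr (.inl (by unfold Centred; omega)),
        by omega, by omega⟩
    · exact ⟨2 * r + 3 + h, 2 * r + 3 + h, 2 * r + 3 - h, .inl (by unfold Centred; omega),
        by omega, by omega⟩
  · by_cases hh : h % 2 = 0
    · exact ⟨h, 1 + h, 1 - h, .inr (.inr (.inr (.inl (by unfold Centred; omega)))),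
        by omega, by omega⟩
    · exact ⟨2 * r + h, 2 * r + 1 + h, 2 * r + 1 - h,
        .inr (.inr (.inl (by unfold Centred; omega))), by omega, by omega⟩

/-- The edges joining antipodal vertices and, at the four ends of the two remaining edges of the
cycles, these edges. -/
def antipodal (p x y : ℤ) : Prop :=
  (0 ≤ x ∧ x < 2 * p ∧ 0 ≤ y ∧ y < 2 * p ∧ (y = x + p ∨ x = y + p) ∧
    x ≠ 0 ∧ x ≠ p - 1 ∧ x ≠ p ∧ x ≠ 2 * p - 1) ∨ Single 0 (p - 1) x y ∨ Single p (2 * p - 1) x y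

theorem antipodal_symm {p : ℤ} (x y : ℤ) (h : antipodal p x y) : antipodal p y x := by
  rcases h with h | h | h
  · left; omega
  · exact .inr (.inl h.symm)
  · exact .inr (.inr h.symm)

theorem antipodal_unique {p : ℤ} (hp : 2 ≤ p) {x y y' : ℤ} (h : antipodal p x y)
    (h' : antipodal p x y') : y = y' := by
  unfold antipodal Single at *
  rcases h with h | h | h <;> rcases h' with h' | h' | h' <;> omega

/-- A matching with an additional edge. -/
def withEdge (A : ℤ → ℤ → Prop) (c d x y : ℤ) : Prop := A x y ∨ Single c d x y

theorem withEdge_symm {A : ℤ → ℤ → Prop} (hA : ∀ x y, A x y → A y x) (c d x y : ℤ)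
    (h : withEdge A c d x y) : withEdge A c d y x := h.imp (hA _ _) (·.symm)

theorem withEdge_unique {A : ℤ → ℤ → Prop} {c d : ℤ} (hA : ∀ x y y', A x y → A x y' → y = y')
    (hc : ∀ y, ¬ A c y) (hd : ∀ y, ¬ A d y) (hcd : c ≠ d) {x y y' : ℤ}
    (h : withEdge A c d x y) (h' : withEdge A c d x y') : y = y' := by
  rcases h with h | h <;> rcases h' with h' | h'
  · exact hA _ _ _ h h'
  · rcases h' with ⟨rfl, -⟩ | ⟨rfl, -⟩
    exacts [absurd h (hc _), absurd h (hd _)]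
  · rcases h with ⟨rfl, -⟩ | ⟨rfl, -⟩
    exacts [absurd h' (hc _), absurd h' (hd _)]
  · unfold Single at h h'; omega

theorem steps_firstHalfOdd_unique {p : ℤ} (hp : p % 2 = 1) {x y y' : ℤ}
    (h : steps p (p - 1) (p - 1) (firstHalfOdd p) x y)
    (h' : steps p (p - 1) (p - 1) (firstHalfOdd p) x y') : y = y' := by
  refine steps_unique (by omega) (by omega) (fun x y hxy hx hy => ?_) h h'
  unfold StepTo Cong firstHalfOdd at *
  omega

theorem steps_secondHalfOdd_unique {p : ℤ} (hp : p % 2 = 1) {x y y' : ℤ}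
    (h : steps p (p - 1) (p - 1) (secondHalfOdd p) x y)
    (h' : steps p (p - 1) (p - 1) (secondHalfOdd p) x y') : y = y' := by
  refine steps_unique (by omega) (by omega) (fun x y hxy hx hy => ?_) h h'
  unfold StepTo Cong secondHalfOdd at *
  omega

theorem not_steps_firstHalfOdd {p x y : ℤ} (hp : p % 2 = 1) (hx : x = p - 1 ∨ x = 2 * p - 1) :
    ¬ steps p (p - 1) (p - 1) (firstHalfOdd p) x y := by
  intro h
  unfold steps StepTo Cong firstHalfOdd at h
  omega

theorem not_steps_secondHalfOdd {p x y : ℤ} (hp : p % 2 = 1) (hx : x = 0 ∨ x = p) :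
    ¬ steps p (p - 1) (p - 1) (secondHalfOdd p) x y := by
  intro h
  unfold steps StepTo Cong secondHalfOdd at h
  omega

theorem not_steps_infinity {p e f y : ℤ} {P : ℤ → Prop} : ¬ steps p e f P (2 * p) y :=
  fun h => by have := steps_range h; omega

theorem harmoniousTotalColorable_even_mod_four_three {V : Type*} [Fintype V] (G : SimpleGraph V)
    {p r : ℕ} (hp : p = 4 * r + 3) (hV : Fintype.card V = 2 * p) :
    G.HarmoniousTotalColorable (3 * p) := by
  have hr' : (0 : ℤ) ≤ r := by omega
  have hp' : (p : ℤ) = 4 * r + 3 := by omega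
  have h := isTiling_tilingModFourThree hr' hp'
  have hodd : (p : ℤ) % 2 = 1 := by omega
  let A := steps p (p - 1) (p - 1) (firstHalfOdd p)
  let B := steps p (p - 1) (p - 1) (secondHalfOdd p)
  -- For odd p the antipodal edges are crossing. The third matching has the two leftover edges in
  -- place of the antipodal edges at their four ends; these two antipodal edges fit into `A` and
  -- `B`, which miss exactly their ends.
  let M : Fin 3 → ℤ → ℤ → Prop :=
    ![withEdge A (p - 1) (2 * p - 1), withEdge B 0 p, antipodal p]
  refine harmoniousTotalColorable_of_threeMatchings G hV (h.isCherryFamily (by omega)) (z := 1)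
    (by omega) (by omega) rfl (by omega)
    (fun x y h0 h1 h2 h3 h4 => exists_translates_tilingModFourThree hr' hp' h0 h1 h2 h3 h4) M ?_ ?_ ?_ ?_
  · intro i
    fin_cases i
    exacts [withEdge_symm steps_symm _ _, withEdge_symm steps_symm _ _, antipodal_symm]
  · intro i x y y'
    fin_cases i
    · exact withEdge_unique (A := A) (c := p - 1) (d := 2 * p - 1)
        (fun _ _ _ => steps_firstHalfOdd_unique hodd)
        (fun y => not_steps_firstHalfOdd hodd (.inl rfl))
        (fun y => not_steps_firstHalfOdd hodd (.inr rfl)) (by omega)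
    · exact withEdge_unique (A := B) (c := 0) (d := p)
        (fun _ _ _ => steps_secondHalfOdd_unique hodd)
        (fun y => not_steps_secondHalfOdd hodd (.inl rfl))
        (fun y => not_steps_secondHalfOdd hodd (.inr rfl)) (by omega)
    · exact antipodal_unique (by omega)
  · intro x y h0 hxy hy hpar
    rcases cover_tilingModFourThree hr' hp' h0 hxy hy hpar with hS | hA | hB | hC | hC
    exacts [.inl hS, .inr ⟨0, .inl hA⟩, .inr ⟨1, .inl hB⟩, .inr ⟨2, .inr (.inl hC)⟩,
      .inr ⟨2, .inr (.inr hC)⟩]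
  · intro x h0 h1
    obtain ⟨c, hc⟩ : ∃ c : ℤ, (0 ≤ c ∧ c < 2 * p) ∧ (c = x + p ∨ x = c + p) := by
      by_cases hx : x < p
      · exact ⟨x + p, by omega⟩
      · exact ⟨x - p, by omega⟩
    refine ⟨c, hc.1, by omega, by unfold Cong; omega, by unfold Cong; omega, ?_⟩
    by_cases hx : x = 0 ∨ x = p
    · exact ⟨1, .inr (by unfold Single; omega)⟩
    by_cases hx' : x = p - 1 ∨ x = 2 * p - 1
    · exact ⟨0, .inr (by unfold Single; omega)⟩
    exact ⟨2, .inl (by omega)⟩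

theorem harmoniousTotalColorable_odd_mod_four_three {V : Type*} [Fintype V] (G : SimpleGraph V)
    {p r : ℕ} (hp : p = 4 * r + 3) (hV : Fintype.card V = 2 * p + 1) :
    G.HarmoniousTotalColorable (3 * p + 2) := by
  have hr' : (0 : ℤ) ≤ r := by omega
  have hp' : (p : ℤ) = 4 * r + 3 := by omega
  have h := isTiling_tilingModFourThree hr' hp'
  have hodd : (p : ℤ) % 2 = 1 := by omega
  -- The even-to-odd offset -(2r + 1) and its reverse 2r + 1 lie just below the ranges used.
  have hs := translates_ne (π := 1) (g := 2 * r + 1) h (by omega)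
    (by
      intro w a b ht hw hc
      simp only [tilingModFourThree, Centred, Marked, Cong] at ht hc
      rcases ht with ht | ht | ht | ht | ht | ht <;> omega)
    (by
      intro w a b ht hw hc
      simp only [tilingModFourThree, Centred, Marked, Cong] at ht hc
      rcases ht with ht | ht | ht | ht | ht | ht <;> omega) (by omega) (by omega)
  have hS := (h.isCherryFamily (by omega)).union_slackEdges (by omega) (by omega) (by omega)
    (.inl (by omega)) hs.1 hs.2
  let A := steps p (p - 1) (p - 1) (firstHalfOdd p)
  let B := steps p (p - 1) (p - 1) (secondHalfOdd p)
  -- The even vertices p - 1 and 0, missed by `A` and `B`, are joined to ∞; every other even vertex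
  -- keeps its antipodal edge.
  let M : Fin 3 → ℤ → ℤ → Prop :=
    ![withEdge A (2 * p) (p - 1), withEdge B (2 * p) 0, antipodal p]
  refine harmoniousTotalColorable_of_threeMatchings_succ G hV hS (z := 1) (τ := 0) (π := 1)
    (by omega) (by omega) rfl (by omega) (by omega) ?_ ?_ M ?_ ?_ ?_ (a := p - 1) (b := 0)
    (by omega) (by omega) (by omega) ⟨0, .inr (.inl ⟨rfl, rfl⟩)⟩ ⟨1, .inr (.inl ⟨rfl, rfl⟩)⟩ ?_
  · intro x y h0 h1 h2 h3 h4
    obtain ⟨w, hw⟩ := exists_translates_tilingModFourThree hr' hp' h0 h1 h2 h3 h4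
    exact ⟨w, .inl hw⟩
  · intro x h1 h2 h3
    obtain ⟨w, hw⟩ := exists_slackEdges (p := p) (π := 1) (g := 2 * r + 1) h1 h2 h3
      (by omega) (by omega)
    exact ⟨w, .inr hw⟩
  · intro i
    fin_cases i
    exacts [withEdge_symm steps_symm _ _, withEdge_symm steps_symm _ _, antipodal_symm]
  · intro i x y y'
    fin_cases i
    · exact withEdge_unique (A := A) (c := 2 * p) (d := p - 1)
        (fun _ _ _ => steps_firstHalfOdd_unique hodd)
        (fun y => not_steps_infinity)
        (fun y => not_steps_firstHalfOdd hodd (.inl rfl)) (by omega)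
    · exact withEdge_unique (A := B) (c := 2 * p) (d := 0)
        (fun _ _ _ => steps_secondHalfOdd_unique hodd)
        (fun y => not_steps_infinity)
        (fun y => not_steps_secondHalfOdd hodd (.inl rfl)) (by omega)
    · exact antipodal_unique (by omega)
  · intro x y h0 hxy hy hpar
    rcases cover_tilingModFourThree hr' hp' h0 hxy hy hpar with ⟨w, hS⟩ | hA | hB | hC | hC
    exacts [.inl ⟨w, .inl hS⟩, .inr ⟨0, .inl hA⟩, .inr ⟨1, .inl hB⟩, .inr ⟨2, .inr (.inl hC)⟩,
      .inr ⟨2, .inr (.inr hC)⟩]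
  · intro x h0 h1 hx xa xb
    obtain ⟨c, hc⟩ : ∃ c : ℤ, (0 ≤ c ∧ c < 2 * p) ∧ (c = x + p ∨ x = c + p) := by
      by_cases hx : x < p
      · exact ⟨x + p, by omega⟩
      · exact ⟨x - p, by omega⟩
    exact ⟨c, hc.1, by omega, by unfold Cong; omega, by unfold Cong; omega, 2, .inl (by omega)⟩

/-! ### Small orders by tables -/

/-- The entry of a table. -/
def entry (L : List (List ℕ)) (u v : ℕ) : ℕ := (L.getD u []).getD v 0

/-- The entries smaller than `k` of the table `L` are the colours of the edges in a harmonious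
total colouring of a graph with `n` vertices, which have the colours `0, …, n - 1`. -/
def isColorTable (n k : ℕ) (L : List (List ℕ)) : Bool :=
  (List.range n).all fun u => (List.range n).all fun v =>
    entry L u v == entry L v u && (decide (k ≤ entry L u v) || (entry L u v != u &&
      (List.range n).all fun v' => (v == v' || entry L u v != entry L u v') &&
        (decide (n ≤ entry L u v) || entry L (entry L u v) v' != u)))

theorem harmoniousTotalColorable_of_table {V : Type*} [Fintype V] (G : SimpleGraph V) {n k : ℕ}
    (e : V ≃ Fin n) (L : List (List ℕ)) (hnk : n ≤ k) (hL : isColorTable n k L = true)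
    (hG : ∀ u v, G.Adj u v → entry L (e u) (e v) < k) : G.HarmoniousTotalColorable k := by
  have hcard : Fintype.card V = n := by rw [Fintype.card_congr e, Fintype.card_fin]
  have hL' : ∀ u < n, ∀ v < n, entry L u v = entry L v u ∧ (k ≤ entry L u v ∨ (entry L u v ≠ u ∧
      ∀ v' < n, (v = v' ∨ entry L u v ≠ entry L u v') ∧
        (n ≤ entry L u v ∨ entry L (entry L u v) v' ≠ u))) := by
    simpa [isColorTable] using hL
  let φ : ℕ → V ⊕ ℕ := fun c => if h : c < n then Sum.inl (e.symm ⟨c, h⟩) else Sum.inr (c - n)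
  have hφl : ∀ c w, φ c = Sum.inl w → c = e w := by
    intro c w h
    by_cases hc : c < n
    · simp only [φ, dif_pos hc, Sum.inl.injEq] at h
      rw [← h, Equiv.apply_symm_apply]
    · simp only [φ, dif_neg hc, reduceCtorEq] at h
  have hφr : ∀ c m, φ c = Sum.inr m → c = n + m := by
    intro c m h
    by_cases hc : c < n
    · simp only [φ, dif_pos hc, reduceCtorEq] at h
    · simp only [φ, dif_neg hc, Sum.inr.injEq] at h
      omega
  have hφ : ∀ c c', φ c = φ c' → c = c' := by
    intro c c' h
    rcases h' : φ c' with w | m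
    · rw [hφl _ _ h', hφl _ _ (h.trans h')]
    · rw [hφr _ _ h', hφr _ _ (h.trans h')]
  have hres := harmoniousTotalColorable_of_edgeColoring G (k - n)
    (fun u v => φ (entry L (e u) (e v))) ?_ ?_ ?_ ?_ ?_
  · rwa [hcard, Nat.add_sub_cancel' hnk] at hres
  · intro u v
    exact congrArg φ (hL' _ (e u).2 _ (e v).2).1
  · intro u v m huv h
    have := hφr _ _ h
    have := hG u v huv
    omega
  · intro u v huv h
    have h1 := hφl _ _ h
    have h2 := hG u v huv
    rcases (hL' _ (e u).2 _ (e v).2).2 with h3 | h3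
    · omega
    · exact h3.1 h1
  · intro u v v' huv huv' h
    have h1 := hφ _ _ h
    have h2 := hG u v huv
    rcases (hL' _ (e u).2 _ (e v).2).2 with h3 | h3
    · omega
    · rcases (h3.2 _ (e v').2).1 with h4 | h4
      · exact e.injective (Fin.ext h4)
      · exact absurd h1 h4
  · intro u v w v' huv hwv' h h'
    have h1 := hφl _ _ h
    have h2 := hφl _ _ h'
    have h3 := hG u v huv
    rcases (hL' _ (e u).2 _ (e v).2).2 with h4 | h4
    · omega
    · rcases (h4.2 _ (e v').2).2 with h5 | h5
      · have := (e w).2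
        omega
      · rw [h1] at h5
        exact h5 h2

/-- Only entries off the diagonal need to be colours; an entry `k` on the diagonal marks a non-edge.
-/
theorem harmoniousTotalColorable_of_complete_table {V : Type*} [Fintype V] (G : SimpleGraph V)
    {n k : ℕ} (hV : Fintype.card V = n) (L : List (List ℕ)) (hnk : n ≤ k)
    (hL : isColorTable n k L = true)
    (hL' : ((List.range n).all fun u => (List.range n).all fun v =>
      u == v || decide (entry L u v < k)) = true) : G.HarmoniousTotalColorable k := by
  let e : V ≃ Fin n := Fintype.equivFinOfCardEq hV
  have hL'' : ∀ u < n, ∀ v < n, u = v ∨ entry L u v < k := by simpa using hL'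
  refine harmoniousTotalColorable_of_table G e L hnk hL fun u v huv => ?_
  rcases hL'' _ (e u).2 _ (e v).2 with h | h
  · exact absurd (e.injective (Fin.ext h)) huv.ne
  · exact h

/-- A harmonious total colouring of the complete graph with 2 vertices. -/
def tableTwo : List (List ℕ) := [
  [3, 2],
  [2, 3]]

theorem harmoniousTotalColorable_two {V : Type*} [Fintype V] (G : SimpleGraph V)
    (hV : Fintype.card V = 2) : G.HarmoniousTotalColorable 3 :=
  harmoniousTotalColorable_of_complete_table G hV tableTwo (by norm_num)
    (by decide +kernel) (by decide +kernel)

/-- A harmonious total colouring of the complete graph with 3 vertices. -/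
def tableThree : List (List ℕ) := [
  [5, 2, 3],
  [2, 5, 4],
  [3, 4, 5]]

theorem harmoniousTotalColorable_three {V : Type*} [Fintype V] (G : SimpleGraph V)
    (hV : Fintype.card V = 3) : G.HarmoniousTotalColorable 5 :=
  harmoniousTotalColorable_of_complete_table G hV tableThree (by norm_num)
    (by decide +kernel) (by decide +kernel)

/-- A harmonious total colouring of the complete graph with 5 vertices. -/
def tableFive : List (List ℕ) := [
  [8, 7, 6, 5, 3],
  [7, 8, 5, 6, 2],
  [6, 5, 8, 7, 0],
  [5, 6, 7, 8, 1],
  [3, 2, 0, 1, 8]]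

theorem harmoniousTotalColorable_five {V : Type*} [Fintype V] (G : SimpleGraph V)
    (hV : Fintype.card V = 5) : G.HarmoniousTotalColorable 8 :=
  harmoniousTotalColorable_of_complete_table G hV tableFive (by norm_num)
    (by decide +kernel) (by decide +kernel)

/-- A harmonious total colouring of the complete graph with 9 vertices. -/
def tableNine : List (List ℕ) := [
  [14, 2, 3, 4, 5, 9, 10, 1, 6],
  [2, 14, 4, 5, 6, 10, 13, 12, 11],
  [3, 4, 14, 12, 10, 7, 11, 9, 13],
  [4, 5, 12, 14, 13, 11, 9, 10, 1],
  [5, 6, 10, 13, 14, 8, 12, 11, 9],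
  [9, 10, 7, 11, 8, 14, 2, 13, 12],
  [10, 13, 11, 9, 12, 2, 14, 3, 7],
  [1, 12, 9, 10, 11, 13, 3, 14, 0],
  [6, 11, 13, 1, 9, 12, 7, 0, 14]]

theorem harmoniousTotalColorable_nine {V : Type*} [Fintype V] (G : SimpleGraph V)
    (hV : Fintype.card V = 9) : G.HarmoniousTotalColorable 14 :=
  harmoniousTotalColorable_of_complete_table G hV tableNine (by norm_num)
    (by decide +kernel) (by decide +kernel)

/-- A harmonious total colouring of the complete graph with 12 vertices. -/
def tableTwelve : List (List ℕ) := [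
  [18, 7, 9, 16, 11, 13, 15, 17, 12, 14, 3, 5],
  [7, 18, 17, 2, 14, 12, 4, 10, 13, 16, 0, 15],
  [9, 17, 18, 7, 0, 14, 11, 12, 15, 6, 16, 13],
  [16, 2, 7, 18, 17, 15, 13, 5, 14, 12, 6, 1],
  [11, 14, 0, 17, 18, 2, 7, 13, 3, 15, 12, 10],
  [13, 12, 14, 15, 2, 18, 1, 9, 4, 8, 17, 16],
  [15, 4, 11, 13, 7, 1, 18, 14, 0, 17, 8, 12],
  [17, 10, 12, 5, 13, 9, 14, 18, 16, 11, 15, 8],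
  [12, 13, 15, 14, 3, 4, 0, 16, 18, 1, 2, 17],
  [14, 16, 6, 12, 15, 8, 17, 11, 1, 18, 13, 3],
  [3, 0, 16, 6, 12, 17, 8, 15, 2, 13, 18, 14],
  [5, 15, 13, 1, 10, 16, 12, 8, 17, 3, 14, 18]]

theorem harmoniousTotalColorable_twelve {V : Type*} [Fintype V] (G : SimpleGraph V)
    (hV : Fintype.card V = 12) : G.HarmoniousTotalColorable 18 :=
  harmoniousTotalColorable_of_complete_table G hV tableTwelve (by norm_num)
    (by decide +kernel) (by decide +kernel)

/-- A harmonious total colouring of the complete graph with 13 vertices. -/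
def tableThirteen : List (List ℕ) := [
  [20, 16, 5, 17, 1, 8, 18, 4, 19, 6, 13, 15, 14],
  [16, 20, 13, 2, 8, 12, 14, 19, 10, 18, 17, 9, 15],
  [5, 13, 20, 0, 15, 18, 10, 16, 11, 19, 7, 17, 4],
  [17, 2, 0, 20, 19, 15, 7, 1, 12, 13, 16, 14, 6],
  [1, 8, 15, 19, 20, 16, 17, 18, 6, 14, 3, 13, 11],
  [8, 12, 18, 15, 16, 20, 1, 14, 3, 17, 4, 10, 13],
  [18, 14, 10, 7, 17, 1, 20, 15, 13, 16, 19, 5, 2],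
  [4, 19, 16, 1, 18, 14, 15, 20, 9, 5, 12, 0, 17],
  [19, 10, 11, 12, 6, 3, 13, 9, 20, 2, 14, 16, 18],
  [6, 18, 19, 13, 14, 17, 16, 5, 2, 20, 15, 3, 0],
  [13, 17, 7, 16, 3, 4, 19, 12, 14, 15, 20, 18, 9],
  [15, 9, 17, 14, 13, 10, 5, 0, 16, 3, 18, 20, 19],
  [14, 15, 4, 6, 11, 13, 2, 17, 18, 0, 9, 19, 20]]

theorem harmoniousTotalColorable_thirteen {V : Type*} [Fintype V] (G : SimpleGraph V)
    (hV : Fintype.card V = 13) : G.HarmoniousTotalColorable 20 :=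
  harmoniousTotalColorable_of_complete_table G hV tableThirteen (by norm_num)
    (by decide +kernel) (by decide +kernel)

/-- A harmonious total colouring of the complete graph with 4 vertices without an edge. -/
def tableFour : List (List ℕ) := [
  [6, 6, 5, 4],
  [6, 6, 4, 5],
  [5, 4, 6, 1],
  [4, 5, 1, 6]]

/-- Two transpositions move the missing edge to the vertices 0 and 1, whose table entry 6 is not a
colour. -/
theorem harmoniousTotalColorable_four {V : Type*} [Fintype V] (G : SimpleGraph V)
    (hV : Fintype.card V = 4) {x y : V} (hxy : x ≠ y) (h : ¬ G.Adj x y) :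
    G.HarmoniousTotalColorable 6 := by
  classical
  let e₀ : V ≃ Fin 4 := Fintype.equivFinOfCardEq hV
  let e₁ : V ≃ Fin 4 := e₀.trans (Equiv.swap (e₀ x) 0)
  have h1 : e₁ x = 0 := by simp [e₁]
  let e₂ : V ≃ Fin 4 := e₁.trans (Equiv.swap (e₁ y) 1)
  have h2 : e₂ y = 1 := by simp [e₂]
  have h3 : e₂ x = 0 := by
    have hne : (0 : Fin 4) ≠ e₁ y := fun h0 => hxy (e₁.injective (h1.trans h0))
    simp only [e₂, Equiv.trans_apply, h1]
    exact Equiv.swap_apply_of_ne_of_ne hne (by decide)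
  have key : ∀ a b : Fin 4, a ≠ b → ¬ (a = 0 ∧ b = 1) → ¬ (a = 1 ∧ b = 0) →
      entry tableFour a b < 6 := by decide
  refine harmoniousTotalColorable_of_table G e₂ tableFour (by norm_num) (by decide +kernel) ?_
  intro u v huv
  refine key _ _ (fun h0 => huv.ne (e₂.injective h0)) ?_ ?_
  · rintro ⟨hu, hv⟩
    rw [← h3] at hu
    rw [← h2] at hv
    rw [e₂.injective hu, e₂.injective hv] at huv
    exact h huv
  · rintro ⟨hu, hv⟩
    rw [← h2] at hu
    rw [← h3] at hv
    rw [e₂.injective hu, e₂.injective hv] at huv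
    exact h huv.symm

/-! ### All orders together -/

theorem harmoniousTotalColorable_even {V : Type*} [Fintype V] (G : SimpleGraph V) {p : ℕ}
    (hV : Fintype.card V = 2 * p) (hp : 1 ≤ p) (hp2 : p ≠ 2) :
    G.HarmoniousTotalColorable (3 * p) := by
  by_cases h1 : p = 1
  · subst h1
    exact harmoniousTotalColorable_two G hV
  by_cases h6 : p = 6
  · subst h6
    exact harmoniousTotalColorable_twelve G hV
  have h : p % 4 = 1 ∨ p % 4 = 3 ∨ p % 8 = 0 ∨ p % 8 = 2 ∨ p % 8 = 4 ∨ p % 8 = 6 := by omega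
  rcases h with h | h | h | h | h | h
  · exact harmoniousTotalColorable_even_mod_four_one G (r := p / 4) (by omega) (by omega) hV
  · exact harmoniousTotalColorable_even_mod_four_three G (r := p / 4) (by omega) hV
  · exact harmoniousTotalColorable_even_mod_eight_zero G (i := p / 8) (by omega) (by omega) hV
  · exact harmoniousTotalColorable_even_mod_eight_two G (i := p / 8) (by omega) (by omega) hV
  · exact harmoniousTotalColorable_even_mod_eight_four G (j := p / 8) (by omega) hV
  · exact harmoniousTotalColorable_even_mod_eight_six G (i := p / 8) (by omega) (by omega) hV

theorem harmoniousTotalColorable_odd {V : Type*} [Fintype V] (G : SimpleGraph V) {p : ℕ}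
    (hV : Fintype.card V = 2 * p + 1) (hp : 1 ≤ p) : G.HarmoniousTotalColorable (3 * p + 2) := by
  by_cases h1 : p = 1
  · subst h1
    exact harmoniousTotalColorable_three G hV
  by_cases h2 : p = 2
  · subst h2
    exact harmoniousTotalColorable_five G hV
  -- The tiling exists for p = 4, but the third matching with ∞ needs p ≥ 8.
  by_cases h4 : p = 4
  · subst h4
    exact harmoniousTotalColorable_nine G hV
  by_cases h6 : p = 6
  · subst h6
    exact harmoniousTotalColorable_thirteen G hV
  have h : p % 4 = 1 ∨ p % 4 = 3 ∨ p % 8 = 0 ∨ p % 8 = 2 ∨ p % 8 = 4 ∨ p % 8 = 6 := by omega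
  rcases h with h | h | h | h | h | h
  · exact harmoniousTotalColorable_odd_mod_four_one G (r := p / 4) (by omega) (by omega) hV
  · exact harmoniousTotalColorable_odd_mod_four_three G (r := p / 4) (by omega) hV
  · exact harmoniousTotalColorable_odd_mod_eight_zero G (i := p / 8) (by omega) (by omega) hV
  · exact harmoniousTotalColorable_odd_mod_eight_two G (i := p / 8) (by omega) (by omega) hV
  · exact harmoniousTotalColorable_odd_mod_eight_four G (j := p / 8) (by omega) (by omega) hV
  · exact harmoniousTotalColorable_odd_mod_eight_six G (i := p / 8) (by omega) (by omega) hV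

theorem harmoniousTotalColorable_zero {V : Type*} [Fintype V] (G : SimpleGraph V)
    (hV : Fintype.card V = 0) : G.HarmoniousTotalColorable 0 := by
  have : IsEmpty V := Fintype.card_eq_zero_iff.1 hV
  have h := harmoniousTotalColorable_of_edgeColoring G 0 (fun u _ => isEmptyElim u)
    (fun u => isEmptyElim u) (fun u => isEmptyElim u) (fun u => isEmptyElim u)
    (fun u => isEmptyElim u) (fun u => isEmptyElim u)
  rwa [hV] at h

end HarmoniousTotal

theorem mainTheorem3 {V : Type*} [Fintype V] (G : SimpleGraph V)
    (h₁ : IsEmpty (G ≃g SimpleGraph.completeGraph (Fin 1)))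
    (h₄ : IsEmpty (G ≃g SimpleGraph.completeGraph (Fin 4))) :
    G.harmoniousTotalChromaticNumber ≤
      ((⌈(3 / 2 : ℚ) * (Fintype.card V : ℚ)⌉₊ : ℕ) : ℕ∞) := by
  have bound : ∀ k : ℕ, G.HarmoniousTotalColorable k →
      k ≤ ⌈(3 / 2 : ℚ) * (Fintype.card V : ℚ)⌉₊ → G.harmoniousTotalChromaticNumber ≤
        ((⌈(3 / 2 : ℚ) * (Fintype.card V : ℚ)⌉₊ : ℕ) : ℕ∞) := fun k hk h =>
    (iInf₂_le k hk).trans (Nat.cast_le.2 h)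
  obtain ⟨p, hp | hp⟩ : ∃ p, Fintype.card V = 2 * p ∨ Fintype.card V = 2 * p + 1 :=
    ⟨Fintype.card V / 2, by omega⟩
  · refine bound (3 * p) ?_ ?_
    · by_cases h0 : p = 0
      · subst h0
        exact HarmoniousTotal.harmoniousTotalColorable_zero G hp
      by_cases h2 : p = 2
      · subst h2
        obtain ⟨x, y, hxy, h⟩ : ∃ x y, x ≠ y ∧ ¬ G.Adj x y := by
          by_contra hc
          refine h₄.false ⟨Fintype.equivFinOfCardEq hp, fun {x y} => ?_⟩
          rw [SimpleGraph.completeGraph_eq_top, SimpleGraph.top_adj]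
          refine ⟨fun hxy => ?_, fun hxy h => hxy.ne ((Fintype.equivFinOfCardEq hp).injective h)⟩
          by_contra h
          exact hc ⟨x, y, fun h' => hxy (congrArg _ h'), h⟩
        exact HarmoniousTotal.harmoniousTotalColorable_four G hp hxy h
      exact HarmoniousTotal.harmoniousTotalColorable_even G hp (by omega) h2
    · have h := Nat.le_ceil ((3 / 2 : ℚ) * (Fintype.card V : ℚ))
      rw [hp] at h ⊢
      have h' : (3 / 2 : ℚ) * ((2 * p : ℕ) : ℚ) = ((3 * p : ℕ) : ℚ) := by push_cast; ring
      rw [h'] at h ⊢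
      exact_mod_cast h
  · refine bound (3 * p + 2) ?_ ?_
    · by_cases h0 : p = 0
      · subst h0
        refine (h₁.false ⟨Fintype.equivFinOfCardEq hp, fun {x y} => ?_⟩).elim
        have hxy : x = y := Fintype.card_le_one_iff.1 hp.le x y
        subst hxy
        simp
      exact HarmoniousTotal.harmoniousTotalColorable_odd G hp (by omega)
    -- Here 3n/2 = 3p + 3/2 exceeds 3p + 1, so its ceiling is at least 3p + 2.
    · rw [Nat.succ_le_iff, Nat.lt_ceil, hp]
      push_cast
      linarith
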